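/- Let $k$ be a field, $\mathfrak{g}$ a finite-dimensional Lie algebra over $k$, $n=\dim_k\mathfrak{g}$, and $U(\mathfrak{g})$ its universal enveloping algebra. For a $k$-central $U(\mathfrak{g})$-bimodule $M$ (that is, $k$ acts on $M$ in the same way from the left and from the right), denote by $H^q(U(\mathfrak{g}),M)$ and $H_q(U(\mathfrak{g}),M)$ the Hochschild cohomology and homology of the $k$-algebra $U(\mathfrak{g})$ with coefficients in $M$; both are zero for $q<0$. Regard $\bigwedge^n\mathfrak{g}^*$ as a $U(\mathfrak{g})$-bimodule with trivial left action and with the right coadjoint action, i.e. the right action extending $(f\cdot x)(y)=f([x,y])$ $(f\in\mathfrak{g}^*,\ x,y\in\mathfrak{g})$ by derivations, and let $M\otimes_k\bigwedge^n\mathfrak{g}^*$ be the $U(\mathfrak{g})$-bimodule on which $x\in\mathfrak{g}$ acts by $x(m\otimes w)=xm\otimes w$ and $(m\otimes w)x=mx\otimes w+m\otimes w\cdot x$. Then for every $k$-central $U(\mathfrak{g})$-bimodule $M$ and every integer $q$ there is an isomorphism of $k$-vector spaces $$H^q\bigl(U(\mathfrak{g}),M\bigr)\;\cong\;H_{n-q}\Bigl(U(\mathfrak{g}),\,M\otimes_k\textstyle\bigwedge^n\mathfrak{g}^*\Bigr).$$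 In particular both sides vanish unless $0\le q\le n$. -/

import Mathlib

open scoped TensorProduct

/-! ### Hochschild cohomology and homology of a `k`-algebra

Let `A` be a `k`-algebra. A `k`-central `A`-bimodule is a `k`-module `M` with commuting actions of
`A` (on the left) and `Aᵐᵒᵖ` (on the right, `m · a = MulOpposite.op a • m`), both compatible with
the action of `k`; compatibility (`IsScalarTower`) says that `k` acts from the left and from the
right through `k → A` by one and the same scalar multiplication. -/

namespace HochschildDuality

section Hochschild

variable (k : Type*) [Field k] (A : Type*) [Ring A] [Algebra k A]

/-- Right multiplication by `a` on a right `A`-module, linear in `a`. -/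
noncomputable def rightMul (M : Type*) [AddCommGroup M] [Module k M] [Module Aᵐᵒᵖ M]
    [IsScalarTower k Aᵐᵒᵖ M] : A →ₗ[k] Module.End k M :=
  (Algebra.lsmul k k M : Aᵐᵒᵖ →ₐ[k] Module.End k M).toLinearMap ∘ₗ
    (MulOpposite.opLinearEquiv k : A ≃ₗ[k] Aᵐᵒᵖ).toLinearMap

/-- Left multiplication by `a` on a left `A`-module, linear in `a`. -/
noncomputable def leftMul (M : Type*) [AddCommGroup M] [Module k M] [Module A M]
    [IsScalarTower k A M] : A →ₗ[k] Module.End k M :=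
  (Algebra.lsmul k k M : A →ₐ[k] Module.End k M).toLinearMap

theorem rightMul_apply (M : Type*) [AddCommGroup M] [Module k M] [Module Aᵐᵒᵖ M]
    [IsScalarTower k Aᵐᵒᵖ M] (a : A) (m : M) : rightMul k A M a m = MulOpposite.op a • m := rfl

theorem leftMul_apply (M : Type*) [AddCommGroup M] [Module k M] [Module A M]
    [IsScalarTower k A M] (a : A) (m : M) : leftMul k A M a m = a • m := rfl

variable {k A}

theorem contractNth_update {q : ℕ} (j : Fin q) (a : Fin (q + 1) → A) (i : Fin (q + 1)) :
    ∃ (l : Fin q) (L : A →ₗ[k] A), ∀ x : A,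
      Fin.contractNth j.castSucc (· * ·) (Function.update a i x) =
        Function.update (Fin.contractNth j.castSucc (· * ·) a) l (L x) := by
  obtain ⟨i, hi⟩ := i
  obtain ⟨j, hj⟩ := j
  rcases lt_trichotomy i j with h | h | h
  · refine ⟨⟨i, by omega⟩, LinearMap.id, fun x => funext fun l => ?_⟩
    simp only [Fin.contractNth, Function.update_apply, Fin.ext_iff, Fin.val_castSucc, Fin.val_succ,
      LinearMap.id_apply]
    split_ifs <;> first | rfl | omega
  · refine ⟨⟨j, hj⟩, LinearMap.mulRight k (a (Fin.succ ⟨j, hj⟩)), fun x => funext fun l => ?_⟩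
    simp only [Fin.contractNth, Function.update_apply, Fin.ext_iff, Fin.val_castSucc, Fin.val_succ,
      LinearMap.mulRight_apply]
    split_ifs <;> first | rfl | omega | (congr 3; apply Fin.ext; assumption)
  · by_cases h' : i = j + 1
    · refine ⟨⟨j, hj⟩, LinearMap.mulLeft k (a (Fin.castSucc ⟨j, hj⟩)), fun x => funext fun l => ?_⟩
      simp only [Fin.contractNth, Function.update_apply, Fin.ext_iff, Fin.val_castSucc,
        Fin.val_succ, LinearMap.mulLeft_apply]
      split_ifs <;> first | rfl | omega | (congr 3; apply Fin.ext; assumption)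
    · refine ⟨⟨i - 1, by omega⟩, LinearMap.id, fun x => funext fun l => ?_⟩
      simp only [Fin.contractNth, Function.update_apply, Fin.ext_iff, Fin.val_castSucc,
        Fin.val_succ, LinearMap.id_apply]
      split_ifs <;> first | rfl | omega

/-- The multilinear map `(a₀, …, a_q) ↦ f (a₀, …, a_j a_{j+1}, …, a_q)`. -/
noncomputable def mulContract {N : Type*} [AddCommGroup N] [Module k N] {q : ℕ} (j : Fin q)
    (f : MultilinearMap k (fun _ : Fin q => A) N) :
    MultilinearMap k (fun _ : Fin (q + 1) => A) N :=
  MultilinearMap.mk' (fun a => f (Fin.contractNth j.castSucc (· * ·) a))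
    (fun a i x y => by
      obtain ⟨l, L, h⟩ := contractNth_update (k := k) j a i
      simp only [h, map_add, MultilinearMap.map_update_add])
    (fun a i c x => by
      obtain ⟨l, L, h⟩ := contractNth_update (k := k) j a i
      simp only [h, map_smul, MultilinearMap.map_update_smul])

/-- The multilinear map `(a₀, …, a_q) ↦ L a₀ (f (a₁, …, a_q))`. -/
noncomputable def headMul {N P : Type*} [AddCommGroup N] [Module k N] [AddCommGroup P] [Module k P]
    {q : ℕ} (L : A →ₗ[k] N →ₗ[k] P) (f : MultilinearMap k (fun _ : Fin q => A) N) :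
    MultilinearMap k (fun _ : Fin (q + 1) => A) P :=
  MultilinearMap.mk' (fun a => L (a 0) (f (Fin.tail a)))
    (fun a i x y => by
      refine Fin.cases ?_ (fun i => ?_) i
      · simp
      · simp [Fin.tail_update_succ, (Fin.succ_ne_zero i).symm])
    (fun a i c x => by
      refine Fin.cases ?_ (fun i => ?_) i
      · simp
      · simp [Fin.tail_update_succ, (Fin.succ_ne_zero i).symm])

/-- The multilinear map `(a₀, …, a_q) ↦ L a_q (f (a₀, …, a_{q-1}))`. -/
noncomputable def lastMul {N P : Type*} [AddCommGroup N] [Module k N] [AddCommGroup P] [Module k P]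
    {q : ℕ} (L : A →ₗ[k] N →ₗ[k] P) (f : MultilinearMap k (fun _ : Fin q => A) N) :
    MultilinearMap k (fun _ : Fin (q + 1) => A) P :=
  MultilinearMap.mk' (fun a => L (a (Fin.last q)) (f (Fin.init a)))
    (fun a i x y => by
      refine Fin.lastCases ?_ (fun i => ?_) i
      · simp
      · simp [Fin.init_update_castSucc, (Fin.castSucc_lt_last i).ne'])
    (fun a i c x => by
      refine Fin.lastCases ?_ (fun i => ?_) i
      · simp
      · simp [Fin.init_update_castSucc, (Fin.castSucc_lt_last i).ne'])

variable (k A)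

section Cohomology

variable (M : Type*) [AddCommGroup M] [Module k M] [Module A M] [Module Aᵐᵒᵖ M]
  [IsScalarTower k A M] [IsScalarTower k Aᵐᵒᵖ M]

/-- The Hochschild differential
`(d f)(a₀, …, a_q) = a₀ f(a₁, …, a_q) + ∑_{j < q} (-1)^{j+1} f(…, a_j a_{j+1}, …)
  + (-1)^{q+1} f(a₀, …, a_{q-1}) a_q`
on `q`-cochains, i.e. on `k`-multilinear maps `A^q → M`. -/
noncomputable def hochschildD (q : ℕ) :
    MultilinearMap k (fun _ : Fin q => A) M →ₗ[k]
      MultilinearMap k (fun _ : Fin (q + 1) => A) M where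
  toFun f := headMul (leftMul k A M) f + ∑ j : Fin q, (-1 : k) ^ ((j : ℕ) + 1) • mulContract j f
    + (-1 : k) ^ (q + 1) • lastMul (rightMul k A M) f
  map_add' f g := by
    ext a
    simp [headMul, lastMul, mulContract, Finset.sum_add_distrib]
    abel
  map_smul' c f := by
    ext a
    simp [headMul, lastMul, mulContract, Finset.smul_sum, smul_smul,
      mul_comm]

theorem hochschildD_apply (q : ℕ) (f : MultilinearMap k (fun _ : Fin q => A) M)
    (a : Fin (q + 1) → A) :
    hochschildD k A M q f a = a 0 • f (Fin.tail a)
      + ∑ j : Fin q, (-1 : k) ^ ((j : ℕ) + 1) • f (Fin.contractNth j.castSucc (· * ·) a)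
      + (-1 : k) ^ (q + 1) • (MulOpposite.op (a (Fin.last q)) • f (Fin.init a)) := by
  simp [hochschildD, headMul, lastMul, mulContract, leftMul_apply,
    rightMul_apply]

/-- Hochschild `q`-coboundaries. -/
noncomputable def hochschildCoboundaries :
    (q : ℕ) → Submodule k (MultilinearMap k (fun _ : Fin q => A) M)
  | 0 => ⊥
  | q + 1 => LinearMap.range (hochschildD k A M q)

/-- Hochschild cohomology `H^q(A, M)`: cocycles modulo coboundaries. -/
abbrev HochschildCohomology (q : ℕ) :=
  LinearMap.ker (hochschildD k A M q) ⧸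
    (hochschildCoboundaries k A M q).submoduleOf (LinearMap.ker (hochschildD k A M q))

/-- The multilinear map `(a₁, …, a_q) ↦ (m ↦ m ⊗ (a₁ ⊗ ⋯ ⊗ a_q))`. -/
noncomputable def pureChain (q : ℕ) :
    MultilinearMap k (fun _ : Fin q => A) (M →ₗ[k] M ⊗[k] ⨂[k]^q A) :=
  (TensorProduct.mk k M (⨂[k]^q A)).flip.compMultilinearMap (PiTensorProduct.tprod k)

/-- The Hochschild boundary `M ⊗ A^{⊗(q+1)} → M ⊗ A^{⊗q}`,
`m ⊗ (a₀ ⊗ ⋯ ⊗ a_q) ↦ m a₀ ⊗ (a₁ ⊗ ⋯ ⊗ a_q)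
  + ∑_{j < q} (-1)^{j+1} m ⊗ (⋯ ⊗ a_j a_{j+1} ⊗ ⋯) + (-1)^{q+1} a_q m ⊗ (a₀ ⊗ ⋯ ⊗ a_{q-1})`. -/
noncomputable def hochschildB (q : ℕ) :
    (M ⊗[k] ⨂[k]^(q + 1) A) →ₗ[k] (M ⊗[k] ⨂[k]^q A) :=
  TensorProduct.lift <| LinearMap.flip <| PiTensorProduct.lift <|
    headMul ((LinearMap.llcomp k M M _).flip ∘ₗ rightMul k A M) (pureChain k A M q)
    + ∑ j : Fin q, (-1 : k) ^ ((j : ℕ) + 1) • mulContract j (pureChain k A M q)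
    + (-1 : k) ^ (q + 1) •
      lastMul ((LinearMap.llcomp k M M _).flip ∘ₗ leftMul k A M) (pureChain k A M q)

theorem hochschildB_tmul_tprod (q : ℕ) (m : M) (a : Fin (q + 1) → A) :
    hochschildB k A M q (m ⊗ₜ PiTensorProduct.tprod k a) =
      (MulOpposite.op (a 0) • m) ⊗ₜ PiTensorProduct.tprod k (Fin.tail a)
      + ∑ j : Fin q, (-1 : k) ^ ((j : ℕ) + 1) •
          (m ⊗ₜ[k] PiTensorProduct.tprod k (Fin.contractNth j.castSucc (· * ·) a))
      + (-1 : k) ^ (q + 1) •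
          ((a (Fin.last q) • m) ⊗ₜ[k] PiTensorProduct.tprod k (Fin.init a)) := by
  simp [hochschildB, headMul, lastMul, mulContract, pureChain,
    leftMul_apply, rightMul_apply, LinearMap.sum_apply]

/-- Hochschild `q`-cycles; every `0`-chain is a cycle. -/
noncomputable def hochschildCycles : (q : ℕ) → Submodule k (M ⊗[k] ⨂[k]^q A)
  | 0 => ⊤
  | q + 1 => LinearMap.ker (hochschildB k A M q)

/-- Hochschild homology `H_q(A, M)`: cycles modulo boundaries. -/
abbrev HochschildHomology (q : ℕ) :=
  hochschildCycles k A M q ⧸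
    (LinearMap.range (hochschildB k A M q)).submoduleOf (hochschildCycles k A M q)

end Cohomology

end Hochschild

/-! ### The top exterior power of the coadjoint representation -/

section Exterior

attribute [local instance] LieRing.ofAssociativeRing

variable {k V : Type*} [Field k] [AddCommGroup V] [Module k V]

/-- The alternating map `(v₁, …, v_n) ↦ ∑ i, v₁ ∧ ⋯ ∧ φ v_i ∧ ⋯ ∧ v_n`. -/
noncomputable def exteriorDerivAux (n : ℕ) (φ : Module.End k V) : V [⋀^Fin n]→ₗ[k] ⋀[k]^n V where
  toMultilinearMap := ∑ i : Fin n, (exteriorPower.ιMulti k n).toMultilinearMap.compLinearMap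
    (fun j => if j = i then φ else LinearMap.id)
  map_eq_zero_of_eq' v i j h hij := by
    have e : ∀ l, (fun m => (if m = l then φ else LinearMap.id : Module.End k V) (v m)) =
        Function.update v l (φ (v l)) := by
      intro l
      funext m
      by_cases hm : m = l
      · subst hm; simp
      · simp [hm]
    change (∑ l : Fin n, (exteriorPower.ιMulti k n).toMultilinearMap.compLinearMap
      (fun m => if m = l then φ else LinearMap.id)) v = 0
    simp only [sum_apply, MultilinearMap.compLinearMap_apply, e]
    change ∑ l : Fin n, exteriorPower.ιMulti k n (Function.update v l (φ (v l))) = 0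
    rw [← Finset.add_sum_erase _ _ (Finset.mem_univ i),
      ← Finset.add_sum_erase _ _ (Finset.mem_erase.2 ⟨hij.symm, Finset.mem_univ j⟩),
      Finset.sum_eq_zero, add_zero]
    · have hs : Function.update v j (φ (v j)) =
          Function.update v i (φ (v i)) ∘ Equiv.swap i j := by
        funext m
        by_cases hi : m = i
        · subst hi; simp [hij, hij.symm, h]
        · by_cases hj : m = j
          · subst hj; simp [h]
          · simp [Equiv.swap_apply_of_ne_of_ne hi hj, hi, hj]
      rw [hs, AlternatingMap.map_swap _ _ hij, add_neg_cancel]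
    · intro l hl
      simp only [Finset.mem_erase] at hl
      exact AlternatingMap.map_eq_zero_of_eq _ _
        (by rw [Function.update_of_ne hl.2.1.symm, Function.update_of_ne hl.1.symm, h]) hij

theorem exteriorDerivAux_apply (n : ℕ) (φ : Module.End k V) (v : Fin n → V) :
    exteriorDerivAux n φ v =
      ∑ i, exteriorPower.ιMulti k n (Function.update v i (φ (v i))) := by
  change (∑ l : Fin n, (exteriorPower.ιMulti k n).toMultilinearMap.compLinearMap
    (fun m => if m = l then φ else LinearMap.id)) v = _
  simp only [sum_apply, MultilinearMap.compLinearMap_apply]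
  refine Finset.sum_congr rfl fun l _ => congrArg (exteriorPower.ιMulti k n) (funext fun m => ?_)
  by_cases hm : m = l
  · subst hm; simp
  · simp [hm]

/-- The endomorphism of `⋀^n V` extending `φ` as a derivation:
`v₁ ∧ ⋯ ∧ v_n ↦ ∑ i, v₁ ∧ ⋯ ∧ φ v_i ∧ ⋯ ∧ v_n`. -/
noncomputable def exteriorDeriv (n : ℕ) (φ : Module.End k V) : Module.End k (⋀[k]^n V) :=
  exteriorPower.alternatingMapLinearEquiv (exteriorDerivAux n φ)

theorem exteriorDeriv_ιMulti (n : ℕ) (φ : Module.End k V) (v : Fin n → V) :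
    exteriorDeriv n φ (exteriorPower.ιMulti k n v) =
      ∑ i, exteriorPower.ιMulti k n (Function.update v i (φ (v i))) := by
  rw [exteriorDeriv, exteriorPower.alternatingMapLinearEquiv_apply_ιMulti, exteriorDerivAux_apply]

/-- `⋀^n` of a representation: `φ ↦ exteriorDeriv n φ` is a homomorphism of Lie algebras. -/
noncomputable def exteriorDerivHom (n : ℕ) : Module.End k V →ₗ⁅k⁆ Module.End k (⋀[k]^n V) where
  toFun := exteriorDeriv n
  map_add' φ ψ := by
    refine exteriorPower.linearMap_ext (AlternatingMap.ext fun v => ?_)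
    simp [exteriorDeriv_ιMulti, Finset.sum_add_distrib]
  map_smul' c φ := by
    refine exteriorPower.linearMap_ext (AlternatingMap.ext fun v => ?_)
    simp [exteriorDeriv_ιMulti, Finset.smul_sum]
  map_lie' {φ ψ} := by
    refine exteriorPower.linearMap_ext (AlternatingMap.ext fun v => ?_)
    have key : ∀ α β : Module.End k V,
        exteriorDeriv n α (exteriorDeriv n β (exteriorPower.ιMulti k n v)) =
          ∑ i, exteriorPower.ιMulti k n (Function.update v i (α (β (v i)))) +
          ∑ i, ∑ j ∈ Finset.univ.erase i, exteriorPower.ιMulti k n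
            (Function.update (Function.update v i (β (v i))) j (α (v j))) := by
      intro α β
      rw [exteriorDeriv_ιMulti, map_sum, ← Finset.sum_add_distrib]
      refine Finset.sum_congr rfl fun i _ => ?_
      rw [exteriorDeriv_ιMulti, ← Finset.add_sum_erase _ _ (Finset.mem_univ i)]
      congr 1
      · simp
      · refine Finset.sum_congr rfl fun j hj => ?_
        rw [Function.update_of_ne (Finset.ne_of_mem_erase hj)]
    have swap : ∀ α β : Module.End k V,
        ∑ i, ∑ j ∈ Finset.univ.erase i, exteriorPower.ιMulti k n
            (Function.update (Function.update v i (β (v i))) j (α (v j))) =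
        ∑ i, ∑ j ∈ Finset.univ.erase i, exteriorPower.ιMulti k n
            (Function.update (Function.update v i (α (v i))) j (β (v j))) := by
      intro α β
      rw [Finset.sum_comm' (t' := Finset.univ) (s' := fun j => Finset.univ.erase j)
        (by intro i j; simp [ne_comm])]
      refine Finset.sum_congr rfl fun i _ => Finset.sum_congr rfl fun j hj => ?_
      rw [Function.update_comm (Finset.ne_of_mem_erase hj)]
    simp only [LinearMap.compAlternatingMap_apply, LieRing.of_associative_ring_bracket,
      LinearMap.sub_apply, Module.End.mul_apply]
    rw [key, key, swap ψ φ, exteriorDeriv_ιMulti]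
    simp [Finset.sum_sub_distrib]

end Exterior

section Twist

attribute [local instance] LieRing.ofAssociativeRing

variable (k : Type*) [Field k] (g : Type*) [LieRing g] [LieAlgebra k g]

/-- The top exterior power `⋀^n g*`, where `n = dim g`. -/
noncomputable abbrev TopDual := ⋀[k]^(Module.finrank k g) (Module.Dual k g)

/-- The (left) coadjoint representation of `g` on `⋀^n g*`: on `g*` it is `(x f)(y) = -f([x, y])`,
extended to `⋀^n g*` by derivations. -/
noncomputable def coadTop : g →ₗ⁅k⁆ Module.End k (TopDual k g) :=
  (exteriorDerivHom (Module.finrank k g)).comp (LieModule.toEnd k g (Module.Dual k g))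

theorem coadTop_ιMulti (x : g) (v : Fin (Module.finrank k g) → Module.Dual k g) :
    coadTop k g x (exteriorPower.ιMulti k _ v) =
      ∑ i, exteriorPower.ιMulti k _ (Function.update v i (-(v i ∘ₗ (LieAlgebra.ad k g x)))) :=
  exteriorDeriv_ιMulti _ _ v

/-- The tensor product `M ⊗ ⋀^n g*` of the bimodule `M` with `⋀^n g*`, where `g` acts on `⋀^n g*`
trivially from the left, and from the right by the right coadjoint action
`w · x = -coadTop x w` (so that `(f · x)(y) = f([x, y])` on `g*`; this is dual to the right adjoint
action `y · x = [y, x]` of `g` on itself). An element `x ∈ g` acts by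
`x (m ⊗ w) = x m ⊗ w` and `(m ⊗ w) x = m x ⊗ w + m ⊗ w · x`. -/
def CoadjointTwist (k g M : Type*) [Field k] [LieRing g] [LieAlgebra k g]
    [AddCommGroup M] [Module k M] := M ⊗[k] TopDual k g

noncomputable instance (M : Type*) [AddCommGroup M] [Module k M] :
    AddCommGroup (CoadjointTwist k g M) :=
  inferInstanceAs (AddCommGroup (M ⊗[k] TopDual k g))

noncomputable instance (M : Type*) [AddCommGroup M] [Module k M] :
    Module k (CoadjointTwist k g M) :=
  inferInstanceAs (Module k (M ⊗[k] TopDual k g))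

/-- The identification of `CoadjointTwist k g M` with the underlying tensor product. -/
noncomputable def toTwist (M : Type*) [AddCommGroup M] [Module k M] :
    (M ⊗[k] TopDual k g) ≃ₗ[k] CoadjointTwist k g M :=
  LinearEquiv.refl k (M ⊗[k] TopDual k g)

section Left

variable (M : Type*) [AddCommGroup M] [Module k M] [Module (UniversalEnvelopingAlgebra k g) M]
  [IsScalarTower k (UniversalEnvelopingAlgebra k g) M]

/-- The left action: `u (m ⊗ w) = u m ⊗ w`. -/
noncomputable instance : Module (UniversalEnvelopingAlgebra k g) (CoadjointTwist k g M) :=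
  inferInstanceAs (Module (UniversalEnvelopingAlgebra k g) (M ⊗[k] TopDual k g))

instance : IsScalarTower k (UniversalEnvelopingAlgebra k g) (CoadjointTwist k g M) :=
  inferInstanceAs (IsScalarTower k (UniversalEnvelopingAlgebra k g) (M ⊗[k] TopDual k g))

theorem left_smul_tmul (u : UniversalEnvelopingAlgebra k g) (m : M) (w : TopDual k g) :
    u • toTwist k g M (m ⊗ₜ w) = toTwist k g M ((u • m) ⊗ₜ w) := rfl

end Left

section Right

variable (M : Type*) [AddCommGroup M] [Module k M] [Module (UniversalEnvelopingAlgebra k g)ᵐᵒᵖ M]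
  [IsScalarTower k (UniversalEnvelopingAlgebra k g)ᵐᵒᵖ M]

/-- The endomorphism `m ⊗ w ↦ m x ⊗ w + m ⊗ w · x` of `M ⊗ ⋀^n g*` for `x ∈ g`, as a homomorphism
of Lie algebras to the opposite of the endomorphism algebra. -/
noncomputable def twistRight :
    g →ₗ⁅k⁆ (Module.End k (M ⊗[k] TopDual k g))ᵐᵒᵖ where
  toFun x := MulOpposite.op <|
    (rightMul k _ M (UniversalEnvelopingAlgebra.ι k x)).rTensor (TopDual k g)
      - (coadTop k g x).lTensor M
  map_add' x y := by
    rw [← MulOpposite.op_add]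
    congr 1
    ext m w
    simp
    abel
  map_smul' c x := by
    rw [RingHom.id_apply, ← MulOpposite.op_smul]
    congr 1
    ext m w
    simp [TensorProduct.smul_tmul', smul_sub]
  map_lie' {x y} := by
    rw [LieRing.of_associative_ring_bracket, ← MulOpposite.op_mul, ← MulOpposite.op_mul,
      ← MulOpposite.op_sub]
    congr 1
    refine TensorProduct.ext' fun m w => ?_
    simp [LieRing.of_associative_ring_bracket, rightMul_apply, mul_smul]
    abel

/-- The right action of `U(g)` on `M ⊗ ⋀^n g*` extending `twistRight`. -/
noncomputable def twistRightAlg :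
    (UniversalEnvelopingAlgebra k g)ᵐᵒᵖ →ₐ[k] Module.End k (M ⊗[k] TopDual k g) :=
  AlgHom.opComm (UniversalEnvelopingAlgebra.lift k (twistRight k g M))

/-- The right action: `(m ⊗ w) x = m x ⊗ w + m ⊗ w · x` for `x ∈ g`. -/
noncomputable instance : Module (UniversalEnvelopingAlgebra k g)ᵐᵒᵖ (CoadjointTwist k g M) :=
  Module.compHom (M ⊗[k] TopDual k g) (twistRightAlg k g M).toRingHom

theorem op_smul_toTwist (u : (UniversalEnvelopingAlgebra k g)ᵐᵒᵖ) (t : M ⊗[k] TopDual k g) :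
    u • toTwist k g M t = toTwist k g M (twistRightAlg k g M u t) := rfl

instance : IsScalarTower k (UniversalEnvelopingAlgebra k g)ᵐᵒᵖ (CoadjointTwist k g M) where
  smul_assoc c u t := by
    obtain ⟨t, rfl⟩ := (toTwist k g M).surjective t
    rw [op_smul_toTwist, op_smul_toTwist, map_smul, LinearMap.smul_apply, map_smul]

theorem twistRightAlg_op_ι (x : g) :
    twistRightAlg k g M (MulOpposite.op (UniversalEnvelopingAlgebra.ι k x)) =
      (rightMul k _ M (UniversalEnvelopingAlgebra.ι k x)).rTensor (TopDual k g)
        - (coadTop k g x).lTensor M := by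
  change (UniversalEnvelopingAlgebra.lift k (twistRight k g M)
    (UniversalEnvelopingAlgebra.ι k x)).unop = _
  rw [UniversalEnvelopingAlgebra.lift_ι_apply]
  rfl

theorem right_smul_tmul (x : g) (m : M) (w : TopDual k g) :
    MulOpposite.op (UniversalEnvelopingAlgebra.ι k x) • toTwist k g M (m ⊗ₜ w) =
      toTwist k g M ((MulOpposite.op (UniversalEnvelopingAlgebra.ι k x) • m) ⊗ₜ w)
        + toTwist k g M (m ⊗ₜ (-coadTop k g x w)) := by
  rw [op_smul_toTwist, twistRightAlg_op_ι, ← map_add, TensorProduct.tmul_neg, ← sub_eq_add_neg]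
  rfl

end Right

/-- The two actions on `M ⊗ ⋀^n g*` commute, so it is again a `k`-central bimodule. -/
instance (M : Type*) [AddCommGroup M] [Module k M]
    [Module (UniversalEnvelopingAlgebra k g) M] [Module (UniversalEnvelopingAlgebra k g)ᵐᵒᵖ M]
    [IsScalarTower k (UniversalEnvelopingAlgebra k g) M]
    [IsScalarTower k (UniversalEnvelopingAlgebra k g)ᵐᵒᵖ M]
    [SMulCommClass (UniversalEnvelopingAlgebra k g) (UniversalEnvelopingAlgebra k g)ᵐᵒᵖ M] :
    SMulCommClass (UniversalEnvelopingAlgebra k g) (UniversalEnvelopingAlgebra k g)ᵐᵒᵖ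
      (CoadjointTwist k g M) where
  smul_comm u v t := by
    obtain ⟨v, rfl⟩ := MulOpposite.op_surjective v
    let l : Module.End k (M ⊗[k] TopDual k g) := (leftMul k _ M u).rTensor (TopDual k g)
    let S : Subalgebra k (UniversalEnvelopingAlgebra k g) :=
      (Subalgebra.centralizer k {MulOpposite.op l}).comap
        (UniversalEnvelopingAlgebra.lift k (twistRight k g M))
    have hS : ∀ x, UniversalEnvelopingAlgebra.ι k x ∈ S := by
      intro x
      simp only [S, Subalgebra.mem_comap, Subalgebra.mem_centralizer_iff, Set.mem_singleton_iff,
        forall_eq, UniversalEnvelopingAlgebra.lift_ι_apply]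
      refine congrArg MulOpposite.op (TensorProduct.ext' fun m w => ?_)
      change ((rightMul k _ M (UniversalEnvelopingAlgebra.ι k x)).rTensor (TopDual k g)
        - (coadTop k g x).lTensor M) (l (m ⊗ₜ w)) =
        l (((rightMul k _ M (UniversalEnvelopingAlgebra.ι k x)).rTensor (TopDual k g)
        - (coadTop k g x).lTensor M) (m ⊗ₜ w))
      simp [l, rightMul_apply, leftMul_apply, smul_comm]
    let f : g →ₗ⁅k⁆ S :=
      { toFun := fun x => ⟨UniversalEnvelopingAlgebra.ι k x, hS x⟩
        map_add' := fun x y => Subtype.ext (by simp)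
        map_smul' := fun c x => Subtype.ext (by simp)
        map_lie' := fun {x y} => Subtype.ext (by
          simp [LieRing.of_associative_ring_bracket]) }
    have hid : S.val.comp (UniversalEnvelopingAlgebra.lift k f) = AlgHom.id k _ := by
      ext x
      simp [f]
    have hv : v ∈ S := by
      have := congrArg (fun F => F v) hid
      simp only [AlgHom.comp_apply, AlgHom.id_apply] at this
      rw [← this]
      exact (UniversalEnvelopingAlgebra.lift k f v).2
    have h := hv
    simp only [S, Subalgebra.mem_comap, Subalgebra.mem_centralizer_iff, Set.mem_singleton_iff,
      forall_eq] at h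
    have h' := congrArg MulOpposite.unop h
    obtain ⟨t, rfl⟩ := (toTwist k g M).surjective t
    exact (LinearMap.congr_fun h' t).symm

end Twist

end HochschildDuality

/-!
Hochschild (co)homology of an algebra `A` is `Ext` and `Tor` over the enveloping algebra
`Aᵉ = A ⊗ Aᵐᵒᵖ` of the bimodule `A`, so it can be computed from any free resolution of `A` over
`Aᵉ`. The bar resolution gives the complexes of the definition (`barResolution`). For `A = U(g)`
there is a second one, the Koszul resolution `U(g)ᵉ ⊗ ⋀ g` (`koszulResolution`), which has length
`n = dim g` and is self-dual up to a twist: this gives both the vanishing and the duality.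

*Exactness of the Koszul resolution.* The exterior algebra is realised as the fermionic Fock space
on the subsets of `{1, …, n}`, where the Chevalley–Eilenberg differential is a polynomial in
creation and annihilation operators; that its square is zero follows from Cartan's formula
`d (x ∧) + (x ∧) d = L_x` (`ceDiff_mul_self`). With coefficients in `U(g)`, identified with
polynomials by the Poincaré–Birkhoff–Witt theorem (`pbwEquiv`), the differential agrees up to terms
of lower filtration with the differential of the polynomial Koszul complex, which has an explicit
contraction; hence the complex is acyclic (`exists_ceDiff_eq`). The complex over `U(g)ᵉ` is obtained
from `U(g) ⊗ (U(g) ⊗ ⋀ g)` by the isomorphism `a ⊗ u ↦ (a ⊗ 1) S(u)`, where `S` is the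
anti-homomorphism with `S(x) = 1 ⊗ x - x ⊗ 1` (`untwistEquiv`).

*Comparison.* Any two free resolutions are homotopy equivalent, so they give isomorphic cohomology
and homology (`Resolution.nonempty_cohomologyEquiv`, `Resolution.nonempty_homologyEquiv`).
Hochschild (co)homology of `U(g)` thus becomes Lie algebra (co)homology for the commutator action
of `g`.

*Duality.* The Hodge star `f ↦ ∑ T, ± f(e_T) ⊗ e_{Tᶜ}` from `Hom(⋀ g, M)` to `M ⊗ ⋀ g` turns
precomposition with a creation or annihilation operator into the same operator on `⋀ g`. The part of
the differential that involves the bracket is a product of three such operators, whose order is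
reversed; restoring normal order costs the terms `tr (ad x)` (`hodgeStar_ceCodiff`). The coadjoint
action on the line `⋀^n g*` is by `- tr (ad x)` (`coadTop_eq`), so that the twist of the
coefficients in the theorem accounts for precisely these terms (`commActOp_twistEquiv`).
-/

namespace HochschildDuality

/-! ### The exterior algebra as a Fock space -/

section Fock

variable (k : Type*) [Field k] {n : ℕ}

/-- The Koszul sign `(-1)^{#{j ∈ T | j < i}}`. -/
def koszulSign (i : Fin n) (T : Finset (Fin n)) : k :=
  (-1) ^ (T.filter (· < i)).card

theorem koszulSign_mul_self (i : Fin n) (T : Finset (Fin n)) :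
    koszulSign k i T * koszulSign k i T = 1 := by
  rw [koszulSign, ← mul_pow]; simp

theorem koszulSign_insert (i : Fin n) {j : Fin n} {T : Finset (Fin n)} (h : j ∉ T) :
    koszulSign k i (insert j T) = (if j < i then -1 else 1) * koszulSign k i T := by
  unfold koszulSign
  rw [Finset.filter_insert]
  split_ifs with hji
  · rw [Finset.card_insert_of_notMem (by simp [h]), pow_succ']
  · simp

theorem koszulSign_insert_self (i : Fin n) (T : Finset (Fin n)) :
    koszulSign k i (insert i T) = koszulSign k i T := by
  simp [koszulSign, Finset.filter_insert]

theorem koszulSign_erase (i : Fin n) {j : Fin n} {T : Finset (Fin n)} (h : j ∈ T) :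
    koszulSign k i (T.erase j) = (if j < i then -1 else 1) * koszulSign k i T := by
  conv_rhs => rw [← Finset.insert_erase h]
  rw [koszulSign_insert k i (Finset.notMem_erase j T)]
  split_ifs <;> simp

theorem koszulSign_erase_self (i : Fin n) (T : Finset (Fin n)) :
    koszulSign k i (T.erase i) = koszulSign k i T := by
  by_cases h : i ∈ T
  · rw [koszulSign_erase k i h]; simp
  · rw [Finset.erase_eq_of_notMem h]

theorem koszulSign_of_forall_lt {i : Fin n} {T : Finset (Fin n)} (h : ∀ j ∈ T, i ≤ j) :
    koszulSign k i T = 1 := by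
  rw [koszulSign, Finset.filter_false_of_mem fun j hj => not_lt.2 (h j hj)]; simp

variable (n) in
/-- The exterior algebra on `n` generators, as the vector space with basis the subsets `T` of
`Fin n`; the basis vector of `T = {i₁ < ⋯ < i_q}` stands for `e_{i₁} ∧ ⋯ ∧ e_{i_q}`. -/
abbrev Fock := Finset (Fin n) →₀ k

-- Here and for the tensor products below, instances found by inference are restated: without such
-- shortcuts, unifying the ring operations in rewriting with general lemmas is too slow.
noncomputable instance : AddCommGroup (Fock k n) := Finsupp.instAddCommGroup

noncomputable instance : Ring (Module.End k (Fock k n)) := Module.End.instRing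

/-- Exterior multiplication by the `i`-th generator. -/
noncomputable def creation (i : Fin n) : Module.End k (Fock k n) :=
  Finsupp.linearCombination k fun T => if i ∈ T then 0 else Finsupp.single (insert i T)
    (koszulSign k i T)

/-- Contraction with the `i`-th element of the dual basis. -/
noncomputable def annihilation (i : Fin n) : Module.End k (Fock k n) :=
  Finsupp.linearCombination k fun T => if i ∈ T then Finsupp.single (T.erase i)
    (koszulSign k i T) else 0

theorem creation_single (i : Fin n) (T : Finset (Fin n)) (c : k) :
    creation k i (Finsupp.single T c) =
      if i ∈ T then 0 else Finsupp.single (insert i T) (c * koszulSign k i T) := by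
  rw [creation, Finsupp.linearCombination_single]
  split_ifs <;> simp

theorem annihilation_single (i : Fin n) (T : Finset (Fin n)) (c : k) :
    annihilation k i (Finsupp.single T c) =
      if i ∈ T then Finsupp.single (T.erase i) (c * koszulSign k i T) else 0 := by
  rw [annihilation, Finsupp.linearCombination_single]
  split_ifs <;> simp

theorem creation_mul_self (i : Fin n) : creation k i * creation k i = 0 := by
  refine Finsupp.lhom_ext fun T c => ?_
  by_cases h : i ∈ T <;> simp [-Finsupp.single_mul, creation_single, h]

theorem annihilation_mul_self (i : Fin n) : annihilation k i * annihilation k i = 0 := by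
  refine Finsupp.lhom_ext fun T c => ?_
  by_cases h : i ∈ T <;> simp [-Finsupp.single_mul, annihilation_single, h]

theorem creation_anticomm (i j : Fin n) :
    creation k i * creation k j + creation k j * creation k i = 0 := by
  rcases eq_or_ne i j with rfl | hij
  · simp [creation_mul_self]
  refine Finsupp.lhom_ext fun T c => ?_
  by_cases hi : i ∈ T <;> by_cases hj : j ∈ T <;>
    simp [-Finsupp.single_mul, creation_single, hi, hj, hij, hij.symm]
  rw [Finset.insert_comm j i, ← Finsupp.single_add, koszulSign_insert k i hj,
    koszulSign_insert k j hi]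
  rw [Finsupp.single_eq_zero]
  rcases lt_or_gt_of_ne hij with h | h <;> simp [h, h.not_gt] <;> ring

theorem annihilation_anticomm (i j : Fin n) :
    annihilation k i * annihilation k j + annihilation k j * annihilation k i = 0 := by
  rcases eq_or_ne i j with rfl | hij
  · simp [annihilation_mul_self]
  refine Finsupp.lhom_ext fun T c => ?_
  by_cases hi : i ∈ T <;> by_cases hj : j ∈ T <;>
    simp [-Finsupp.single_mul, annihilation_single, hi, hj, hij, hij.symm]
  rw [Finset.erase_right_comm, ← Finsupp.single_add, koszulSign_erase k i hj,
    koszulSign_erase k j hi]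
  rw [Finsupp.single_eq_zero]
  rcases lt_or_gt_of_ne hij with h | h <;> simp [h, h.not_gt] <;> ring

/-- The canonical anticommutation relations between annihilation and creation operators. -/
theorem annihilation_creation (i j : Fin n) :
    annihilation k i * creation k j + creation k j * annihilation k i = if i = j then 1 else 0 := by
  refine Finsupp.lhom_ext fun T c => ?_
  rcases eq_or_ne i j with rfl | hij
  · by_cases hi : i ∈ T
    · simp [-Finsupp.single_mul, annihilation_single, creation_single, hi,
        koszulSign_erase_self, mul_assoc, koszulSign_mul_self]
    · simp [-Finsupp.single_mul, annihilation_single, creation_single, hi,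
        koszulSign_insert_self, mul_assoc, koszulSign_mul_self]
  · by_cases hi : i ∈ T <;> by_cases hj : j ∈ T <;>
      simp [-Finsupp.single_mul, annihilation_single, creation_single, hi, hj, hij, hij.symm]
    rw [Finset.erase_insert_of_ne hij.symm, ← Finsupp.single_add, koszulSign_insert k i hj,
      koszulSign_erase k j hi]
    rw [Finsupp.single_eq_zero]
    rcases lt_or_gt_of_ne hij with h | h <;> simp [h, h.not_gt] <;> ring

/-- The vacuum and the exterior multiplications generate `N ⊗ Fock k n`. -/
theorem fock_induction {N : Type*} [AddCommGroup N] [Module k N] {p : N ⊗[k] Fock k n → Prop}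
    (hadd : ∀ x y, p x → p y → p (x + y)) (hvac : ∀ m, p (m ⊗ₜ Finsupp.single ∅ 1))
    (hcre : ∀ i x, p x → p ((creation k i).lTensor N x)) (x : N ⊗[k] Fock k n) : p x := by
  have key : ∀ (T : Finset (Fin n)) (m : N), p (m ⊗ₜ Finsupp.single T 1) := by
    intro T
    induction T using Finset.induction_on_min with
    | empty => exact hvac
    | insert i T hi ih =>
      intro m
      have h := hcre i _ (ih m)
      rwa [LinearMap.lTensor_tmul, creation_single, if_neg fun h => (hi i h).false,
        koszulSign_of_forall_lt k fun j hj => (hi j hj).le, mul_one] at h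
  induction x with
  | zero => simpa using hvac 0
  | add x y hx hy => exact hadd x y hx hy
  | tmul m w =>
    induction w using Finsupp.induction_linear with
    | zero => simpa using hvac 0
    | add v w hv hw => rw [TensorProduct.tmul_add]; exact hadd _ _ hv hw
    | single T c =>
      rw [← mul_one c, ← smul_eq_mul, ← Finsupp.smul_single, ← TensorProduct.smul_tmul]
      exact key T _

end Fock

/-! ### The Chevalley–Eilenberg differential -/

section ExteriorLie

variable {k : Type*} [Field k] {g : Type*} [LieRing g] [LieAlgebra k g] {n : ℕ}
  (b : Module.Basis (Fin n) k g)

/-- Exterior multiplication by `x ∈ g` on `⋀ g`. -/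
noncomputable def wedge : g →ₗ[k] Module.End k (Fock k n) :=
  b.constr k (creation k)

theorem wedge_basis (i : Fin n) : wedge b (b i) = creation k i := by simp [wedge]

theorem wedge_eq_sum (x : g) : wedge b x = ∑ i, b.repr x i • creation k i := by
  simp [wedge, Module.Basis.constr_apply_fintype]

theorem annihilation_wedge (i : Fin n) (x : g) :
    annihilation k i * wedge b x + wedge b x * annihilation k i = b.repr x i • 1 := by
  simp only [wedge_eq_sum, Finset.mul_sum, Finset.sum_mul, ← Finset.sum_add_distrib,
    mul_smul_comm, smul_mul_assoc, ← smul_add, annihilation_creation]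
  simp

theorem wedge_anticomm (x y : g) : wedge b x * wedge b y + wedge b y * wedge b x = 0 := by
  rw [wedge_eq_sum, wedge_eq_sum, Finset.sum_mul_sum, Finset.sum_mul_sum, Finset.sum_comm,
    ← Finset.sum_add_distrib]
  refine Finset.sum_eq_zero fun i _ => ?_
  rw [← Finset.sum_add_distrib]
  refine Finset.sum_eq_zero fun j _ => ?_
  simp only [mul_smul_comm, smul_mul_assoc]
  rw [smul_comm, ← smul_add, ← smul_add, creation_anticomm]
  simp

/-- The adjoint action of `x ∈ g` on `⋀ g` by derivations. -/
noncomputable def adFock (x : g) : Module.End k (Fock k n) :=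
  ∑ i, wedge b ⁅x, b i⁆ * annihilation k i

/-- The operator `adFock b x` extends `ad x` to `⋀ g` by derivations. -/
theorem adFock_wedge (x y : g) :
    adFock b x * wedge b y - wedge b y * adFock b x = wedge b ⁅x, y⁆ := by
  have h : ∀ i, wedge b ⁅x, b i⁆ * annihilation k i * wedge b y -
      wedge b y * (wedge b ⁅x, b i⁆ * annihilation k i) = b.repr y i • wedge b ⁅x, b i⁆ := by
    intro i
    have h1 := annihilation_wedge b i y
    have h2 := wedge_anticomm b y ⁅x, b i⁆
    rw [← mul_one (wedge b ⁅x, b i⁆), ← mul_smul_comm, ← h1, mul_one, mul_add, ← mul_assoc,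
      ← mul_assoc, ← mul_assoc, eq_neg_of_add_eq_zero_left h2]
    noncomm_ring
  rw [adFock, Finset.sum_mul, Finset.mul_sum, ← Finset.sum_sub_distrib]
  simp only [h, ← map_smul, ← map_sum, ← lie_smul, ← lie_sum, b.sum_repr]

/-- The operator `∑_{i < j} [e_i, e_j] ∧ ι_i ι_j` on `⋀ g`, where `ι_i` is the contraction with
the `i`-th dual basis vector. On `x ∧ y` it is `-[x, y]`. -/
noncomputable def bracketFock : Module.End k (Fock k n) :=
  ∑ i, ∑ j, if i < j then wedge b ⁅b i, b j⁆ * annihilation k i * annihilation k j else 0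

/-- The anticommutator of the Lie algebra boundary of `⋀ g` with `x ∧ ·` is `ad x`, up to sign: this
is Cartan's formula for trivial coefficients. -/
theorem bracketFock_wedge (x : g) :
    bracketFock b * wedge b x + wedge b x * bracketFock b = -adFock b x := by
  have h : ∀ i j, (wedge b ⁅b i, b j⁆ * annihilation k i * annihilation k j) * wedge b x +
      wedge b x * (wedge b ⁅b i, b j⁆ * annihilation k i * annihilation k j) =
      b.repr x j • (wedge b ⁅b i, b j⁆ * annihilation k i) +
      b.repr x i • (wedge b ⁅b j, b i⁆ * annihilation k j) := by
    intro i j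
    have h1 := eq_sub_of_add_eq (annihilation_wedge b i x)
    have h2 := eq_sub_of_add_eq (annihilation_wedge b j x)
    have h3 := eq_neg_of_add_eq_zero_left (wedge_anticomm b x ⁅b i, b j⁆)
    rw [mul_assoc _ _ (wedge b x), h2, mul_sub, mul_assoc _ (annihilation k i) (wedge b x * _),
      ← mul_assoc (annihilation k i) (wedge b x), h1, ← mul_assoc (wedge b x),
      ← mul_assoc (wedge b x), h3,
      ← lie_skew (b i) (b j), map_neg]
    simp only [sub_mul, mul_sub, mul_smul_comm, mul_one, smul_mul_assoc, one_mul, neg_mul,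
      mul_assoc,
      smul_neg]
    abel
  have e : ∀ i j : Fin n,
      (if i < j then b.repr x j • (wedge b ⁅b i, b j⁆ * annihilation k i) else 0)
      + (if j < i then b.repr x j • (wedge b ⁅b i, b j⁆ * annihilation k i) else 0) =
      b.repr x j • (wedge b ⁅b i, b j⁆ * annihilation k i) := by
    intro i j
    rcases lt_trichotomy i j with h | rfl | h
    · rw [if_pos h, if_neg h.not_gt, add_zero]
    · rw [lie_self, map_zero, zero_mul, smul_zero, if_neg (lt_irrefl _), add_zero]
    · rw [if_neg h.not_gt, if_pos h, zero_add]
  have h' : bracketFock b * wedge b x + wedge b x * bracketFock b =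
      ∑ i, ∑ j, b.repr x j • (wedge b ⁅b i, b j⁆ * annihilation k i) := by
    rw [Finset.sum_congr rfl fun i _ => Finset.sum_congr rfl fun j _ => (e i j).symm]
    simp only [Finset.sum_add_distrib]
    rw [Finset.sum_comm (f := fun i j => if j < i then _ else _)]
    simp only [bracketFock, Finset.sum_mul, Finset.mul_sum, ← Finset.sum_add_distrib]
    refine Finset.sum_congr rfl fun i _ => Finset.sum_congr rfl fun j _ => ?_
    split_ifs
    · exact h i j
    · simp
  rw [h', adFock, ← Finset.sum_neg_distrib]
  refine Finset.sum_congr rfl fun i _ => ?_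
  simp only [← smul_mul_assoc, ← map_smul, ← Finset.sum_mul, ← map_sum, ← lie_smul, ← lie_sum,
    b.sum_repr, ← neg_mul, ← map_neg, lie_skew]

theorem annihilation_vac (i : Fin n) : annihilation k i (Finsupp.single ∅ 1) = 0 := by
  simp [annihilation_single]

theorem adFock_vac (x : g) : adFock b x (Finsupp.single ∅ 1) = 0 := by
  simp [adFock, annihilation_vac]

theorem bracketFock_vac : bracketFock b (Finsupp.single ∅ 1) = 0 := by
  rw [bracketFock, LinearMap.sum_apply]
  refine Finset.sum_eq_zero fun i _ => ?_
  rw [LinearMap.sum_apply]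
  refine Finset.sum_eq_zero fun j _ => ?_
  split_ifs <;> simp [annihilation_vac]

end ExteriorLie

section ChevalleyEilenberg

variable {k : Type*} [Field k] {g : Type*} [LieRing g] [LieAlgebra k g] {n : ℕ}
  (b : Module.Basis (Fin n) k g) {N : Type*} [AddCommGroup N] [Module k N]
  (ρ : g →ₗ[k] Module.End k N)

noncomputable instance : AddCommGroup (N ⊗[k] Fock k n) := TensorProduct.addCommGroup

noncomputable instance : Ring (Module.End k (N ⊗[k] Fock k n)) := Module.End.instRing

/-- The Chevalley–Eilenberg differential on `N ⊗ ⋀ g` for a left `g`-module `N`. -/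
noncomputable def ceDiff : Module.End k (N ⊗[k] Fock k n) :=
  ∑ i, TensorProduct.map (ρ (b i)) (annihilation k i) - (bracketFock b).lTensor N

/-- The diagonal action of `x ∈ g` on `N ⊗ ⋀ g`. -/
noncomputable def lieDeriv (x : g) : Module.End k (N ⊗[k] Fock k n) :=
  (ρ x).rTensor _ + (adFock b x).lTensor N

theorem ceDiff_tmul_vac (m : N) : ceDiff b ρ (m ⊗ₜ Finsupp.single ∅ 1) = 0 := by
  simp [ceDiff, annihilation_vac, bracketFock_vac, LinearMap.sum_apply]

theorem lieDeriv_tmul_vac (x : g) (m : N) :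
    lieDeriv b ρ x (m ⊗ₜ Finsupp.single ∅ 1) = ρ x m ⊗ₜ Finsupp.single ∅ 1 := by
  simp [lieDeriv, adFock_vac]

/-- Cartan's homotopy formula. -/
theorem ceDiff_wedge (x : g) :
    ceDiff b ρ * (wedge b x).lTensor N + (wedge b x).lTensor N * ceDiff b ρ = lieDeriv b ρ x := by
  have h1 : ∀ i, TensorProduct.map (ρ (b i)) (annihilation k i) * (wedge b x).lTensor N +
      (wedge b x).lTensor N * TensorProduct.map (ρ (b i)) (annihilation k i) =
      b.repr x i • (ρ (b i)).rTensor (Fock k n) := by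
    intro i
    refine TensorProduct.ext' fun m w => ?_
    have := LinearMap.congr_fun (annihilation_wedge b i x) w
    simp only [LinearMap.add_apply, Module.End.mul_apply, LinearMap.smul_apply,
      Module.End.one_apply] at this
    simp [← TensorProduct.tmul_add, this]
  have h2 : (bracketFock b).lTensor N * (wedge b x).lTensor N +
      (wedge b x).lTensor N * (bracketFock b).lTensor N = - (adFock b x).lTensor N := by
    rw [← LinearMap.lTensor_mul, ← LinearMap.lTensor_mul, ← LinearMap.lTensor_add,
      bracketFock_wedge, LinearMap.lTensor_neg]
  have h3 : ceDiff b ρ * (wedge b x).lTensor N + (wedge b x).lTensor N * ceDiff b ρ =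
      ∑ i, (TensorProduct.map (ρ (b i)) (annihilation k i) * (wedge b x).lTensor N +
      (wedge b x).lTensor N * TensorProduct.map (ρ (b i)) (annihilation k i)) -
      ((bracketFock b).lTensor N * (wedge b x).lTensor N +
      (wedge b x).lTensor N * (bracketFock b).lTensor N) := by
    rw [ceDiff, Finset.sum_add_distrib, ← Finset.sum_mul, ← Finset.mul_sum, sub_mul, mul_sub]
    abel
  rw [h3, h2, sub_neg_eq_add, lieDeriv, Finset.sum_congr rfl fun i _ => h1 i]
  congr 1
  simp only [← map_smul, ← LinearMap.coe_rTensorHom, ← map_sum,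
    b.sum_repr]

theorem lieDeriv_wedge (x y : g) :
    lieDeriv b ρ x * (wedge b y).lTensor N - (wedge b y).lTensor N * lieDeriv b ρ x =
      (wedge b ⁅x, y⁆).lTensor N := by
  refine TensorProduct.ext' fun m w => ?_
  simp [lieDeriv, ← adFock_wedge]

/-- An operator that kills the vacuum and can be moved past every `x ∧ ·` is zero, because the
vacuum generates `⋀ g` under these operators. -/
theorem fock_end_eq_zero {X : Module.End k (N ⊗[k] Fock k n)}
    (hvac : ∀ m, X (m ⊗ₜ Finsupp.single ∅ 1) = 0)
    (hcomm : ∀ x, ∃ Y : Module.End k (N ⊗[k] Fock k n),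
      X * (wedge b x).lTensor N = Y * X) : X = 0 := by
  refine LinearMap.ext fun v => ?_
  rw [LinearMap.zero_apply]
  induction v using fock_induction with
  | hadd x y hx hy => rw [map_add, hx, hy, add_zero]
  | hvac m => exact hvac m
  | hcre i x hx =>
    obtain ⟨Y, hY⟩ := hcomm (b i)
    rw [wedge_basis] at hY
    rw [← Module.End.mul_apply, hY, Module.End.mul_apply, hx, map_zero]

theorem lieDeriv_lie (hρ : ∀ x y, ρ ⁅x, y⁆ = ρ x * ρ y - ρ y * ρ x) (x y : g) :
    lieDeriv b ρ x * lieDeriv b ρ y - lieDeriv b ρ y * lieDeriv b ρ x - lieDeriv b ρ ⁅x, y⁆ =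
      0 := by
  refine fock_end_eq_zero b (fun m => ?_) fun z => ⟨(wedge b z).lTensor N, ?_⟩
  · simp [lieDeriv_tmul_vac, hρ, TensorProduct.sub_tmul]
  · have h1 := sub_eq_iff_eq_add.1 (lieDeriv_wedge b ρ x z)
    have h2 := sub_eq_iff_eq_add.1 (lieDeriv_wedge b ρ y z)
    have h3 := sub_eq_iff_eq_add.1 (lieDeriv_wedge b ρ ⁅x, y⁆ z)
    have h4 := sub_eq_iff_eq_add.1 (lieDeriv_wedge b ρ x ⁅y, z⁆)
    have h5 := sub_eq_iff_eq_add.1 (lieDeriv_wedge b ρ y ⁅x, z⁆)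
    rw [lie_lie x y z, map_sub, LinearMap.lTensor_sub] at h3
    simp only [sub_mul, mul_assoc, h1, h2, h3, mul_add, mul_sub]
    simp only [← mul_assoc, h1, h2, h4, h5, add_mul]
    abel

theorem ceDiff_lieDeriv (hρ : ∀ x y, ρ ⁅x, y⁆ = ρ x * ρ y - ρ y * ρ x) (y : g) :
    ceDiff b ρ * lieDeriv b ρ y - lieDeriv b ρ y * ceDiff b ρ = 0 := by
  refine fock_end_eq_zero b (fun m => ?_) fun x => ⟨-(wedge b x).lTensor N, ?_⟩
  · simp [lieDeriv_tmul_vac, ceDiff_tmul_vac]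
  · have h1 := eq_sub_of_add_eq (ceDiff_wedge b ρ x)
    have h2 := sub_eq_iff_eq_add.1 (lieDeriv_wedge b ρ y x)
    have h3 := eq_sub_of_add_eq (ceDiff_wedge b ρ ⁅y, x⁆)
    have h4 := lieDeriv_lie b ρ hρ y x
    rw [sub_eq_zero] at h4
    simp only [sub_mul, mul_assoc, h1, h2, mul_add, mul_sub]
    simp only [← mul_assoc, h1, h2, h3, ← h4, add_mul, sub_mul, neg_mul]
    simp only [mul_assoc]
    abel

/-- The square of the Chevalley–Eilenberg differential vanishes: by Cartan's formula it commutes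
with exterior multiplication, and it kills the vacuum. -/
theorem ceDiff_mul_self (hρ : ∀ x y, ρ ⁅x, y⁆ = ρ x * ρ y - ρ y * ρ x) :
    ceDiff b ρ * ceDiff b ρ = 0 := by
  refine fock_end_eq_zero b (fun m => ?_) fun x => ⟨(wedge b x).lTensor N, ?_⟩
  · simp [ceDiff_tmul_vac]
  · have h1 := eq_sub_of_add_eq (ceDiff_wedge b ρ x)
    have h2 := sub_eq_zero.1 (ceDiff_lieDeriv b ρ hρ x)
    rw [mul_assoc, h1, mul_sub, h2, ← mul_assoc _ _ (ceDiff b ρ), h1, sub_mul, mul_assoc]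
    abel

end ChevalleyEilenberg

/-! ### The Poincaré–Birkhoff–Witt theorem -/

section PBW

variable {k : Type*} [Field k] {g : Type*} [LieRing g] [LieAlgebra k g] {n : ℕ}

variable (k n) in
/-- The underlying vector space of the polynomial ring in `n` variables: its basis vectors are the
multisets `s` of indices, i.e. the monomials. -/
abbrev MonomialSpace := Multiset (Fin n) →₀ k

noncomputable instance : AddCommGroup (MonomialSpace k n) := Finsupp.instAddCommGroup

noncomputable instance : Ring (Module.End k (MonomialSpace k n)) := Module.End.instRing

variable (k) in
/-- The monomial with multiset of indices `s`. -/
noncomputable abbrev mono (s : Multiset (Fin n)) : MonomialSpace k n := Finsupp.single s 1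

variable (k n) in
/-- The polynomials of degree at most `d`. -/
noncomputable def degLE (d : ℕ) : Submodule k (MonomialSpace k n) :=
  Finsupp.supported k k {s | s.card ≤ d}

theorem mono_mem_degLE {s : Multiset (Fin n)} {d : ℕ} (h : s.card ≤ d) :
    mono k s ∈ degLE k n d :=
  Finsupp.single_mem_supported k 1 h

theorem degLE_mono {d e : ℕ} (h : d ≤ e) : degLE k n d ≤ degLE k n e :=
  Finsupp.supported_mono fun _ hs => le_trans (show _ ≤ d from hs) h

theorem degLE_eq_span (d : ℕ) :
    degLE k n d = Submodule.span k (mono k '' {s : Multiset (Fin n) | s.card ≤ d}) :=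
  Finsupp.supported_eq_span_single k _

/-- A linear condition that holds on the monomials of degree at most `d` holds on `degLE k n d`. -/
theorem degLE_le {d : ℕ} {p : Submodule k (MonomialSpace k n)}
    (h : ∀ s : Multiset (Fin n), s.card ≤ d → mono k s ∈ p) : degLE k n d ≤ p := by
  rw [degLE_eq_span, Submodule.span_le]
  rintro _ ⟨s, hs, rfl⟩
  exact h s hs

theorem exists_eq_cons_min {s : Multiset (Fin n)} {i : Fin n} (h : ¬ ∀ l ∈ s, i ≤ l) :
    ∃ j t, s = j ::ₘ t ∧ (∀ l ∈ t, j ≤ l) ∧ j < i := by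
  push Not at h
  obtain ⟨l, hl, hli⟩ := h
  obtain ⟨j, hj, hmin⟩ := s.toFinset.exists_min_image id ⟨l, by simpa using hl⟩
  rw [Multiset.mem_toFinset] at hj
  obtain ⟨t, rfl⟩ := Multiset.exists_cons_of_mem hj
  refine ⟨j, t, rfl, fun m hm => hmin m (by simp [hm]),
    lt_of_le_of_lt (hmin l (by simpa using hl)) hli⟩

theorem exists_pair_eq_cons_min {s : Multiset (Fin n)} {i : Fin n} (h : ¬ ∀ l ∈ s, i ≤ l) :
    ∃ p : Fin n × Multiset (Fin n), s = p.1 ::ₘ p.2 ∧ (∀ l ∈ p.2, p.1 ≤ l) ∧ p.1 < i :=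
  let ⟨j, t, h⟩ := exists_eq_cons_min h
  ⟨(j, t), h⟩

theorem cons_min_unique {j j' : Fin n} {t t' : Multiset (Fin n)} (h : j ::ₘ t = j' ::ₘ t')
    (hj : ∀ l ∈ t, j ≤ l) (hj' : ∀ l ∈ t', j' ≤ l) : j = j' ∧ t = t' := by
  have h1 : j ≤ j' := by
    have : j' ∈ j ::ₘ t := h ▸ Multiset.mem_cons_self j' t'
    rcases Multiset.mem_cons.1 this with rfl | h'
    · exact le_rfl
    · exact hj _ h'
  have h2 : j' ≤ j := by
    have : j ∈ j' ::ₘ t' := h ▸ Multiset.mem_cons_self j t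
    rcases Multiset.mem_cons.1 this with rfl | h'
    · exact le_rfl
    · exact hj' _ h'
  obtain rfl := le_antisymm h1 h2
  exact ⟨rfl, (Multiset.cons_inj_right j).1 h⟩

variable (b : Module.Basis (Fin n) k g)

theorem apply_eq_of_basis {P Q : g →ₗ[k] Module.End k (MonomialSpace k n)} {v : MonomialSpace k n}
    (h : ∀ i, P (b i) v = Q (b i) v) (x : g) : P x v = Q x v :=
  LinearMap.congr_fun (b.ext (f₁ := P.flip v) (f₂ := Q.flip v) h) x

open Classical in
/-- One step of the recursion for the action of `g` on polynomials: `e_i` sends a monomial `s` all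
of whose indices are at least `i` to `i s`; for `s = j t` with `j < i` minimal it is
`e_j e_i t + [e_i, e_j] t`, where `P` is the action on polynomials of degree less than that
of `s` and where the leading term of `e_j e_i t` is `i j t`. -/
noncomputable def pbwStep (P : g →ₗ[k] Module.End k (MonomialSpace k n)) (i : Fin n)
    (s : Multiset (Fin n)) : MonomialSpace k n :=
  if h : ∀ l ∈ s, i ≤ l then mono k (i ::ₘ s) else
    let j := (exists_pair_eq_cons_min h).choose.1
    let t := (exists_pair_eq_cons_min h).choose.2
    mono k (i ::ₘ s) + P (b j) (P (b i) (mono k t) - mono k (i ::ₘ t)) + P ⁅b i, b j⁆ (mono k t)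

theorem pbwStep_of_le (P : g →ₗ[k] Module.End k (MonomialSpace k n)) {i : Fin n}
    {s : Multiset (Fin n)} (h : ∀ l ∈ s, i ≤ l) : pbwStep b P i s = mono k (i ::ₘ s) :=
  dif_pos h

theorem pbwStep_cons (P : g →ₗ[k] Module.End k (MonomialSpace k n)) {i j : Fin n}
    {t : Multiset (Fin n)} (h : ∀ l ∈ t, j ≤ l) (hji : j < i) :
    pbwStep b P i (j ::ₘ t) = mono k (i ::ₘ j ::ₘ t) +
      P (b j) (P (b i) (mono k t) - mono k (i ::ₘ t)) + P ⁅b i, b j⁆ (mono k t) := by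
  have hn : ¬ ∀ l ∈ j ::ₘ t, i ≤ l := fun h' =>
    (h' j (Multiset.mem_cons_self j t)).not_gt hji
  have hs := (exists_pair_eq_cons_min hn).choose_spec
  obtain ⟨h1, h2⟩ := cons_min_unique hs.1 h hs.2.1
  have hp : (exists_pair_eq_cons_min hn).choose = (j, t) := Prod.ext h1.symm h2.symm
  rw [pbwStep, dif_neg hn]
  simp only [hp]

/-- The approximations to the action of `g` on polynomials; the `d`-th is correct in degrees at
most `d`. -/
noncomputable def pbwApprox : ℕ → g →ₗ[k] Module.End k (MonomialSpace k n)
  | 0 => b.constr k fun i => Finsupp.linearCombination k fun s => mono k (i ::ₘ s)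
  | d + 1 => b.constr k fun i => Finsupp.linearCombination k fun s => pbwStep b (pbwApprox d) i s

theorem pbwApprox_zero (i : Fin n) (s : Multiset (Fin n)) :
    pbwApprox b 0 (b i) (mono k s) = mono k (i ::ₘ s) := by
  simp [pbwApprox]

theorem pbwApprox_succ (d : ℕ) (i : Fin n) (s : Multiset (Fin n)) :
    pbwApprox b (d + 1) (b i) (mono k s) = pbwStep b (pbwApprox b d) i s := by
  simp [pbwApprox]

/-- An operator family with leading term `e_i s = i s + ⋯` raises the degree by at most one. -/
theorem apply_mem_degLE_succ {P : g →ₗ[k] Module.End k (MonomialSpace k n)}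
    (hP : ∀ i s, P (b i) (mono k s) - mono k (i ::ₘ s) ∈ degLE k n s.card) (x : g) {d : ℕ}
    {v : MonomialSpace k n} (hv : v ∈ degLE k n d) : P x v ∈ degLE k n (d + 1) := by
  have h : ∀ i, degLE k n d ≤ (degLE k n (d + 1)).comap (P (b i)) := by
    intro i
    refine degLE_le fun s hs => ?_
    rw [Submodule.mem_comap, ← sub_add_cancel (P (b i) (mono k s)) (mono k (i ::ₘ s))]
    exact add_mem (degLE_mono (by omega) (hP i s)) (mono_mem_degLE (by simpa using hs))
  rw [← b.sum_repr x, map_sum, LinearMap.sum_apply]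
  refine sum_mem fun i _ => ?_
  rw [map_smul, LinearMap.smul_apply]
  exact Submodule.smul_mem _ _ (h i hv)

theorem pbwApprox_sub_mem (d : ℕ) (i : Fin n) (s : Multiset (Fin n)) :
    pbwApprox b d (b i) (mono k s) - mono k (i ::ₘ s) ∈ degLE k n s.card := by
  induction d generalizing i s with
  | zero => rw [pbwApprox_zero, sub_self]; exact zero_mem _
  | succ d ih =>
    rw [pbwApprox_succ]
    by_cases h : ∀ l ∈ s, i ≤ l
    · rw [pbwStep_of_le b _ h, sub_self]; exact zero_mem _
    · obtain ⟨j, t, rfl, hj, hji⟩ := exists_eq_cons_min h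
      rw [pbwStep_cons b _ hj hji, add_assoc, add_sub_cancel_left, Multiset.card_cons]
      exact add_mem (apply_mem_degLE_succ b ih _ (ih i t))
        (apply_mem_degLE_succ b ih _ (mono_mem_degLE le_rfl))

/-- The approximations stabilise: on polynomials of degree at most `d`, step `d` is already
final. -/
theorem pbwApprox_stable (d : ℕ) (x : g) {v : MonomialSpace k n} (hv : v ∈ degLE k n d) :
    pbwApprox b (d + 1) x v = pbwApprox b d x v := by
  induction d generalizing x v with
  | zero =>
    refine apply_eq_of_basis b (fun i => ?_) x
    refine LinearMap.mem_eqLocus.1 (degLE_le (fun s hs => ?_) hv)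
    rw [LinearMap.mem_eqLocus, pbwApprox_succ, pbwApprox_zero, pbwStep_of_le]
    rw [Multiset.card_eq_zero.1 (Nat.le_zero.1 hs)]
    simp
  | succ d ih =>
    refine apply_eq_of_basis b (fun i => ?_) x
    refine LinearMap.mem_eqLocus.1 (degLE_le (fun s hs => ?_) hv)
    rw [LinearMap.mem_eqLocus, pbwApprox_succ, pbwApprox_succ]
    by_cases h : ∀ l ∈ s, i ≤ l
    · rw [pbwStep_of_le b _ h, pbwStep_of_le b _ h]
    · obtain ⟨j, t, rfl, hj, hji⟩ := exists_eq_cons_min h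
      have ht : t.card ≤ d := by simpa using hs
      rw [pbwStep_cons b _ hj hji, pbwStep_cons b _ hj hji, ih _ (mono_mem_degLE ht),
        ih _ (mono_mem_degLE ht), ih _ (degLE_mono ht (pbwApprox_sub_mem b d i t))]

/-- The action of `g` on polynomials that makes them the left regular module `U(g)`. -/
noncomputable def pbwAct : g →ₗ[k] Module.End k (MonomialSpace k n) :=
  b.constr k fun i => Finsupp.linearCombination k fun s => pbwApprox b s.card (b i) (mono k s)

theorem pbwAct_basis_mono (i : Fin n) (s : Multiset (Fin n)) :
    pbwAct b (b i) (mono k s) = pbwApprox b s.card (b i) (mono k s) := by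
  simp [pbwAct]

theorem pbwApprox_eq_pbwAct {d : ℕ} (x : g) {v : MonomialSpace k n} (hv : v ∈ degLE k n d) :
    pbwApprox b d x v = pbwAct b x v := by
  refine apply_eq_of_basis b (fun i => ?_) x
  refine LinearMap.mem_eqLocus.1 (degLE_le (fun s hs => ?_) hv)
  rw [LinearMap.mem_eqLocus, pbwAct_basis_mono]
  clear hv
  induction d, hs using Nat.le_induction with
  | base => rfl
  | succ d hd ih => rw [pbwApprox_stable b d _ (mono_mem_degLE hd), ih]

theorem pbwAct_sub_mem (i : Fin n) (s : Multiset (Fin n)) :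
    pbwAct b (b i) (mono k s) - mono k (i ::ₘ s) ∈ degLE k n s.card := by
  rw [pbwAct_basis_mono]
  exact pbwApprox_sub_mem b _ i s

theorem pbwAct_of_le {i : Fin n} {s : Multiset (Fin n)} (h : ∀ l ∈ s, i ≤ l) :
    pbwAct b (b i) (mono k s) = mono k (i ::ₘ s) := by
  rw [← pbwApprox_eq_pbwAct b (d := s.card + 1) _ (mono_mem_degLE (Nat.le_succ _)),
    pbwApprox_succ, pbwStep_of_le b _ h]

theorem pbwAct_cons {i j : Fin n} {t : Multiset (Fin n)} (h : ∀ l ∈ t, j ≤ l) (hji : j < i) :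
    pbwAct b (b i) (mono k (j ::ₘ t)) =
      pbwAct b (b j) (pbwAct b (b i) (mono k t)) + pbwAct b ⁅b i, b j⁆ (mono k t) := by
  have hit : ∀ l ∈ i ::ₘ t, j ≤ l := by
    intro l hl
    rcases Multiset.mem_cons.1 hl with rfl | hl
    · exact hji.le
    · exact h l hl
  rw [← pbwApprox_eq_pbwAct b (d := t.card + 1) _ (mono_mem_degLE (by simp)), pbwApprox_succ,
    pbwStep_cons b _ h hji, pbwApprox_eq_pbwAct b _ (mono_mem_degLE le_rfl),
    pbwApprox_eq_pbwAct b _ (mono_mem_degLE le_rfl),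
    pbwApprox_eq_pbwAct b _ (pbwAct_sub_mem b i t), map_sub, pbwAct_of_le b hit,
    Multiset.cons_swap]
  abel

theorem pbwAct_lie_of_le {i j : Fin n} {s : Multiset (Fin n)} (h : ∀ l ∈ s, j ≤ l) (hji : j < i) :
    pbwAct b (b i) (pbwAct b (b j) (mono k s)) =
      pbwAct b (b j) (pbwAct b (b i) (mono k s)) + pbwAct b ⁅b i, b j⁆ (mono k s) := by
  rw [pbwAct_of_le b h, pbwAct_cons b h hji]

/-- The commutator relation on polynomials of degree at most `d`, from the relation on
monomials. -/
theorem pbwAct_lie_of_mono {d : ℕ} {x y : g}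
    (h : ∀ s : Multiset (Fin n), s.card ≤ d → pbwAct b x (pbwAct b y (mono k s)) =
      pbwAct b y (pbwAct b x (mono k s)) + pbwAct b ⁅x, y⁆ (mono k s))
    {v : MonomialSpace k n} (hv : v ∈ degLE k n d) :
    pbwAct b x (pbwAct b y v) = pbwAct b y (pbwAct b x v) + pbwAct b ⁅x, y⁆ v :=
  LinearMap.mem_eqLocus.1 (degLE_le (p := LinearMap.eqLocus (pbwAct b x * pbwAct b y)
    (pbwAct b y * pbwAct b x + pbwAct b ⁅x, y⁆)) h hv)

theorem pbwAct_lie_of_lt {v : MonomialSpace k n}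
    (h : ∀ i j, j < i → pbwAct b (b i) (pbwAct b (b j) v) =
      pbwAct b (b j) (pbwAct b (b i) v) + pbwAct b ⁅b i, b j⁆ v) (x y : g) :
    pbwAct b x (pbwAct b y v) = pbwAct b y (pbwAct b x v) + pbwAct b ⁅x, y⁆ v := by
  let F : g →ₗ[k] g →ₗ[k] MonomialSpace k n :=
    LinearMap.mk₂ k (fun x y => pbwAct b x (pbwAct b y v))
      (by simp) (by simp) (by simp) (by simp)
  let G : g →ₗ[k] g →ₗ[k] MonomialSpace k n :=
    LinearMap.mk₂ k (fun x y => pbwAct b y (pbwAct b x v) + pbwAct b ⁅x, y⁆ v)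
      (by intros; simp; abel) (by simp) (by intros; simp; abel) (by simp)
  have hFG : F = G := by
    refine b.ext fun i => b.ext fun j => ?_
    change pbwAct b (b i) (pbwAct b (b j) v) =
      pbwAct b (b j) (pbwAct b (b i) v) + pbwAct b ⁅b i, b j⁆ v
    rcases lt_trichotomy i j with hij | rfl | hij
    · rw [h j i hij, ← lie_skew (b i) (b j), map_neg, LinearMap.neg_apply]
      abel
    · simp
    · exact h i j hij
  exact LinearMap.congr_fun (LinearMap.congr_fun hFG x) y

/-- The action is a Lie algebra action. By induction on the degree; the case in which neither letter
can be put in front of the monomial follows from the Jacobi identity. -/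
theorem pbwAct_lie_mono (d : ℕ) (s : Multiset (Fin n)) (hs : s.card < d) (x y : g) :
    pbwAct b x (pbwAct b y (mono k s)) =
      pbwAct b y (pbwAct b x (mono k s)) + pbwAct b ⁅x, y⁆ (mono k s) := by
  induction d generalizing s x y with
  | zero => omega
  | succ d ih =>
    refine pbwAct_lie_of_lt b (fun i j hji => ?_) x y
    by_cases h : ∀ l ∈ s, j ≤ l
    · exact pbwAct_lie_of_le b h hji
    obtain ⟨l, r, rfl, hl, hlj⟩ := exists_eq_cons_min h
    have hr : r.card < d := by simpa using hs
    -- `s = e_l r` with `l` minimal; move `e_l` to the front, where both sides are known.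
    have comm : ∀ i j, l < i → l < j →
        pbwAct b (b i) (pbwAct b (b l) (pbwAct b (b j) (mono k r))) =
          pbwAct b (b l) (pbwAct b (b i) (pbwAct b (b j) (mono k r))) +
          pbwAct b ⁅b i, b l⁆ (pbwAct b (b j) (mono k r)) := by
      intro i j hi hj
      have h1 := pbwAct_lie_of_mono b (x := b i) (y := b l) (d := r.card)
        (fun s hs => ih s (hs.trans_lt hr) _ _) (pbwAct_sub_mem b j r)
      have h2 := pbwAct_lie_of_le b (s := j ::ₘ r) (fun m hm => by
        rcases Multiset.mem_cons.1 hm with rfl | hm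
        · exact hj.le
        · exact hl m hm) hi
      simp only [map_sub] at h1
      rw [h2] at h1
      rw [← sub_eq_zero] at h1 ⊢
      rw [← h1]
      abel
    rw [← pbwAct_of_le b hl, ih r hr (b j) (b l), map_add, comm i j (hlj.trans hji) hlj,
      ih r hr (b i) ⁅b j, b l⁆, ih r hr (b i) (b l), map_add, comm j i hlj (hlj.trans hji),
      ih r hr (b j) ⁅b i, b l⁆, ih r hr (b i) (b j), map_add, ih r hr ⁅b i, b j⁆ (b l),
      leibniz_lie (b i) (b j) (b l), map_add, LinearMap.add_apply]
    abel

/-- `pbwAct` is a representation of `g`. -/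
theorem pbwAct_lie (x y : g) :
    pbwAct b ⁅x, y⁆ = pbwAct b x * pbwAct b y - pbwAct b y * pbwAct b x := by
  refine Finsupp.lhom_ext fun s c => ?_
  rw [← mul_one c, ← smul_eq_mul, ← Finsupp.smul_single, map_smul, map_smul]
  congr 1
  simp only [LinearMap.sub_apply, Module.End.mul_apply]
  rw [pbwAct_lie_mono b _ s (Nat.lt_succ_self _), add_sub_cancel_left]

end PBW

section Universal

attribute [local instance] LieRing.ofAssociativeRing

variable {k : Type*} [Field k] {g : Type*} [LieRing g] [LieAlgebra k g]

variable (k) in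
/-- The canonical map `g → U(g)`, as a linear map. -/
noncomputable def toU : g →ₗ[k] UniversalEnvelopingAlgebra k g where
  toFun := UniversalEnvelopingAlgebra.ι k
  map_add' := map_add _
  map_smul' := map_smul _

theorem toU_lie (x y : g) : toU k ⁅x, y⁆ = toU k x * toU k y - toU k y * toU k x := by
  change UniversalEnvelopingAlgebra.ι k ⁅x, y⁆ = _
  rw [LieHom.map_lie, LieRing.of_associative_ring_bracket]
  rfl

/-- The algebra map on `U(g)` that extends a linear map compatible with brackets. -/
noncomputable def liftU {B : Type*} [Ring B] [Algebra k B] (f : g →ₗ[k] B)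
    (hf : ∀ x y, f ⁅x, y⁆ = f x * f y - f y * f x) : UniversalEnvelopingAlgebra k g →ₐ[k] B :=
  UniversalEnvelopingAlgebra.lift k
    { f with map_lie' := fun {x y} => by
              rw [LieRing.of_associative_ring_bracket]; exact hf x y }

theorem liftU_toU {B : Type*} [Ring B] [Algebra k B] (f : g →ₗ[k] B)
    (hf : ∀ x y, f ⁅x, y⁆ = f x * f y - f y * f x) (x : g) : liftU f hf (toU k x) = f x := by
  rw [liftU, toU, LinearMap.coe_mk, AddHom.coe_mk, UniversalEnvelopingAlgebra.lift_ι_apply]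
  rfl

/-- A subalgebra of `U(g)` that contains `g` is everything. -/
theorem mem_of_toU_mem (S : Subalgebra k (UniversalEnvelopingAlgebra k g))
    (hS : ∀ x, toU k x ∈ S) (u : UniversalEnvelopingAlgebra k g) : u ∈ S := by
  let f : g →ₗ[k] S := (toU k).codRestrict (Subalgebra.toSubmodule S) hS
  have hf : ∀ x y, f ⁅x, y⁆ = f x * f y - f y * f x := fun x y => Subtype.ext (toU_lie x y)
  have hid : S.val.comp (liftU f hf) = AlgHom.id k _ :=
    UniversalEnvelopingAlgebra.hom_ext k (LieHom.ext fun x =>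
      congrArg Subtype.val (liftU_toU f hf x))
  rw [← AlgHom.id_apply (R := k) u, ← hid]
  exact (liftU f hf u).2

end Universal

section PBW

variable {k : Type*} [Field k] {g : Type*} [LieRing g] [LieAlgebra k g] {n : ℕ}
  (b : Module.Basis (Fin n) k g)

/-- The linear map from polynomials to `U(g)` that sends a monomial `e_{i₁} ⋯ e_{i_q}` with
`i₁ ≤ ⋯ ≤ i_q` to the product of the `e_i` in this order. -/
noncomputable def orderedProd : MonomialSpace k n →ₗ[k] UniversalEnvelopingAlgebra k g :=
  Finsupp.linearCombination k fun s => ((s.sort (· ≤ ·)).map fun i => toU k (b i)).prod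

theorem orderedProd_zero : orderedProd b (mono k 0) = 1 := by
  simp [orderedProd]

theorem orderedProd_cons {i : Fin n} {s : Multiset (Fin n)} (h : ∀ l ∈ s, i ≤ l) :
    orderedProd b (mono k (i ::ₘ s)) = toU k (b i) * orderedProd b (mono k s) := by
  simp [orderedProd, Multiset.sort_cons (r := (· ≤ ·)) (s := s) (a := i) h]

theorem orderedProd_pbwAct_of_mono {d : ℕ} {x : g}
    (h : ∀ i, ∀ s : Multiset (Fin n), s.card ≤ d → orderedProd b (pbwAct b (b i) (mono k s)) =
      toU k (b i) * orderedProd b (mono k s))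
    {v : MonomialSpace k n} (hv : v ∈ degLE k n d) :
    orderedProd b (pbwAct b x v) = toU k x * orderedProd b v := by
  have h' : ∀ i, orderedProd b (pbwAct b (b i) v) = toU k (b i) * orderedProd b v := fun i =>
    LinearMap.mem_eqLocus.1 (degLE_le (p := LinearMap.eqLocus (orderedProd b ∘ₗ pbwAct b (b i))
      (LinearMap.mulLeft k (toU k (b i)) ∘ₗ orderedProd b)) (h i) hv)
  exact LinearMap.congr_fun (b.ext (f₁ := orderedProd b ∘ₗ (pbwAct b).flip v)
    (f₂ := (LinearMap.mul k _).flip (orderedProd b v) ∘ₗ toU k) h') x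

theorem orderedProd_pbwAct_mono (d : ℕ) (i : Fin n) (s : Multiset (Fin n)) (hs : s.card < d) :
    orderedProd b (pbwAct b (b i) (mono k s)) = toU k (b i) * orderedProd b (mono k s) := by
  induction d generalizing i s with
  | zero => omega
  | succ d ih =>
    by_cases h : ∀ l ∈ s, i ≤ l
    · rw [pbwAct_of_le b h, orderedProd_cons b h]
    obtain ⟨j, t, rfl, hj, hji⟩ := exists_eq_cons_min h
    have ht : t.card < d := by simpa using hs
    have ih' : ∀ x : g, ∀ v ∈ degLE k n t.card,
        orderedProd b (pbwAct b x v) = toU k x * orderedProd b v := fun x v hv =>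
      orderedProd_pbwAct_of_mono b (fun i s hs => ih i s (hs.trans_lt ht)) hv
    have hjt : ∀ l ∈ i ::ₘ t, j ≤ l := fun l hl => by
      rcases Multiset.mem_cons.1 hl with rfl | hl
      · exact hji.le
      · exact hj l hl
    -- `e_i t` is its leading term, to which `e_j` applies as a product, plus lower terms.
    have h1 := ih' (b j) _ (pbwAct_sub_mem b i t)
    rw [map_sub, map_sub, pbwAct_of_le b hjt, orderedProd_cons b hjt, map_sub, mul_sub,
      sub_left_inj, ih i t ht] at h1
    rw [pbwAct_cons b hj hji, map_add, h1, ih' _ _ (mono_mem_degLE le_rfl), toU_lie,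
      orderedProd_cons b hj]
    noncomm_ring

/-- Taking ordered products intertwines the action on polynomials with left multiplication on
`U(g)`. -/
theorem orderedProd_pbwAct (x : g) (v : MonomialSpace k n) :
    orderedProd b (pbwAct b x v) = toU k x * orderedProd b v := by
  refine LinearMap.congr_fun (Finsupp.lhom_ext (φ := orderedProd b ∘ₗ pbwAct b x)
    (ψ := LinearMap.mulLeft k (toU k x) ∘ₗ orderedProd b) fun s c => ?_) v
  rw [← mul_one c, ← smul_eq_mul, ← Finsupp.smul_single, map_smul, map_smul]
  congr 1
  exact orderedProd_pbwAct_of_mono b (fun i s _ => orderedProd_pbwAct_mono b _ i s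
    (Nat.lt_succ_self _)) (mono_mem_degLE le_rfl)

/-- The representation of `U(g)` on polynomials. -/
noncomputable def pbwRep : UniversalEnvelopingAlgebra k g →ₐ[k] Module.End k (MonomialSpace k n) :=
  liftU (pbwAct b) (pbwAct_lie b)

theorem pbwRep_toU (x : g) : pbwRep b (toU k x) = pbwAct b x :=
  liftU_toU _ _ x

theorem orderedProd_pbwRep (u : UniversalEnvelopingAlgebra k g) (v : MonomialSpace k n) :
    orderedProd b (pbwRep b u v) = u * orderedProd b v := by
  let S : Subalgebra k (UniversalEnvelopingAlgebra k g) :=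
    { carrier := {u | ∀ v, orderedProd b (pbwRep b u v) = u * orderedProd b v}
      mul_mem' := fun {u w} hu hw v => by
        rw [map_mul, Module.End.mul_apply, hu, hw, mul_assoc]
      add_mem' := fun {u w} hu hw v => by
        rw [map_add, LinearMap.add_apply, map_add, hu, hw, add_mul]
      algebraMap_mem' := fun c v => by
        simp [Algebra.smul_def] }
  exact mem_of_toU_mem S (fun x v => by rw [pbwRep_toU, orderedProd_pbwAct]) u v

/-- An ordered product takes `1` to the monomial it came from; hence ordered products of distinct
monomials are linearly independent. -/
theorem pbwRep_orderedProd (s : Multiset (Fin n)) :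
    pbwRep b (orderedProd b (mono k s)) (mono k 0) = mono k s := by
  induction h : s.card generalizing s with
  | zero =>
    rw [Multiset.card_eq_zero.1 h, orderedProd_zero, map_one, Module.End.one_apply]
  | succ d ih =>
    obtain ⟨i, t, rfl, hi⟩ : ∃ i t, s = i ::ₘ t ∧ ∀ l ∈ t, i ≤ l := by
      obtain ⟨m, hm⟩ := Multiset.card_pos_iff_exists_mem.1 (by omega : 0 < s.card)
      obtain ⟨i, hi, hmin⟩ := s.toFinset.exists_min_image id ⟨m, by simpa using hm⟩
      obtain ⟨t, rfl⟩ := Multiset.exists_cons_of_mem (Multiset.mem_toFinset.1 hi)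
      exact ⟨i, t, rfl, fun l hl => hmin l (by simp [hl])⟩
    rw [orderedProd_cons b hi, map_mul, Module.End.mul_apply, ih t (by simpa using h),
      pbwRep_toU, pbwAct_of_le b hi]

/-- The Poincaré–Birkhoff–Witt theorem: polynomials are isomorphic to `U(g)`, as vector spaces and
(`orderedProd_pbwAct`) as `g`-modules. -/
noncomputable def pbwEquiv : MonomialSpace k n ≃ₗ[k] UniversalEnvelopingAlgebra k g :=
  LinearEquiv.ofLinearMap (orderedProd b) ((pbwRep b).toLinearMap.flip (mono k 0))
    (LinearMap.ext fun u => by simp [orderedProd_pbwRep, orderedProd_zero])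
    (Finsupp.lhom_ext fun s c => by
      rw [← mul_one c, ← smul_eq_mul, ← Finsupp.smul_single, map_smul, map_smul]
      congr 1
      exact pbwRep_orderedProd b s)

end PBW

/-! ### Acyclicity of the Chevalley–Eilenberg complex of the enveloping algebra -/

section Koszul

variable {k : Type*} [Field k] {n : ℕ}

variable (k n) in
/-- The `q`-th exterior power, as the subspace of the exterior algebra spanned by the basis vectors
of the `q`-element subsets. -/
noncomputable def extPow (q : ℕ) : Submodule k (Fock k n) :=
  Finsupp.supported k k {T | T.card = q}

theorem single_mem_extPow {T : Finset (Fin n)} {q : ℕ} (h : T.card = q) (c : k) :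
    Finsupp.single T c ∈ extPow k n q :=
  Finsupp.single_mem_supported k c h

/-- A linear condition that holds on the basis vectors of degree `q` holds on `extPow k n q`. -/
theorem extPow_le {q : ℕ} {p : Submodule k (Fock k n)}
    (h : ∀ T : Finset (Fin n), T.card = q → Finsupp.single T 1 ∈ p) : extPow k n q ≤ p := by
  rw [extPow, Finsupp.supported_eq_span_single, Submodule.span_le]
  rintro _ ⟨s, hs, rfl⟩
  exact h s hs

theorem creation_mem_extPow (i : Fin n) {q : ℕ} {w : Fock k n} (hw : w ∈ extPow k n q) :
    creation k i w ∈ extPow k n (q + 1) := by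
  refine extPow_le (p := (extPow k n (q + 1)).comap (creation k i)) (fun T hT => ?_) hw
  rw [Submodule.mem_comap, creation_single]
  split_ifs with h
  · exact zero_mem _
  · exact single_mem_extPow (by rw [Finset.card_insert_of_notMem h, hT]) _

theorem annihilation_mem_extPow (i : Fin n) {q : ℕ} {w : Fock k n} (hw : w ∈ extPow k n (q + 1)) :
    annihilation k i w ∈ extPow k n q := by
  refine extPow_le (p := (extPow k n q).comap (annihilation k i)) (fun T hT => ?_) hw
  rw [Submodule.mem_comap, annihilation_single]
  split_ifs with h
  · exact single_mem_extPow (by rw [Finset.card_erase_of_mem h, hT]; rfl) _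
  · exact zero_mem _

theorem annihilation_eq_zero (i : Fin n) {w : Fock k n} (hw : w ∈ extPow k n 0) :
    annihilation k i w = 0 := by
  refine extPow_le (p := LinearMap.ker (annihilation k i)) (fun T hT => ?_) hw
  rw [LinearMap.mem_ker, Finset.card_eq_zero.1 hT, annihilation_vac]

variable {g : Type*} [LieRing g] [LieAlgebra k g] (b : Module.Basis (Fin n) k g)

theorem wedge_mem_extPow (x : g) {q : ℕ} {w : Fock k n} (hw : w ∈ extPow k n q) :
    wedge b x w ∈ extPow k n (q + 1) := by
  rw [wedge_eq_sum, LinearMap.sum_apply]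
  exact sum_mem fun i _ => Submodule.smul_mem _ _ (creation_mem_extPow i hw)

theorem bracketFock_eq_zero {w : Fock k n} (hw : w ∈ extPow k n 0) : bracketFock b w = 0 := by
  refine extPow_le (p := LinearMap.ker (bracketFock b)) (fun T hT => ?_) hw
  rw [LinearMap.mem_ker, Finset.card_eq_zero.1 hT, bracketFock_vac]

theorem bracketFock_mem_extPow {q : ℕ} {w : Fock k n} (hw : w ∈ extPow k n (q + 1)) :
    bracketFock b w ∈ extPow k n q := by
  rw [bracketFock, LinearMap.sum_apply]
  refine sum_mem fun i _ => ?_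
  rw [LinearMap.sum_apply]
  refine sum_mem fun j _ => ?_
  split_ifs
  · rw [Module.End.mul_apply, Module.End.mul_apply]
    have h := annihilation_mem_extPow j hw
    cases q with
    | zero => rw [annihilation_eq_zero i h, map_zero]; exact zero_mem _
    | succ q => exact wedge_mem_extPow b _ (annihilation_mem_extPow i h)
  · exact zero_mem _

/-- The total filtration of `k[e₁, …, e_n] ⊗ ⋀ g`: polynomials of degree `d` tensored with `e`-fold
products lie in step `d + e`. -/
noncomputable def totalLE (k : Type*) [Field k] (n p : ℕ) :
    Submodule k (MonomialSpace k n ⊗[k] Fock k n) :=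
  Submodule.span k
    {x | ∃ (s : Multiset (Fin n)) (T : Finset (Fin n)), s.card + T.card ≤ p ∧
      x = mono k s ⊗ₜ Finsupp.single T 1}

theorem mono_tmul_mem_totalLE {s : Multiset (Fin n)} {T : Finset (Fin n)} {p : ℕ}
    (h : s.card + T.card ≤ p) : mono k s ⊗ₜ Finsupp.single T 1 ∈ totalLE k n p :=
  Submodule.subset_span ⟨s, T, h, rfl⟩

theorem totalLE_mono {p q : ℕ} (h : p ≤ q) : totalLE k n p ≤ totalLE k n q :=
  Submodule.span_mono fun _ ⟨s, T, hsT, hx⟩ => ⟨s, T, hsT.trans h, hx⟩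

theorem totalLE_le {p : ℕ} {P : Submodule k (MonomialSpace k n ⊗[k] Fock k n)}
    (h : ∀ (s : Multiset (Fin n)) (T : Finset (Fin n)), s.card + T.card ≤ p →
      mono k s ⊗ₜ Finsupp.single T 1 ∈ P) : totalLE k n p ≤ P := by
  rw [totalLE, Submodule.span_le]
  rintro _ ⟨s, T, hsT, rfl⟩
  exact h s T hsT

theorem tmul_mem_totalLE {d e p : ℕ} (h : d + e ≤ p) {v : MonomialSpace k n}
    (hv : v ∈ degLE k n d) {w : Fock k n} (hw : w ∈ extPow k n e) :
    v ⊗ₜ w ∈ totalLE k n p := by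
  refine degLE_le (p := (totalLE k n p).comap ((TensorProduct.mk k _ _).flip w))
    (fun s hs => ?_) hv
  refine extPow_le (p := (totalLE k n p).comap (TensorProduct.mk k _ _ (mono k s)))
    (fun T hT => ?_) hw
  exact mono_tmul_mem_totalLE (by omega)

theorem exists_mem_totalLE (x : MonomialSpace k n ⊗[k] Fock k n) : ∃ p, x ∈ totalLE k n p := by
  induction x with
  | zero => exact ⟨0, zero_mem _⟩
  | add x y hx hy =>
    obtain ⟨p, hp⟩ := hx
    obtain ⟨q, hq⟩ := hy
    exact ⟨max p q, add_mem (totalLE_mono (le_max_left _ _) hp)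
      (totalLE_mono (le_max_right _ _) hq)⟩
  | tmul v w =>
    induction v using Finsupp.induction_linear with
    | zero => exact ⟨0, by simp⟩
    | add v v' hv hv' =>
      obtain ⟨p, hp⟩ := hv
      obtain ⟨q, hq⟩ := hv'
      exact ⟨max p q, by
        rw [TensorProduct.add_tmul]
        exact add_mem (totalLE_mono (le_max_left _ _) hp) (totalLE_mono (le_max_right _ _) hq)⟩
    | single s c =>
      induction w using Finsupp.induction_linear with
      | zero => exact ⟨0, by simp⟩
      | add v v' hv hv' =>
        obtain ⟨p, hp⟩ := hv
        obtain ⟨q, hq⟩ := hv'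
        exact ⟨max p q, by
          rw [TensorProduct.tmul_add]
          exact add_mem (totalLE_mono (le_max_left _ _) hp) (totalLE_mono (le_max_right _ _) hq)⟩
      | single T c' =>
        refine ⟨s.card + T.card, ?_⟩
        rw [← mul_one c, ← smul_eq_mul, ← Finsupp.smul_single, ← TensorProduct.smul_tmul']
        exact Submodule.smul_mem _ _ (tmul_mem_totalLE le_rfl (mono_mem_degLE le_rfl)
          (single_mem_extPow rfl _))

open Classical in
/-- The contracting homotopy of the Koszul complex `k[e₁, …, e_n] ⊗ ⋀ g`: if the smallest index `m`
that occurs in `s ⊗ e_T` does not occur in `T`, one factor `e_m` is moved from the polynomial to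
the exterior algebra; otherwise the value is zero. -/
noncomputable def koszulHomotopy : Module.End k (MonomialSpace k n ⊗[k] Fock k n) :=
  TensorProduct.lift <| Finsupp.linearCombination k fun s => Finsupp.linearCombination k fun T =>
    if h : ∃ m ∈ s, (∀ l ∈ s, m ≤ l) ∧ ∀ l ∈ T, m < l then
      mono k (s.erase h.choose) ⊗ₜ[k] creation k h.choose (Finsupp.single T 1) else 0

theorem koszulHomotopy_of_min {m : Fin n} {t : Multiset (Fin n)} {T : Finset (Fin n)}
    (ht : ∀ l ∈ t, m ≤ l) (hT : ∀ l ∈ T, m < l) :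
    koszulHomotopy (mono k (m ::ₘ t) ⊗ₜ Finsupp.single T 1) =
      mono k t ⊗ₜ creation k m (Finsupp.single T 1) := by
  have h : ∃ m' ∈ m ::ₘ t, (∀ l ∈ m ::ₘ t, m' ≤ l) ∧ ∀ l ∈ T, m' < l :=
    ⟨m, Multiset.mem_cons_self m t, by simpa using ht, hT⟩
  have hm : h.choose = m := le_antisymm (h.choose_spec.2.1 m (Multiset.mem_cons_self m t)) (by
    rcases Multiset.mem_cons.1 h.choose_spec.1 with h' | h'
    · exact h'.ge
    · exact ht _ h')
  simp only [koszulHomotopy, TensorProduct.lift.tmul, Finsupp.linearCombination_single, one_smul]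
  refine (dif_pos h).trans ?_
  rw [hm, Multiset.erase_cons_head]

theorem koszulHomotopy_eq_zero {s : Multiset (Fin n)} {T : Finset (Fin n)}
    (h : ¬ ∃ m ∈ s, (∀ l ∈ s, m ≤ l) ∧ ∀ l ∈ T, m < l) :
    koszulHomotopy (mono k s ⊗ₜ Finsupp.single T 1) = 0 := by
  simp only [koszulHomotopy, TensorProduct.lift.tmul, Finsupp.linearCombination_single, one_smul]
  exact dif_neg h

theorem koszulHomotopy_mem {p : ℕ} {x : MonomialSpace k n ⊗[k] Fock k n}
    (hx : x ∈ totalLE k n p) : koszulHomotopy x ∈ totalLE k n p := by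
  refine totalLE_le (P := (totalLE k n p).comap koszulHomotopy) (fun s T h => ?_) hx
  rw [Submodule.mem_comap]
  by_cases hm : ∃ m ∈ s, (∀ l ∈ s, m ≤ l) ∧ ∀ l ∈ T, m < l
  · obtain ⟨m, hms, hm, hmT⟩ := hm
    obtain ⟨t, rfl⟩ := Multiset.exists_cons_of_mem hms
    rw [koszulHomotopy_of_min (fun l hl => hm l (Multiset.mem_cons_of_mem hl)) hmT]
    rw [Multiset.card_cons] at h
    exact tmul_mem_totalLE (e := T.card + 1) (by omega) (mono_mem_degLE le_rfl)
      (creation_mem_extPow m (single_mem_extPow rfl 1))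
  · rw [koszulHomotopy_eq_zero hm]; exact zero_mem _

variable (k n) in
/-- The differential of the Koszul complex `k[e₁, …, e_n] ⊗ ⋀ g`. -/
noncomputable def koszulDiff : Module.End k (MonomialSpace k n ⊗[k] Fock k n) :=
  ∑ i : Fin n, TensorProduct.map (Finsupp.lmapDomain k k (i ::ₘ ·)) (annihilation k i)

theorem koszulDiff_tmul (s : Multiset (Fin n)) (w : Fock k n) :
    koszulDiff k n (mono k s ⊗ₜ w) = ∑ i, mono k (i ::ₘ s) ⊗ₜ annihilation k i w := by
  simp [koszulDiff, LinearMap.sum_apply, Finsupp.mapDomain_single]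

/-- The homotopy formula, away from the constants `1 ⊗ vac`. -/
theorem koszulDiff_homotopy {s : Multiset (Fin n)} {T : Finset (Fin n)}
    (h : 0 < s.card + T.card) :
    koszulDiff k n (koszulHomotopy (mono k s ⊗ₜ Finsupp.single T 1)) +
      koszulHomotopy (koszulDiff k n (mono k s ⊗ₜ Finsupp.single T 1)) =
      mono k s ⊗ₜ Finsupp.single T 1 := by
  rw [koszulDiff_tmul, map_sum]
  by_cases hm : ∃ m ∈ s, (∀ l ∈ s, m ≤ l) ∧ ∀ l ∈ T, m < l
  · obtain ⟨m, hms, hm, hmT⟩ := hm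
    obtain ⟨t, rfl⟩ := Multiset.exists_cons_of_mem hms
    have ht : ∀ l ∈ t, m ≤ l := fun l hl => hm l (Multiset.mem_cons_of_mem hl)
    rw [koszulHomotopy_of_min ht hmT, koszulDiff_tmul, ← Finset.sum_add_distrib]
    have e : ∀ i, mono k (i ::ₘ t) ⊗ₜ[k] annihilation k i (creation k m (Finsupp.single T 1)) +
        koszulHomotopy (mono k (i ::ₘ m ::ₘ t) ⊗ₜ annihilation k i (Finsupp.single T 1)) =
        mono k (i ::ₘ t) ⊗ₜ[k] (if i = m then Finsupp.single T 1 else 0) := by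
      intro i
      have h1 : koszulHomotopy (mono k (i ::ₘ m ::ₘ t) ⊗ₜ annihilation k i (Finsupp.single T 1)) =
          mono k (i ::ₘ t) ⊗ₜ[k] creation k m (annihilation k i (Finsupp.single T 1)) := by
        rw [annihilation_single]
        split_ifs with hi
        · rw [one_mul, ← mul_one (koszulSign k i T), ← smul_eq_mul, ← Finsupp.smul_single,
            TensorProduct.tmul_smul, map_smul, map_smul, TensorProduct.tmul_smul,
            Multiset.cons_swap, koszulHomotopy_of_min]
          · intro l hl
            rcases Multiset.mem_cons.1 hl with rfl | hl
            · exact (hmT _ hi).le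
            · exact ht l hl
          · exact fun l hl => hmT l (Finset.mem_of_mem_erase hl)
        · simp
      have h2 := LinearMap.congr_fun (annihilation_creation k i m) (Finsupp.single T 1)
      rw [LinearMap.add_apply, Module.End.mul_apply, Module.End.mul_apply] at h2
      rw [h1, ← TensorProduct.tmul_add, h2]
      split_ifs <;> simp
    rw [Finset.sum_congr rfl fun i _ => e i, Finset.sum_eq_single m]
    · rw [if_pos rfl]
    · intro i _ hi
      rw [if_neg hi, TensorProduct.tmul_zero]
    · simp
  · rw [koszulHomotopy_eq_zero hm, map_zero, zero_add]
    have hne : (s.toFinset ∪ T).Nonempty := by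
      by_contra hne
      rw [Finset.not_nonempty_iff_eq_empty, Finset.union_eq_empty,
          Multiset.toFinset_eq_empty] at hne
      simp [hne.1, hne.2] at h
    obtain ⟨m, hmem, hmin⟩ := (s.toFinset ∪ T).exists_min_image id hne
    have hs : ∀ l ∈ s, m ≤ l := fun l hl => hmin l (by simp [hl])
    have hT : ∀ l ∈ T, m ≤ l := fun l hl => hmin l (by simp [hl])
    have hmT : m ∈ T := by
      by_contra hmT
      have hms : m ∈ s := by simpa [hmT] using hmem
      exact hm ⟨m, hms, hs, fun l hl => lt_of_le_of_ne (hT l hl) fun e => hmT (e ▸ hl)⟩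
    rw [Finset.sum_eq_single m]
    · rw [annihilation_single, if_pos hmT, koszulSign_of_forall_lt k hT, mul_one,
        koszulHomotopy_of_min hs, creation_single, if_neg (Finset.notMem_erase m T),
        koszulSign_erase_self, koszulSign_of_forall_lt k hT, Finset.insert_erase hmT, mul_one]
      intro l hl
      exact lt_of_le_of_ne (hT l (Finset.mem_of_mem_erase hl)) (Finset.ne_of_mem_erase hl).symm
    · intro i _ hi
      rw [annihilation_single]
      split_ifs with hiT
      · rw [one_mul, ← mul_one (koszulSign k i T), ← smul_eq_mul, ← Finsupp.smul_single,
            TensorProduct.tmul_smul, map_smul, koszulHomotopy_eq_zero, smul_zero]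
        rintro ⟨m', hm's, -, hm'⟩
        have h1 : m' < m := hm' m (Finset.mem_erase.2 ⟨hi.symm, hmT⟩)
        rcases Multiset.mem_cons.1 hm's with rfl | hm's
        · exact h1.not_ge (hT _ hiT)
        · exact h1.not_ge (hs _ hm's)
      · simp
    · simp

end Koszul

section Acyclic

variable {k : Type*} [Field k] {g : Type*} [LieRing g] [LieAlgebra k g] {n : ℕ}
  (b : Module.Basis (Fin n) k g)

/-- Up to terms of lower total degree, the Chevalley–Eilenberg differential is the Koszul one. -/
theorem ceDiff_sub_koszulDiff_mem {p : ℕ} {x : MonomialSpace k n ⊗[k] Fock k n}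
    (hx : x ∈ totalLE k n (p + 1)) : (ceDiff b (pbwAct b) - koszulDiff k n) x ∈ totalLE k n p := by
  refine totalLE_le (P := (totalLE k n p).comap (ceDiff b (pbwAct b) - koszulDiff k n))
    (fun s T h => ?_) hx
  rw [Submodule.mem_comap, LinearMap.sub_apply, koszulDiff_tmul, ceDiff, LinearMap.sub_apply,
    LinearMap.sum_apply, sub_right_comm, ← Finset.sum_sub_distrib, LinearMap.lTensor_tmul]
  have hT := single_mem_extPow (k := k) (T := T) rfl 1
  rcases hc : T.card with _ | c
  · rw [hc] at hT
    rw [bracketFock_eq_zero b hT, TensorProduct.tmul_zero, sub_zero]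
    refine sum_mem fun i _ => ?_
    simp [annihilation_eq_zero i hT]
  · rw [hc] at hT
    refine sub_mem (sum_mem fun i _ => ?_) (tmul_mem_totalLE (by omega) (mono_mem_degLE le_rfl)
      (bracketFock_mem_extPow b hT))
    rw [TensorProduct.map_tmul, ← TensorProduct.sub_tmul]
    exact tmul_mem_totalLE (by omega) (pbwAct_sub_mem b i s) (annihilation_mem_extPow i hT)

/-- The Koszul homotopy contracts the Chevalley–Eilenberg complex of `U(g)` up to terms of lower
total degree. -/
theorem ceDiff_homotopy_mem {p : ℕ} {x : MonomialSpace k n ⊗[k] Fock k n}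
    (hx : x ∈ totalLE k n (p + 1)) :
    x - ceDiff b (pbwAct b) (koszulHomotopy x) - koszulHomotopy (ceDiff b (pbwAct b) x) ∈
      totalLE k n p := by
  refine totalLE_le (P := (totalLE k n p).comap (1 - ceDiff b (pbwAct b) * koszulHomotopy -
    koszulHomotopy * ceDiff b (pbwAct b))) (fun s T h => ?_) hx
  rw [Submodule.mem_comap]
  simp only [LinearMap.sub_apply, Module.End.one_apply, Module.End.mul_apply]
  rcases Nat.eq_zero_or_pos (s.card + T.card) with h0 | hpos
  · obtain ⟨rfl, rfl⟩ : s = 0 ∧ T = ∅ := by simpa using h0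
    rw [koszulHomotopy_eq_zero (by simp), map_zero, ceDiff_tmul_vac, map_zero, sub_zero, sub_zero]
    exact mono_tmul_mem_totalLE (by simp)
  · have hx := mono_tmul_mem_totalLE (k := k) h
    have h1 := ceDiff_sub_koszulDiff_mem b (koszulHomotopy_mem hx)
    have h2 := koszulHomotopy_mem (ceDiff_sub_koszulDiff_mem b hx)
    have h3 := neg_mem (add_mem h1 h2)
    convert h3 using 1
    nth_rw 1 [← koszulDiff_homotopy hpos]
    simp only [LinearMap.sub_apply, map_sub]
    abel

/-- A cycle of the Chevalley–Eilenberg complex of `U(g)` is a boundary up to a multiple of the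
vacuum. -/
theorem exists_ceDiff_eq (x : MonomialSpace k n ⊗[k] Fock k n) (hx : ceDiff b (pbwAct b) x = 0) :
    ∃ y, ∃ c : k, x = ceDiff b (pbwAct b) y + c • (mono k 0 ⊗ₜ Finsupp.single ∅ 1) := by
  obtain ⟨p, hp⟩ := exists_mem_totalLE x
  induction p generalizing x with
  | zero =>
    have h0 : totalLE k n 0 ≤ Submodule.span k {mono k 0 ⊗ₜ Finsupp.single ∅ 1} := by
      refine totalLE_le fun s T h => ?_
      obtain ⟨rfl, rfl⟩ : s = 0 ∧ T = ∅ := by simpa using h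
      exact Submodule.mem_span_singleton_self _
    obtain ⟨c, rfl⟩ := Submodule.mem_span_singleton.1 (h0 hp)
    exact ⟨0, c, by simp⟩
  | succ p ih =>
    have h := ceDiff_homotopy_mem b hp
    rw [hx, map_zero, sub_zero] at h
    obtain ⟨y, c, hy⟩ := ih _ (by
      rw [map_sub, hx, ← Module.End.mul_apply, ceDiff_mul_self b _ (pbwAct_lie b)]
      simp) h
    exact ⟨koszulHomotopy x + y, c, by rw [map_add, add_assoc, ← hy]; abel⟩

end Acyclic

/-! ### Comparison of free resolutions -/

section Subquotient

variable {k : Type*} [Field k] {C D : Type*} [AddCommGroup C] [Module k C] [AddCommGroup D]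
  [Module k D]

/-- Linear maps that preserve cycles and boundaries, and are mutually inverse on cycles up to
boundaries, identify the homologies. -/
theorem nonempty_subquotientEquiv {Z B : Submodule k C} {Z' B' : Submodule k D} (f : C →ₗ[k] D)
    (f' : D →ₗ[k] C) (hZ : ∀ x ∈ Z, f x ∈ Z') (hB : ∀ x ∈ B, f x ∈ B')
    (hZ' : ∀ x ∈ Z', f' x ∈ Z) (hB' : ∀ x ∈ B', f' x ∈ B)
    (h : ∀ x ∈ Z, f' (f x) - x ∈ B) (h' : ∀ x ∈ Z', f (f' x) - x ∈ B') :
    Nonempty ((Z ⧸ B.submoduleOf Z) ≃ₗ[k] (Z' ⧸ B'.submoduleOf Z')) := by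
  refine ⟨LinearEquiv.ofLinearMap
    (Submodule.mapQ (B.submoduleOf Z) (B'.submoduleOf Z') (f.restrict hZ) fun x hx => hB _ hx)
    (Submodule.mapQ (B'.submoduleOf Z') (B.submoduleOf Z) (f'.restrict hZ') fun x hx => hB' _ hx)
    ?_ ?_⟩
  · refine Submodule.linearMap_qext _ (LinearMap.ext fun x => ?_)
    exact (Submodule.Quotient.eq _).2 (h' _ x.2)
  · refine Submodule.linearMap_qext _ (LinearMap.ext fun x => ?_)
    exact (Submodule.Quotient.eq _).2 (h _ x.2)

end Subquotient

section Complexes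

variable {k : Type*} [Field k]

/-- The coboundaries of a cochain complex that starts in degree `0`. -/
def coboundaries {C : ℕ → Type*} [∀ q, AddCommGroup (C q)] [∀ q, Module k (C q)]
    (d : ∀ q, C q →ₗ[k] C (q + 1)) : (q : ℕ) → Submodule k (C q)
  | 0 => ⊥
  | q + 1 => LinearMap.range (d q)

/-- The cycles of a chain complex that ends in degree `0`. -/
def cycles {C : ℕ → Type*} [∀ q, AddCommGroup (C q)] [∀ q, Module k (C q)]
    (d : ∀ q, C (q + 1) →ₗ[k] C q) : (q : ℕ) → Submodule k (C q)
  | 0 => ⊤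
  | q + 1 => LinearMap.ker (d q)

/-- The cohomology in degree `q` of a cochain complex that starts in degree `0`. -/
abbrev Cohomology {C : ℕ → Type*} [∀ q, AddCommGroup (C q)] [∀ q, Module k (C q)]
    (d : ∀ q, C q →ₗ[k] C (q + 1)) (q : ℕ) :=
  LinearMap.ker (d q) ⧸ (coboundaries d q).submoduleOf (LinearMap.ker (d q))

/-- The homology in degree `q` of a chain complex that ends in degree `0`. -/
abbrev Homology {C : ℕ → Type*} [∀ q, AddCommGroup (C q)] [∀ q, Module k (C q)]
    (d : ∀ q, C (q + 1) →ₗ[k] C q) (q : ℕ) :=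
  cycles d q ⧸ (LinearMap.range (d q)).submoduleOf (cycles d q)

variable {C D : ℕ → Type*} [∀ q, AddCommGroup (C q)] [∀ q, Module k (C q)]
  [∀ q, AddCommGroup (D q)] [∀ q, Module k (D q)]

theorem map_mem_coboundaries {d : ∀ q, C q →ₗ[k] C (q + 1)} {d' : ∀ q, D q →ₗ[k] D (q + 1)}
    {f : ∀ q, C q →ₗ[k] D q} (hf : ∀ q x, f (q + 1) (d q x) = d' q (f q x)) (q : ℕ) (x : C q)
    (hx : x ∈ coboundaries d q) : f q x ∈ coboundaries d' q := by
  cases q with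
  | zero =>
    obtain rfl := (Submodule.mem_bot k).1 hx
    simp
  | succ q =>
    obtain ⟨y, rfl⟩ := hx
    exact ⟨f q y, (hf q y).symm⟩

theorem map_mem_cycles {d : ∀ q, C (q + 1) →ₗ[k] C q} {d' : ∀ q, D (q + 1) →ₗ[k] D q}
    {f : ∀ q, C q →ₗ[k] D q} (hf : ∀ q x, f q (d q x) = d' q (f (q + 1) x)) (q : ℕ) (x : C q)
    (hx : x ∈ cycles d q) : f q x ∈ cycles d' q := by
  cases q with
  | zero => exact Submodule.mem_top
  | succ q =>
    have hx : d q x = 0 := hx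
    change d' q _ = 0
    rw [← hf, hx, map_zero]

/-- A self-map homotopic to the identity moves cocycles by coboundaries. -/
theorem sub_mem_coboundaries {d : ∀ q, C q →ₗ[k] C (q + 1)} {e : ∀ q, C q →ₗ[k] C q}
    {s : ∀ q, C (q + 1) →ₗ[k] C q} (h0 : ∀ x, e 0 x - x = s 0 (d 0 x))
    (h : ∀ q x, e (q + 1) x - x = s (q + 1) (d (q + 1) x) + d q (s q x)) (q : ℕ) (x : C q)
    (hx : x ∈ LinearMap.ker (d q)) : e q x - x ∈ coboundaries d q := by
  rw [LinearMap.mem_ker] at hx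
  cases q with
  | zero => rw [h0, hx, map_zero]; exact zero_mem _
  | succ q => rw [h, hx, map_zero, zero_add]; exact ⟨_, rfl⟩

/-- A self-map homotopic to the identity moves cycles by boundaries. -/
theorem sub_mem_boundaries {d : ∀ q, C (q + 1) →ₗ[k] C q} {e : ∀ q, C q →ₗ[k] C q}
    {s : ∀ q, C q →ₗ[k] C (q + 1)} (h0 : ∀ x, e 0 x - x = d 0 (s 0 x))
    (h : ∀ q x, e (q + 1) x - x = d (q + 1) (s (q + 1) x) + s q (d q x)) (q : ℕ) (x : C q)
    (hx : x ∈ cycles d q) : e q x - x ∈ LinearMap.range (d q) := by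
  cases q with
  | zero => rw [h0]; exact ⟨_, rfl⟩
  | succ q =>
    have hx : d q x = 0 := hx
    rw [h, hx, map_zero, add_zero]
    exact ⟨_, rfl⟩

end Complexes

section Resolution

variable {R : Type*} [Ring R] {E : Type*} [AddCommGroup E] [Module R E]

/-- A resolution `⋯ → X 1 → X 0 → E → 0` of an `R`-module `E`. -/
structure Resolution (R : Type*) [Ring R] (E : Type*) [AddCommGroup E] [Module R E]
    (X : ℕ → Type*) [∀ q, AddCommGroup (X q)] [∀ q, Module R (X q)] where
  /-- The differential. -/
  d : ∀ q, X (q + 1) →ₗ[R] X q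
  /-- The augmentation. -/
  aug : X 0 →ₗ[R] E
  exact_d : ∀ q, Function.Exact (d (q + 1)) (d q)
  exact_aug : Function.Exact (d 0) aug
  aug_surjective : Function.Surjective aug

/-- Maps out of a projective module lift along `d` if their values lie in its range. -/
theorem exists_comp_eq {X Y Z : Type*} [AddCommGroup X] [Module R X] [AddCommGroup Y] [Module R Y]
    [AddCommGroup Z] [Module R Z] [Module.Projective R X] (f : X →ₗ[R] Y) (d : Z →ₗ[R] Y)
    (h : ∀ x, f x ∈ LinearMap.range d) : ∃ f' : X →ₗ[R] Z, d ∘ₗ f' = f := by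
  obtain ⟨f', hf'⟩ := Module.projective_lifting_property d.rangeRestrict
    (f.codRestrict _ h) d.surjective_rangeRestrict
  exact ⟨f', LinearMap.ext fun x => congrArg Subtype.val (LinearMap.congr_fun hf' x)⟩

variable {X Y : ℕ → Type*} [∀ q, AddCommGroup (X q)] [∀ q, Module R (X q)]
  [∀ q, AddCommGroup (Y q)] [∀ q, Module R (Y q)] [∀ q, Module.Projective R (X q)]

/-- The identity of `E` lifts to a chain map between resolutions if the first one is projective. -/
theorem Resolution.exists_lift (P : Resolution R E X) (Q : Resolution R E Y) :
    ∃ f : ∀ q, X q →ₗ[R] Y q, (∀ x, Q.aug (f 0 x) = P.aug x) ∧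
      ∀ q x, Q.d q (f (q + 1) x) = f q (P.d q x) := by
  obtain ⟨f0, hf0⟩ := exists_comp_eq P.aug Q.aug fun x => Q.aug_surjective _
  have h0 : ∀ x, Q.aug (f0 x) = P.aug x := LinearMap.congr_fun hf0
  obtain ⟨f1, hf1⟩ := exists_comp_eq (f0 ∘ₗ P.d 0) (Q.d 0) fun x => by
    refine (Q.exact_aug _).1 ?_
    rw [LinearMap.comp_apply, h0]
    exact P.exact_aug.apply_apply_eq_zero x
  have step : ∀ q, ∀ p : {p : (X q →ₗ[R] Y q) × (X (q + 1) →ₗ[R] Y (q + 1)) //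
      Q.d q ∘ₗ p.2 = p.1 ∘ₗ P.d q}, ∃ p' : {p : (X (q + 1) →ₗ[R] Y (q + 1)) ×
      (X (q + 2) →ₗ[R] Y (q + 2)) // Q.d (q + 1) ∘ₗ p.2 = p.1 ∘ₗ P.d (q + 1)},
      p'.1.1 = p.1.2 := by
    rintro q ⟨⟨f, f'⟩, hf⟩
    obtain ⟨f'', hf''⟩ := exists_comp_eq (f' ∘ₗ P.d (q + 1)) (Q.d (q + 1)) fun x => by
      refine (Q.exact_d q _).1 ?_
      rw [LinearMap.comp_apply, ← LinearMap.comp_apply, hf, LinearMap.comp_apply,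
        (P.exact_d q).apply_apply_eq_zero x, map_zero]
    exact ⟨⟨(f', f''), hf''⟩, rfl⟩
  choose next hnext using step
  let F : ∀ q, {p : (X q →ₗ[R] Y q) × (X (q + 1) →ₗ[R] Y (q + 1)) //
      Q.d q ∘ₗ p.2 = p.1 ∘ₗ P.d q} := fun q => Nat.rec ⟨(f0, f1), hf1⟩ next q
  refine ⟨fun q => (F q).1.1, h0, fun q x => ?_⟩
  have h1 : (F (q + 1)).1.1 = (F q).1.2 := hnext q (F q)
  exact (congrArg (fun f => Q.d q (f x)) h1).trans (LinearMap.congr_fun (F q).2 x)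

/-- A chain map between resolutions that lifts zero is null-homotopic if the first resolution is
projective. -/
theorem Resolution.exists_nullHomotopy (P : Resolution R E X) (Q : Resolution R E Y)
    (e : ∀ q, X q →ₗ[R] Y q) (h0 : ∀ x, Q.aug (e 0 x) = 0)
    (he : ∀ q x, Q.d q (e (q + 1) x) = e q (P.d q x)) :
    ∃ s : ∀ q, X q →ₗ[R] Y (q + 1), (∀ x, e 0 x = Q.d 0 (s 0 x)) ∧
      ∀ q x, e (q + 1) x = Q.d (q + 1) (s (q + 1) x) + s q (P.d q x) := by
  obtain ⟨s0, hs0⟩ := exists_comp_eq (e 0) (Q.d 0) fun x => (Q.exact_aug _).1 (h0 x)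
  obtain ⟨s1, hs1⟩ := exists_comp_eq (e 1 - s0 ∘ₗ P.d 0) (Q.d 1) fun x => by
    refine (Q.exact_d 0 _).1 ?_
    have h := LinearMap.congr_fun hs0 (P.d 0 x)
    rw [LinearMap.comp_apply] at h
    rw [LinearMap.sub_apply, map_sub, he, LinearMap.comp_apply, h, sub_self]
  have step : ∀ q, ∀ p : {p : (X q →ₗ[R] Y (q + 1)) × (X (q + 1) →ₗ[R] Y (q + 2)) //
      Q.d (q + 1) ∘ₗ p.2 = e (q + 1) - p.1 ∘ₗ P.d q},
      ∃ p' : {p : (X (q + 1) →ₗ[R] Y (q + 2)) × (X (q + 2) →ₗ[R] Y (q + 3)) //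
      Q.d (q + 2) ∘ₗ p.2 = e (q + 2) - p.1 ∘ₗ P.d (q + 1)}, p'.1.1 = p.1.2 := by
    rintro q ⟨⟨s, s'⟩, hs⟩
    obtain ⟨s'', hs''⟩ := exists_comp_eq (e (q + 2) - s' ∘ₗ P.d (q + 1)) (Q.d (q + 2))
      fun x => by
        refine (Q.exact_d (q + 1) _).1 ?_
        have h := LinearMap.congr_fun hs (P.d (q + 1) x)
        rw [LinearMap.comp_apply, LinearMap.sub_apply, LinearMap.comp_apply,
          (P.exact_d q).apply_apply_eq_zero x, map_zero, sub_zero] at h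
        rw [LinearMap.sub_apply, map_sub, he, LinearMap.comp_apply, h, sub_self]
    exact ⟨⟨(s', s''), hs''⟩, rfl⟩
  choose next hnext using step
  let F : ∀ q, {p : (X q →ₗ[R] Y (q + 1)) × (X (q + 1) →ₗ[R] Y (q + 2)) //
      Q.d (q + 1) ∘ₗ p.2 = e (q + 1) - p.1 ∘ₗ P.d q} := fun q => Nat.rec ⟨(s0, s1), hs1⟩ next q
  refine ⟨fun q => (F q).1.1, fun x => (LinearMap.congr_fun hs0 x).symm, fun q x => ?_⟩
  have h1 : (F (q + 1)).1.1 = (F q).1.2 := hnext q (F q)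
  have h2 := LinearMap.congr_fun (F q).2 x
  rw [← h1, LinearMap.sub_apply, LinearMap.comp_apply, LinearMap.comp_apply,
    eq_sub_iff_add_eq] at h2
  exact h2.symm

end Resolution

section FreeModules

variable {k : Type*} [Field k] {R : Type*} [Ring R] [Algebra k R]
  {M : Type*} [AddCommGroup M] [Module k M] (l : R →ₐ[k] Module.End k M)
  {N : Type*} [AddCommGroup N] [Module k N] (r : R →ₐ[k] (Module.End k N)ᵐᵒᵖ)
  {U V W : Type*} [AddCommGroup U] [Module k U] [AddCommGroup V] [Module k V]
  [AddCommGroup W] [Module k W]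

/-- The extension of `f : V → M` to an `R`-linear map on `R ⊗ V`, for a left `R`-module `M`. -/
noncomputable def homExt (f : V →ₗ[k] M) : R ⊗[k] V →ₗ[k] M :=
  TensorProduct.lift (LinearMap.lcomp k M f ∘ₗ l.toLinearMap)

theorem homExt_tmul (f : V →ₗ[k] M) (a : R) (v : V) : homExt l f (a ⊗ₜ v) = l a (f v) := rfl

theorem homExt_smul (f : V →ₗ[k] M) (a : R) (y : R ⊗[k] V) :
    homExt l f (a • y) = l a (homExt l f y) := by
  induction y with
  | zero => simp
  | add x y hx hy => rw [smul_add, map_add, hx, hy, map_add, map_add]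
  | tmul c v => simp [TensorProduct.smul_tmul', homExt_tmul]

/-- The map `Hom_R(R ⊗ W, M) → Hom_R(R ⊗ V, M)` induced by an `R`-linear map `φ`, read as a map
`Hom(W, M) → Hom(V, M)`. -/
noncomputable def homMap (φ : R ⊗[k] V →ₗ[R] R ⊗[k] W) : (W →ₗ[k] M) →ₗ[k] (V →ₗ[k] M) where
  toFun f := homExt l f ∘ₗ φ.restrictScalars k ∘ₗ TensorProduct.mk k R V 1
  map_add' f f' := by
    have : homExt l (f + f') = homExt l f + homExt l f' :=
      TensorProduct.ext' fun a v => by simp [homExt_tmul]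
    ext; simp [this]
  map_smul' c f := by
    have : homExt l (c • f) = c • homExt l f :=
      TensorProduct.ext' fun a v => by simp [homExt_tmul]
    ext; simp [this]

theorem homMap_apply (φ : R ⊗[k] V →ₗ[R] R ⊗[k] W) (f : W →ₗ[k] M) (v : V) :
    homMap l φ f v = homExt l f (φ (1 ⊗ₜ v)) := rfl

theorem homExt_homMap (φ : R ⊗[k] V →ₗ[R] R ⊗[k] W) (f : W →ₗ[k] M) (y : R ⊗[k] V) :
    homExt l (homMap l φ f) y = homExt l f (φ y) := by
  induction y with
  | zero => simp
  | add x y hx hy => rw [map_add, hx, hy, map_add, map_add]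
  | tmul a v =>
    rw [homExt_tmul, homMap_apply, ← homExt_smul, ← map_smul, TensorProduct.smul_tmul',
      smul_eq_mul, mul_one]

theorem homMap_comp (φ : R ⊗[k] V →ₗ[R] R ⊗[k] W) (ψ : R ⊗[k] U →ₗ[R] R ⊗[k] V) (f : W →ₗ[k] M) :
    homMap l (φ ∘ₗ ψ) f = homMap l ψ (homMap l φ f) :=
  LinearMap.ext fun v => by rw [homMap_apply, homMap_apply, homExt_homMap, LinearMap.comp_apply]

theorem homMap_add (φ ψ : R ⊗[k] V →ₗ[R] R ⊗[k] W) (f : W →ₗ[k] M) :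
    homMap l (φ + ψ) f = homMap l φ f + homMap l ψ f :=
  LinearMap.ext fun v => by simp [homMap_apply]

theorem homMap_sub (φ ψ : R ⊗[k] V →ₗ[R] R ⊗[k] W) (f : W →ₗ[k] M) :
    homMap l (φ - ψ) f = homMap l φ f - homMap l ψ f :=
  LinearMap.ext fun v => by simp [homMap_apply]

theorem homMap_id (f : V →ₗ[k] M) : homMap l (LinearMap.id : R ⊗[k] V →ₗ[R] R ⊗[k] V) f = f :=
  LinearMap.ext fun v => by simp [homMap_apply, homExt_tmul]

/-- The map `N ⊗ R ⊗ W → N ⊗ W`, `n ⊗ a ⊗ w ↦ n a ⊗ w`, for a right `R`-module `N`, in curried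
form. -/
noncomputable def tensorExt : R ⊗[k] W →ₗ[k] N →ₗ[k] N ⊗[k] W :=
  TensorProduct.lift (LinearMap.mk₂ k
    (fun a w => (TensorProduct.mk k N W).flip w ∘ₗ (r a).unop)
    (fun a a' w => by ext; simp)
    (fun c a w => by ext; simp [TensorProduct.smul_tmul'])
    (fun a w w' => by ext; simp)
    (fun c a w => by ext; simp))

theorem tensorExt_tmul (a : R) (w : W) (m : N) :
    tensorExt r (a ⊗ₜ w) m = (r a).unop m ⊗ₜ w := by
  simp [tensorExt]

theorem tensorExt_smul (a : R) (y : R ⊗[k] W) (m : N) :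
    tensorExt r (a • y) m = tensorExt r y ((r a).unop m) := by
  induction y with
  | zero => simp
  | add x y hx hy => rw [smul_add, map_add, LinearMap.add_apply, hx, hy, map_add,
      LinearMap.add_apply]
  | tmul c v => simp [TensorProduct.smul_tmul', tensorExt_tmul]

/-- The map `N ⊗_R (R ⊗ V) → N ⊗_R (R ⊗ W)` induced by an `R`-linear map `φ`, read as a map
`N ⊗ V → N ⊗ W`. -/
noncomputable def tensorMap (φ : R ⊗[k] V →ₗ[R] R ⊗[k] W) : N ⊗[k] V →ₗ[k] N ⊗[k] W :=
  TensorProduct.lift (tensorExt r ∘ₗ φ.restrictScalars k ∘ₗ TensorProduct.mk k R V 1).flip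

theorem tensorMap_tmul (φ : R ⊗[k] V →ₗ[R] R ⊗[k] W) (m : N) (v : V) :
    tensorMap r φ (m ⊗ₜ v) = tensorExt r (φ (1 ⊗ₜ v)) m := rfl

theorem tensorMap_tensorExt (φ : R ⊗[k] V →ₗ[R] R ⊗[k] W) (y : R ⊗[k] V) (m : N) :
    tensorMap r φ (tensorExt r y m) = tensorExt r (φ y) m := by
  induction y with
  | zero => simp
  | add x y hx hy => simp [hx, hy]
  | tmul a v =>
    rw [tensorExt_tmul, tensorMap_tmul, ← tensorExt_smul, ← map_smul, TensorProduct.smul_tmul',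
      smul_eq_mul, mul_one]

theorem tensorMap_comp (φ : R ⊗[k] V →ₗ[R] R ⊗[k] W) (ψ : R ⊗[k] U →ₗ[R] R ⊗[k] V)
    (x : N ⊗[k] U) : tensorMap r (φ ∘ₗ ψ) x = tensorMap r φ (tensorMap r ψ x) := by
  refine LinearMap.congr_fun (TensorProduct.ext' (g := tensorMap r (φ ∘ₗ ψ))
    (h := tensorMap r φ ∘ₗ tensorMap r ψ) fun m u => ?_) x
  rw [LinearMap.comp_apply, tensorMap_tmul, tensorMap_tmul, tensorMap_tensorExt,
    LinearMap.comp_apply]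

theorem tensorMap_add (φ ψ : R ⊗[k] V →ₗ[R] R ⊗[k] W) (x : N ⊗[k] V) :
    tensorMap r (φ + ψ) x = tensorMap r φ x + tensorMap r ψ x :=
  LinearMap.congr_fun (TensorProduct.ext' (g := tensorMap r (φ + ψ))
    (h := tensorMap r φ + tensorMap r ψ) fun m u => by simp [tensorMap_tmul]) x

theorem tensorMap_sub (φ ψ : R ⊗[k] V →ₗ[R] R ⊗[k] W) (x : N ⊗[k] V) :
    tensorMap r (φ - ψ) x = tensorMap r φ x - tensorMap r ψ x :=
  LinearMap.congr_fun (TensorProduct.ext' (g := tensorMap r (φ - ψ))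
    (h := tensorMap r φ - tensorMap r ψ) fun m u => by simp [tensorMap_tmul]) x

theorem tensorMap_id (x : N ⊗[k] V) :
    tensorMap r (LinearMap.id : R ⊗[k] V →ₗ[R] R ⊗[k] V) x = x :=
  LinearMap.congr_fun (TensorProduct.ext' (g := tensorMap r LinearMap.id)
    (h := LinearMap.id) fun m u => by simp [tensorMap_tmul, tensorExt_tmul]) x

end FreeModules

section Comparison

variable {k : Type*} [Field k] {R : Type*} [Ring R] [Algebra k R] {E : Type*} [AddCommGroup E]
  [Module R E] {V W : ℕ → Type*} [∀ q, AddCommGroup (V q)] [∀ q, Module k (V q)]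
  [∀ q, AddCommGroup (W q)] [∀ q, Module k (W q)]

/-- Two free resolutions are homotopy equivalent; this is one half of the data. -/
theorem Resolution.exists_homotopyInverse (P : Resolution R E fun q => R ⊗[k] V q)
    (Q : Resolution R E fun q => R ⊗[k] W q) :
    ∃ (f : ∀ q, R ⊗[k] V q →ₗ[R] R ⊗[k] W q) (f' : ∀ q, R ⊗[k] W q →ₗ[R] R ⊗[k] V q)
      (s : ∀ q, R ⊗[k] V q →ₗ[R] R ⊗[k] V (q + 1)) (s' : ∀ q, R ⊗[k] W q →ₗ[R] R ⊗[k] W (q + 1)),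
      (∀ q, Q.d q ∘ₗ f (q + 1) = f q ∘ₗ P.d q) ∧ (∀ q, P.d q ∘ₗ f' (q + 1) = f' q ∘ₗ Q.d q) ∧
      (f' 0 ∘ₗ f 0 - LinearMap.id = P.d 0 ∘ₗ s 0) ∧
      (∀ q, f' (q + 1) ∘ₗ f (q + 1) - LinearMap.id =
        P.d (q + 1) ∘ₗ s (q + 1) + s q ∘ₗ P.d q) ∧
      (f 0 ∘ₗ f' 0 - LinearMap.id = Q.d 0 ∘ₗ s' 0) ∧
      (∀ q, f (q + 1) ∘ₗ f' (q + 1) - LinearMap.id =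
        Q.d (q + 1) ∘ₗ s' (q + 1) + s' q ∘ₗ Q.d q) := by
  obtain ⟨f, hf0, hf⟩ := P.exists_lift Q
  obtain ⟨f', hf'0, hf'⟩ := Q.exists_lift P
  obtain ⟨s, hs0, hs⟩ := P.exists_nullHomotopy P
    (fun q => f' q ∘ₗ f q - LinearMap.id) (by simp [hf0, hf'0]) (by simp [hf, hf'])
  obtain ⟨s', hs'0, hs'⟩ := Q.exists_nullHomotopy Q
    (fun q => f q ∘ₗ f' q - LinearMap.id) (by simp [hf0, hf'0]) (by simp [hf, hf'])
  exact ⟨f, f', s, s', fun q => LinearMap.ext (hf q), fun q => LinearMap.ext (hf' q),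
    LinearMap.ext hs0, fun q => LinearMap.ext (hs q), LinearMap.ext hs'0,
    fun q => LinearMap.ext (hs' q)⟩

/-- `Ext` does not depend on the free resolution. -/
theorem Resolution.nonempty_cohomologyEquiv (P : Resolution R E fun q => R ⊗[k] V q)
    (Q : Resolution R E fun q => R ⊗[k] W q) {M : Type*} [AddCommGroup M] [Module k M]
    (l : R →ₐ[k] Module.End k M) (q : ℕ) :
    Nonempty (Cohomology (C := fun q => V q →ₗ[k] M) (fun q => homMap l (P.d q)) q ≃ₗ[k]
      Cohomology (C := fun q => W q →ₗ[k] M) (fun q => homMap l (Q.d q)) q) := by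
  obtain ⟨f, f', s, s', hf, hf', hs0, hs, hs'0, hs'⟩ := P.exists_homotopyInverse Q
  have key : ∀ q (x : V q →ₗ[k] M), homMap l (f' (q + 1)) (homMap l (P.d q) x) =
      homMap l (Q.d q) (homMap l (f' q) x) := fun q x => by
    rw [← homMap_comp, ← homMap_comp, hf']
  have key' : ∀ q (x : W q →ₗ[k] M), homMap l (f (q + 1)) (homMap l (Q.d q) x) =
      homMap l (P.d q) (homMap l (f q) x) := fun q x => by
    rw [← homMap_comp, ← homMap_comp, hf]
  have h1 := sub_mem_coboundaries (C := fun q => V q →ₗ[k] M) (d := fun q => homMap l (P.d q))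
    (e := fun q => homMap l (f q) ∘ₗ homMap l (f' q)) (s := fun q => homMap l (s q))
    (fun x => by
      rw [LinearMap.comp_apply, ← homMap_comp, ← homMap_comp, ← hs0, homMap_sub, homMap_id])
    (fun q x => by
      rw [LinearMap.comp_apply, ← homMap_comp, ← homMap_comp, ← homMap_comp, ← homMap_add, ← hs,
        homMap_sub, homMap_id]) q
  have h2 := sub_mem_coboundaries (C := fun q => W q →ₗ[k] M) (d := fun q => homMap l (Q.d q))
    (e := fun q => homMap l (f' q) ∘ₗ homMap l (f q)) (s := fun q => homMap l (s' q))
    (fun x => by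
      rw [LinearMap.comp_apply, ← homMap_comp, ← homMap_comp, ← hs'0, homMap_sub, homMap_id])
    (fun q x => by
      rw [LinearMap.comp_apply, ← homMap_comp, ← homMap_comp, ← homMap_comp, ← homMap_add, ← hs',
        homMap_sub, homMap_id]) q
  have h3 := map_mem_coboundaries (C := fun q => V q →ₗ[k] M) (D := fun q => W q →ₗ[k] M)
    (d := fun q => homMap l (P.d q)) (d' := fun q => homMap l (Q.d q))
    (f := fun q => homMap l (f' q)) key q
  have h4 := map_mem_coboundaries (C := fun q => W q →ₗ[k] M) (D := fun q => V q →ₗ[k] M)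
    (d := fun q => homMap l (Q.d q)) (d' := fun q => homMap l (P.d q))
    (f := fun q => homMap l (f q)) key' q
  refine nonempty_subquotientEquiv (homMap l (f' q)) (homMap l (f q)) (fun x hx => ?_) h3
    (fun x hx => ?_) h4 h1 h2
  · rw [LinearMap.mem_ker] at hx ⊢
    rw [← key, hx, map_zero]
  · rw [LinearMap.mem_ker] at hx ⊢
    rw [← key', hx, map_zero]

/-- `Tor` does not depend on the free resolution. -/
theorem Resolution.nonempty_homologyEquiv (P : Resolution R E fun q => R ⊗[k] V q)
    (Q : Resolution R E fun q => R ⊗[k] W q) {N : Type*} [AddCommGroup N] [Module k N]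
    (r : R →ₐ[k] (Module.End k N)ᵐᵒᵖ) (q : ℕ) :
    Nonempty (Homology (C := fun q => N ⊗[k] V q) (fun q => tensorMap r (P.d q)) q ≃ₗ[k]
      Homology (C := fun q => N ⊗[k] W q) (fun q => tensorMap r (Q.d q)) q) := by
  obtain ⟨f, f', s, s', hf, hf', hs0, hs, hs'0, hs'⟩ := P.exists_homotopyInverse Q
  have key : ∀ q (x : N ⊗[k] V (q + 1)), tensorMap r (f q) (tensorMap r (P.d q) x) =
      tensorMap r (Q.d q) (tensorMap r (f (q + 1)) x) := fun q x => by
    rw [← tensorMap_comp, ← tensorMap_comp, hf]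
  have key' : ∀ q (x : N ⊗[k] W (q + 1)), tensorMap r (f' q) (tensorMap r (Q.d q) x) =
      tensorMap r (P.d q) (tensorMap r (f' (q + 1)) x) := fun q x => by
    rw [← tensorMap_comp, ← tensorMap_comp, hf']
  have h1 := sub_mem_boundaries (C := fun q => N ⊗[k] V q) (d := fun q => tensorMap r (P.d q))
    (e := fun q => tensorMap r (f' q) ∘ₗ tensorMap r (f q)) (s := fun q => tensorMap r (s q))
    (fun x => by
      rw [LinearMap.comp_apply, ← tensorMap_comp, ← tensorMap_comp, ← hs0, tensorMap_sub,
        tensorMap_id])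
    (fun q x => by
      rw [LinearMap.comp_apply, ← tensorMap_comp, ← tensorMap_comp, ← tensorMap_comp,
        ← tensorMap_add, ← hs, tensorMap_sub, tensorMap_id]) q
  have h2 := sub_mem_boundaries (C := fun q => N ⊗[k] W q) (d := fun q => tensorMap r (Q.d q))
    (e := fun q => tensorMap r (f q) ∘ₗ tensorMap r (f' q)) (s := fun q => tensorMap r (s' q))
    (fun x => by
      rw [LinearMap.comp_apply, ← tensorMap_comp, ← tensorMap_comp, ← hs'0, tensorMap_sub,
        tensorMap_id])
    (fun q x => by
      rw [LinearMap.comp_apply, ← tensorMap_comp, ← tensorMap_comp, ← tensorMap_comp,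
        ← tensorMap_add, ← hs', tensorMap_sub, tensorMap_id]) q
  have h3 := map_mem_cycles (C := fun q => N ⊗[k] V q) (D := fun q => N ⊗[k] W q)
    (d := fun q => tensorMap r (P.d q)) (d' := fun q => tensorMap r (Q.d q))
    (f := fun q => tensorMap r (f q)) key q
  have h4 := map_mem_cycles (C := fun q => N ⊗[k] W q) (D := fun q => N ⊗[k] V q)
    (d := fun q => tensorMap r (Q.d q)) (d' := fun q => tensorMap r (P.d q))
    (f := fun q => tensorMap r (f' q)) key' q
  refine nonempty_subquotientEquiv (tensorMap r (f q)) (tensorMap r (f' q)) h3 ?_ h4 ?_ h1 h2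
  · rintro _ ⟨y, rfl⟩
    exact ⟨_, (key q y).symm⟩
  · rintro _ ⟨y, rfl⟩
    exact ⟨_, (key' q y).symm⟩

end Comparison

/-! ### The bar resolution -/

section Enveloping

variable (k : Type*) [Field k] (A : Type*) [Ring A] [Algebra k A]

/-- The enveloping algebra `A ⊗ Aᵐᵒᵖ`; its left modules are the `k`-central `A`-bimodules. -/
abbrev EnvAlg := A ⊗[k] Aᵐᵒᵖ

noncomputable instance : Ring (EnvAlg k A) := Algebra.TensorProduct.instRing

noncomputable instance (V : Type*) [AddCommGroup V] [Module k V] :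
    AddCommGroup (EnvAlg k A ⊗[k] V) := TensorProduct.addCommGroup

/-- The element `1 ⊗ a - a ⊗ 1` of the enveloping algebra: right multiplication by `a` minus left
multiplication by `a`. -/
noncomputable def innerElt : A →ₗ[k] EnvAlg k A :=
  (TensorProduct.mk k A Aᵐᵒᵖ 1) ∘ₗ (MulOpposite.opLinearEquiv k : A ≃ₗ[k] Aᵐᵒᵖ).toLinearMap -
    (TensorProduct.mk k A Aᵐᵒᵖ).flip 1

theorem innerElt_apply (a : A) :
    innerElt k A a = 1 ⊗ₜ MulOpposite.op a - a ⊗ₜ[k] (1 : Aᵐᵒᵖ) := rfl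

/-- The left ideal of the enveloping algebra generated by the `1 ⊗ a - a ⊗ 1`; the quotient by
it is the bimodule `A`. -/
noncomputable def diagIdeal : Submodule (EnvAlg k A) (EnvAlg k A) :=
  Submodule.span (EnvAlg k A) (Set.range (innerElt k A))

noncomputable instance (q : ℕ) : AddCommGroup (⨂[k]^q A) := inferInstance

noncomputable instance (q : ℕ) : AddCommGroup (EnvAlg k A ⊗[k] ⨂[k]^q A) :=
  TensorProduct.addCommGroup

variable {k A}

/-- A derivation rule. It shows that the `a` with `1 ⊗ a - a ⊗ 1` in a given left ideal form a
subalgebra. -/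
theorem innerElt_mul (a b : A) : innerElt k A (a * b) =
    (1 ⊗ₜ MulOpposite.op b : EnvAlg k A) * innerElt k A a + (a ⊗ₜ 1) * innerElt k A b := by
  simp [innerElt_apply, mul_sub]

section Actions

variable (M : Type*) [AddCommGroup M] [Module k M] [Module A M] [Module Aᵐᵒᵖ M]
  [IsScalarTower k A M] [IsScalarTower k Aᵐᵒᵖ M] [SMulCommClass A Aᵐᵒᵖ M]

variable (k A)

/-- A bimodule as a left module over the enveloping algebra: `(a ⊗ b) m = a m b`. -/
noncomputable def leftAct : EnvAlg k A →ₐ[k] Module.End k M :=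
  Algebra.TensorProduct.lift (Algebra.lsmul k k M) (Algebra.lsmul k k M) fun a b =>
    LinearMap.ext fun m => smul_comm a b m

theorem leftAct_tmul (a : A) (b : Aᵐᵒᵖ) (m : M) : leftAct k A M (a ⊗ₜ b) m = a • b • m := rfl

/-- A bimodule as a right module over the enveloping algebra: `m (a ⊗ b) = b m a`. -/
noncomputable def rightAct : EnvAlg k A →ₐ[k] (Module.End k M)ᵐᵒᵖ :=
  Algebra.TensorProduct.lift (AlgHom.opComm.symm (Algebra.lsmul k k M))
    (AlgHom.op (Algebra.lsmul k k M)) fun a b =>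
    MulOpposite.unop_injective (LinearMap.ext fun m => (smul_comm b.unop (MulOpposite.op a) m))

theorem rightAct_tmul (a : A) (b : Aᵐᵒᵖ) (m : M) :
    (rightAct k A M (a ⊗ₜ b)).unop m = b.unop • MulOpposite.op a • m := rfl

end Actions

end Enveloping

section FreeLift

variable {k : Type*} [Field k] {R : Type*} [Ring R] [Algebra k R] {V X : Type*} [AddCommGroup V]
  [Module k V] [AddCommGroup X] [Module k X] [Module R X] [IsScalarTower k R X]

/-- The `R`-linear extension of `f : V → X` to `R ⊗ V`. -/
noncomputable def freeLift (f : V →ₗ[k] X) : R ⊗[k] V →ₗ[R] X :=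
  TensorProduct.AlgebraTensorModule.lift (LinearMap.toSpanSingleton R (V →ₗ[k] X) f)

theorem freeLift_tmul (f : V →ₗ[k] X) (a : R) (v : V) : freeLift f (a ⊗ₜ v) = a • f v := rfl

end FreeLift

section Bar

variable (k : Type*) [Field k] (A : Type*) [Ring A] [Algebra k A]

/-- The multilinear map `(a₁, …, a_q) ↦ 1 ⊗ (a₁ ⊗ ⋯ ⊗ a_q)`. -/
noncomputable def barPure (q : ℕ) :
    MultilinearMap k (fun _ : Fin q => A) (EnvAlg k A ⊗[k] ⨂[k]^q A) :=
  (TensorProduct.mk k (EnvAlg k A) (⨂[k]^q A) 1).compMultilinearMap (PiTensorProduct.tprod k)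

/-- The differential of the bar resolution `A ⊗ A^{⊗ q} ⊗ A`, whose outer factors are collected in
the enveloping algebra. -/
noncomputable def barDiff (q : ℕ) :
    EnvAlg k A ⊗[k] ⨂[k]^(q + 1) A →ₗ[EnvAlg k A] EnvAlg k A ⊗[k] ⨂[k]^q A :=
  freeLift (R := EnvAlg k A) (X := EnvAlg k A ⊗[k] ⨂[k]^q A) <| PiTensorProduct.lift <|
    headMul ((Algebra.lsmul k k (EnvAlg k A ⊗[k] ⨂[k]^q A)).toLinearMap ∘ₗ
      (Algebra.TensorProduct.includeLeft : A →ₐ[k] EnvAlg k A).toLinearMap) (barPure k A q)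
    + ∑ j : Fin q, (-1 : k) ^ ((j : ℕ) + 1) • mulContract j (barPure k A q)
    + (-1 : k) ^ (q + 1) •
      lastMul ((Algebra.lsmul k k (EnvAlg k A ⊗[k] ⨂[k]^q A)).toLinearMap ∘ₗ
      (Algebra.TensorProduct.includeRight : Aᵐᵒᵖ →ₐ[k] EnvAlg k A).toLinearMap ∘ₗ
      (MulOpposite.opLinearEquiv k : A ≃ₗ[k] Aᵐᵒᵖ).toLinearMap) (barPure k A q)

theorem barDiff_tmul_tprod (q : ℕ) (x : EnvAlg k A) (a : Fin (q + 1) → A) :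
    barDiff k A q (x ⊗ₜ PiTensorProduct.tprod k a) =
      (x * (a 0 ⊗ₜ 1)) ⊗ₜ PiTensorProduct.tprod k (Fin.tail a)
      + ∑ j : Fin q, (-1 : k) ^ ((j : ℕ) + 1) •
          (x ⊗ₜ[k] PiTensorProduct.tprod k (Fin.contractNth j.castSucc (· * ·) a))
      + (-1 : k) ^ (q + 1) •
          ((x * (1 ⊗ₜ MulOpposite.op (a (Fin.last q)))) ⊗ₜ[k]
            PiTensorProduct.tprod k (Fin.init a)) := by
  simp [barDiff, freeLift_tmul, headMul, lastMul, mulContract, barPure, Finset.smul_sum,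
    TensorProduct.smul_tmul']
  rw [← TensorProduct.smul_tmul', mul_smul_comm]

/-- The linear map `a ⊗ (a₁ ⊗ ⋯ ⊗ a_q) ↦ a ⊗ a₁ ⊗ ⋯ ⊗ a_q`, in curried form. -/
noncomputable def consTensor (q : ℕ) : A →ₗ[k] (⨂[k]^q A) →ₗ[k] (⨂[k]^(q + 1) A) :=
  (PiTensorProduct.lift : MultilinearMap k (fun _ : Fin q => A) (⨂[k]^(q + 1) A)
    ≃ₗ[k] _).toLinearMap ∘ₗ
    (PiTensorProduct.tprod k : MultilinearMap k (fun _ : Fin (q + 1) => A) _).curryLeft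

theorem consTensor_tprod (q : ℕ) (a : A) (v : Fin q → A) :
    consTensor k A q a (PiTensorProduct.tprod k v) =
      PiTensorProduct.tprod k (Fin.cons a v : Fin (q + 1) → A) := by
  simp [consTensor]

/-- The contracting homotopy `(a ⊗ b) ⊗ t ↦ (1 ⊗ b) ⊗ (a ⊗ t)` of the bar resolution. -/
noncomputable def barHomotopy (q : ℕ) :
    EnvAlg k A ⊗[k] ⨂[k]^q A →ₗ[k] EnvAlg k A ⊗[k] ⨂[k]^(q + 1) A :=
  TensorProduct.lift <| TensorProduct.lift <| LinearMap.mk₂ k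
    (fun a b => TensorProduct.mk k (EnvAlg k A) (⨂[k]^(q + 1) A) (1 ⊗ₜ b) ∘ₗ consTensor k A q a)
    (fun a a' b => by ext; simp [TensorProduct.tmul_add])
    (fun c a b => by ext; simp)
    (fun a b b' => by ext; simp [TensorProduct.tmul_add])
    (fun c a b => by ext; simp)

theorem barHomotopy_tmul_tprod (q : ℕ) (a : A) (b : Aᵐᵒᵖ) (v : Fin q → A) :
    barHomotopy k A q ((a ⊗ₜ b) ⊗ₜ PiTensorProduct.tprod k v) =
      (1 ⊗ₜ b) ⊗ₜ PiTensorProduct.tprod k (Fin.cons a v : Fin (q + 1) → A) := by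
  rw [← consTensor_tprod]
  rfl

theorem contractNth_zero_cons {q : ℕ} (a : A) (v : Fin (q + 1) → A) :
    Fin.contractNth (Fin.castSucc 0) (· * ·) (Fin.cons a v : Fin (q + 2) → A) =
      Fin.cons (a * v 0) (Fin.tail v) := by
  funext l
  refine Fin.cases ?_ (fun l => ?_) l
  · simp [Fin.contractNth]
  · simp [Fin.contractNth, Fin.tail]

theorem contractNth_succ_cons {q : ℕ} (j : Fin q) (a : A) (v : Fin (q + 1) → A) :
    Fin.contractNth j.succ.castSucc (· * ·) (Fin.cons a v : Fin (q + 2) → A) =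
      Fin.cons a (Fin.contractNth j.castSucc (· * ·) v) := by
  funext l
  refine Fin.cases ?_ (fun l => ?_) l
  · simp [Fin.contractNth]
  · simp [Fin.contractNth, Fin.castSucc_succ]

theorem bar_ext {X : Type*} [AddCommMonoid X] [Module k X] {q : ℕ}
    {f f' : EnvAlg k A ⊗[k] ⨂[k]^q A →ₗ[k] X}
    (h : ∀ a b v, f ((a ⊗ₜ b) ⊗ₜ PiTensorProduct.tprod k v) =
      f' ((a ⊗ₜ b) ⊗ₜ PiTensorProduct.tprod k v)) : f = f' := by
  refine TensorProduct.ext (TensorProduct.ext' fun a b => PiTensorProduct.ext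
    (MultilinearMap.ext fun v => h a b v))

theorem barDiff_barHomotopy (q : ℕ) (x : EnvAlg k A ⊗[k] ⨂[k]^(q + 1) A) :
    barDiff k A (q + 1) (barHomotopy k A (q + 1) x) + barHomotopy k A q (barDiff k A q x) = x := by
  refine LinearMap.congr_fun (bar_ext k A (f := (barDiff k A (q + 1)).restrictScalars k ∘ₗ
    barHomotopy k A (q + 1) + barHomotopy k A q ∘ₗ (barDiff k A q).restrictScalars k)
    (f' := LinearMap.id) fun a b v => ?_) x
  simp only [LinearMap.add_apply, LinearMap.comp_apply, LinearMap.coe_restrictScalars,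
    LinearMap.id_apply, barHomotopy_tmul_tprod, barDiff_tmul_tprod, map_add, map_sum, map_smul,
    Algebra.TensorProduct.tmul_mul_tmul, one_mul, mul_one, Fin.cons_zero, Fin.tail_cons]
  rw [Fin.sum_univ_succ, contractNth_zero_cons]
  simp only [contractNth_succ_cons]
  have h1 : Fin.init (Fin.cons a v : Fin (q + 2) → A) = Fin.cons a (Fin.init v) := by
    funext l
    refine Fin.cases ?_ (fun l => ?_) l
    · simp [Fin.init]
    · simp [Fin.init, Fin.castSucc_succ]
  have h2 : (Fin.cons a v : Fin (q + 2) → A) (Fin.last (q + 1)) = v (Fin.last q) := by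
    rw [← Fin.succ_last, Fin.cons_succ]
  rw [h1, h2]
  simp only [Fin.val_succ, Fin.val_zero, pow_succ, neg_smul, mul_neg, mul_one, neg_neg, one_smul,
    zero_add, pow_zero, Finset.sum_neg_distrib]
  abel

theorem barHomotopy_one_tmul (q : ℕ) (v : Fin (q + 1) → A) :
    barHomotopy k A q ((v 0 ⊗ₜ 1) ⊗ₜ PiTensorProduct.tprod k (Fin.tail v)) =
      (1 : EnvAlg k A) ⊗ₜ PiTensorProduct.tprod k v := by
  rw [barHomotopy_tmul_tprod, Fin.cons_self_tail]
  rfl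

/-- The square of the bar differential vanishes: by the homotopy formula it vanishes on the image
of the homotopy, which generates the complex. -/
theorem barDiff_barDiff (q : ℕ) (x : EnvAlg k A ⊗[k] ⨂[k]^(q + 2) A) :
    barDiff k A q (barDiff k A (q + 1) x) = 0 := by
  have ext_one : ∀ q, (∀ v : Fin (q + 2) → A, barDiff k A q (barDiff k A (q + 1)
      ((1 : EnvAlg k A) ⊗ₜ PiTensorProduct.tprod k v)) = 0) →
      ∀ x, barDiff k A q (barDiff k A (q + 1) x) = 0 := by
    intro q h x
    refine LinearMap.congr_fun (bar_ext k A (f := (barDiff k A q).restrictScalars k ∘ₗ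
      (barDiff k A (q + 1)).restrictScalars k) (f' := 0) fun a b v => ?_) x
    have h1 : (a ⊗ₜ[k] b) ⊗ₜ[k] PiTensorProduct.tprod k v =
        (a ⊗ₜ[k] b : EnvAlg k A) • ((1 : EnvAlg k A) ⊗ₜ[k] PiTensorProduct.tprod k v) := by
      rw [TensorProduct.smul_tmul', smul_eq_mul, mul_one]
    rw [h1]
    simp only [LinearMap.comp_apply, LinearMap.coe_restrictScalars, LinearMap.zero_apply]
    rw [map_smul, map_smul, h, smul_zero]
  induction q with
  | zero =>
    refine ext_one 0 (fun v => ?_) x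
    have h1 : Fin.contractNth (Fin.castSucc (0 : Fin 1)) (· * ·) v = fun _ => v 0 * v 1 := by
      funext l
      obtain rfl := Subsingleton.elim l 0
      simp [Fin.contractNth]
    have h0 : ∀ (y : EnvAlg k A) (w : Fin 1 → A),
        barDiff k A 0 (y ⊗ₜ PiTensorProduct.tprod k w) =
          (y * (w 0 ⊗ₜ 1 - 1 ⊗ₜ MulOpposite.op (w 0))) ⊗ₜ PiTensorProduct.tprod k Fin.elim0 := by
      intro y w
      rw [barDiff_tmul_tprod, Subsingleton.elim (Fin.tail w) Fin.elim0,
        Subsingleton.elim (Fin.init w) Fin.elim0]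
      simp [mul_sub, TensorProduct.sub_tmul, ← sub_eq_add_neg]
    have h2 : barDiff k A 1 ((1 : EnvAlg k A) ⊗ₜ PiTensorProduct.tprod k v) =
        (v 0 ⊗ₜ 1 : EnvAlg k A) ⊗ₜ PiTensorProduct.tprod k (Fin.tail v) -
        (1 : EnvAlg k A) ⊗ₜ PiTensorProduct.tprod k (fun _ : Fin 1 => v 0 * v 1) +
        (1 ⊗ₜ MulOpposite.op (v 1) : EnvAlg k A) ⊗ₜ PiTensorProduct.tprod k (Fin.init v) := by
      rw [barDiff_tmul_tprod, Fin.sum_univ_one, h1]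
      simp [← sub_eq_add_neg]
    rw [h2, map_add, map_sub, h0, h0, h0, ← TensorProduct.sub_tmul, ← TensorProduct.add_tmul]
    simp [Fin.tail, Fin.init, mul_sub]
  | succ q ih =>
    refine ext_one (q + 1) (fun v => ?_) x
    have h1 := fun y => eq_sub_of_add_eq (barDiff_barHomotopy k A (q + 1) y)
    have h2 := fun y => eq_sub_of_add_eq (barDiff_barHomotopy k A q y)
    rw [← barHomotopy_one_tmul, h1, map_sub, h2, ih, map_zero, sub_zero, sub_self]

end Bar

section Augmentation

variable {k : Type*} [Field k] {R : Type*} [Ring R] [Algebra k R] {V W : Type*} [AddCommGroup V]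
  [Module k V] [AddCommGroup W] [Module k W]

/-- If `V` is one-dimensional, `R ⊗ V` is the free `R`-module of rank one. -/
noncomputable def freeRankOne (R : Type*) [Ring R] [Algebra k R] (e : V ≃ₗ[k] k) :
    R ⊗[k] V ≃ₗ[R] R :=
  (TensorProduct.AlgebraTensorModule.congr (LinearEquiv.refl R R) e).trans
    (TensorProduct.AlgebraTensorModule.rid k R R)

theorem freeRankOne_tmul (e : V ≃ₗ[k] k) (a : R) (v : V) :
    freeRankOne R e (a ⊗ₜ v) = e v • a := rfl

/-- A presentation `R ⊗ W → R ⊗ V` with `V` one-dimensional resolves `R / J`, where `J` is its image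
in `R`. -/
theorem exact_freeRankOne (e : V ≃ₗ[k] k) (d : R ⊗[k] W →ₗ[R] R ⊗[k] V) (J : Submodule R R)
    (h : LinearMap.range ((freeRankOne R e).toLinearMap ∘ₗ d) = J) :
    Function.Exact d (J.mkQ ∘ₗ (freeRankOne R e).toLinearMap) := by
  subst h
  intro x
  rw [LinearMap.comp_apply, Submodule.mkQ_apply, Submodule.Quotient.mk_eq_zero]
  constructor
  · rintro ⟨y, hy⟩
    exact ⟨y, (freeRankOne R e).injective hy⟩
  · rintro ⟨y, rfl⟩
    exact ⟨y, rfl⟩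

end Augmentation

section BarResolution

variable (k : Type*) [Field k] (A : Type*) [Ring A] [Algebra k A]

/-- The last differential of the bar resolution has cokernel `A`, presented as `Aᵉ` modulo the left
ideal `diagIdeal k A`. -/
theorem range_barDiff_zero : LinearMap.range ((freeRankOne (EnvAlg k A)
    (PiTensorProduct.isEmptyEquiv (R := k) (s := fun _ : Fin 0 => A) (Fin 0))).toLinearMap ∘ₗ
      barDiff k A 0) = diagIdeal k A := by
  have key : ∀ (x : EnvAlg k A) (v : Fin 1 → A), freeRankOne (EnvAlg k A)
      (PiTensorProduct.isEmptyEquiv (R := k) (s := fun _ : Fin 0 => A) (Fin 0))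
      (barDiff k A 0 (x ⊗ₜ PiTensorProduct.tprod k v)) = -(x • innerElt k A (v 0)) := by
    intro x v
    rw [barDiff_tmul_tprod, innerElt_apply, map_add, map_add, Finset.univ_eq_empty,
      Finset.sum_empty, map_zero, add_zero, pow_succ, pow_zero, one_mul, neg_smul, one_smul,
      map_neg,
      freeRankOne_tmul, freeRankOne_tmul, PiTensorProduct.isEmptyEquiv_apply_tprod,
      PiTensorProduct.isEmptyEquiv_apply_tprod, one_smul, one_smul, smul_eq_mul, mul_sub, neg_sub,
      ← sub_eq_add_neg]
    rfl
  apply le_antisymm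
  · rintro _ ⟨y, rfl⟩
    rw [LinearMap.comp_apply]
    induction y with
    | zero => rw [map_zero, map_zero]; exact zero_mem _
    | add y z hy hz => rw [map_add, map_add]; exact add_mem hy hz
    | tmul x t =>
      induction t using PiTensorProduct.induction_on with
      | smul_tprod c v =>
        rw [← TensorProduct.smul_tmul]
        refine (congrArg (· ∈ diagIdeal k A) (key (c • x) v)).mpr ?_
        exact neg_mem (Submodule.smul_mem _ _ (Submodule.subset_span ⟨_, rfl⟩))
      | add t t' ht ht' => rw [TensorProduct.tmul_add, map_add, map_add]; exact add_mem ht ht'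
  · refine Submodule.span_le.2 ?_
    rintro _ ⟨a, rfl⟩
    refine ⟨(-1 : EnvAlg k A) ⊗ₜ PiTensorProduct.tprod k (fun _ => a), ?_⟩
    refine (key (-1) fun _ => a).trans ?_
    rw [neg_smul, one_smul, neg_neg]

/-- The bar resolution of the bimodule `A`. -/
noncomputable def barResolution : Resolution (EnvAlg k A) (EnvAlg k A ⧸ diagIdeal k A)
    (fun q => EnvAlg k A ⊗[k] ⨂[k]^q A) where
  d := barDiff k A
  aug := (diagIdeal k A).mkQ ∘ₗ (freeRankOne (EnvAlg k A)
    (PiTensorProduct.isEmptyEquiv (R := k) (s := fun _ : Fin 0 => A) (Fin 0))).toLinearMap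
  exact_d q x := by
    constructor
    · intro hx
      have h := barDiff_barHomotopy k A q x
      rw [hx, map_zero, add_zero] at h
      exact ⟨_, h⟩
    · rintro ⟨y, rfl⟩
      exact barDiff_barDiff k A q y
  exact_aug := exact_freeRankOne _ _ _ (range_barDiff_zero k A)
  aug_surjective := (Submodule.mkQ_surjective _).comp (LinearEquiv.surjective _)

end BarResolution

section HochschildComplex

variable (k : Type*) [Field k] (A : Type*) [Ring A] [Algebra k A] (M : Type*) [AddCommGroup M]
  [Module k M] [Module A M] [Module Aᵐᵒᵖ M] [IsScalarTower k A M] [IsScalarTower k Aᵐᵒᵖ M]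
  [SMulCommClass A Aᵐᵒᵖ M]

/-- Maps from the bar resolution to `M` form the Hochschild cochain complex. -/
theorem homMap_barDiff_lift (q : ℕ) (f : MultilinearMap k (fun _ : Fin q => A) M) :
    homMap (leftAct k A M) (barDiff k A q) (PiTensorProduct.lift f) =
      PiTensorProduct.lift (hochschildD k A M q f) := by
  refine PiTensorProduct.ext (MultilinearMap.ext fun a => ?_)
  rw [LinearMap.compMultilinearMap_apply, LinearMap.compMultilinearMap_apply, homMap_apply,
    barDiff_tmul_tprod, PiTensorProduct.lift.tprod, hochschildD_apply]
  simp only [map_add, map_sum, map_smul, homExt_tmul, PiTensorProduct.lift.tprod, one_mul, map_one,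
    Module.End.one_apply, leftAct_tmul, one_smul]

/-- The tensor product of `M` with the bar resolution is the Hochschild chain complex. -/
theorem tensorMap_barDiff (q : ℕ) :
    tensorMap (rightAct k A M) (barDiff k A q) = hochschildB k A M q := by
  refine TensorProduct.ext (LinearMap.ext fun m => PiTensorProduct.ext
    (MultilinearMap.ext fun a => ?_))
  change tensorMap (rightAct k A M) (barDiff k A q) (m ⊗ₜ PiTensorProduct.tprod k a) =
    hochschildB k A M q (m ⊗ₜ PiTensorProduct.tprod k a)
  rw [tensorMap_tmul, barDiff_tmul_tprod, hochschildB_tmul_tprod]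
  simp only [map_add, map_sum, map_smul, LinearMap.add_apply, LinearMap.sum_apply,
    LinearMap.smul_apply, tensorExt_tmul, one_mul, rightAct_tmul, map_one, MulOpposite.unop_one,
    Module.End.one_apply, one_smul, MulOpposite.unop_op, MulOpposite.op_one]

theorem nonempty_hochschildCohomologyEquiv (q : ℕ) :
    Nonempty (HochschildCohomology k A M q ≃ₗ[k]
      Cohomology (C := fun q => (⨂[k]^q A) →ₗ[k] M)
        (fun q => homMap (leftAct k A M) (barDiff k A q)) q) := by
  have hc : ∀ q (f : MultilinearMap k (fun _ : Fin q => A) M),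
      f ∈ hochschildCoboundaries k A M q ↔
        PiTensorProduct.lift f ∈ coboundaries (C := fun q => (⨂[k]^q A) →ₗ[k] M)
        (fun q => homMap (leftAct k A M) (barDiff k A q)) q := by
    rintro (_ | q) f
    · simp [hochschildCoboundaries, coboundaries]
    · constructor
      · rintro ⟨f, rfl⟩
        exact ⟨_, homMap_barDiff_lift k A M q f⟩
      · rintro ⟨f', hf'⟩
        refine ⟨PiTensorProduct.lift.symm f', PiTensorProduct.lift.injective ?_⟩
        rw [← homMap_barDiff_lift, LinearEquiv.apply_symm_apply]
        exact hf'
  have hz : ∀ q (f : MultilinearMap k (fun _ : Fin q => A) M),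
      f ∈ LinearMap.ker (hochschildD k A M q) ↔
        PiTensorProduct.lift f ∈ LinearMap.ker (homMap (leftAct k A M) (barDiff k A q)) := by
    intro q f
    rw [LinearMap.mem_ker, LinearMap.mem_ker, homMap_barDiff_lift,
      LinearEquiv.map_eq_zero_iff]
  refine nonempty_subquotientEquiv
    (PiTensorProduct.lift : MultilinearMap k (fun _ : Fin q => A) M ≃ₗ[k] _).toLinearMap
    (PiTensorProduct.lift : MultilinearMap k (fun _ : Fin q => A) M ≃ₗ[k] _).symm.toLinearMap
    (fun f => (hz q f).1) (fun f => (hc q f).1) (fun f hf => (hz q _).2 ?_)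
    (fun f hf => (hc q _).2 ?_) (fun f _ => ?_) (fun f _ => ?_)
  · change PiTensorProduct.lift (PiTensorProduct.lift.symm f) ∈ _
    rw [LinearEquiv.apply_symm_apply]
    exact hf
  · change PiTensorProduct.lift (PiTensorProduct.lift.symm f) ∈ _
    rw [LinearEquiv.apply_symm_apply]
    exact hf
  · simp
  · change PiTensorProduct.lift (PiTensorProduct.lift.symm f) - f ∈ _
    rw [LinearEquiv.apply_symm_apply, sub_self]
    exact zero_mem _

theorem nonempty_hochschildHomologyEquiv (q : ℕ) :
    Nonempty (HochschildHomology k A M q ≃ₗ[k]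
      Homology (C := fun q => M ⊗[k] ⨂[k]^q A)
        (fun q => tensorMap (rightAct k A M) (barDiff k A q)) q) := by
  have hc : hochschildCycles k A M q = cycles (C := fun q => M ⊗[k] ⨂[k]^q A)
      (fun q => tensorMap (rightAct k A M) (barDiff k A q)) q := by
    cases q with
    | zero => rfl
    | succ q => exact congrArg LinearMap.ker (tensorMap_barDiff k A M q).symm
  refine nonempty_subquotientEquiv LinearMap.id LinearMap.id ?_ ?_ ?_ ?_ ?_ ?_
  · exact hc.le
  · exact (congrArg LinearMap.range (tensorMap_barDiff k A M q).symm).le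
  · exact hc.ge
  · exact (congrArg LinearMap.range (tensorMap_barDiff k A M q)).le
  · simp
  · simp

end HochschildComplex

/-! ### The Koszul resolution of the enveloping algebra -/

section Graded

variable {k : Type*} [Field k] {n : ℕ}

noncomputable instance (q : ℕ) : AddCommGroup (extPow k n q) := inferInstance

variable (k n) in
/-- The projection of the exterior algebra onto its component of degree `q`. -/
noncomputable def extProj (q : ℕ) : Fock k n →ₗ[k] extPow k n q :=
  Finsupp.restrictDom k k {T : Finset (Fin n) | T.card = q}

theorem extProj_of_mem {q : ℕ} {w : Fock k n} (hw : w ∈ extPow k n q) : extProj k n q w = ⟨w, hw⟩ :=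
  LinearMap.congr_fun (Finsupp.restrictDom_comp_subtype (M := k) (R := k)
    {T : Finset (Fin n) | T.card = q}) ⟨w, hw⟩

theorem extProj_of_mem_ne {p q : ℕ} (h : p ≠ q) {w : Fock k n} (hw : w ∈ extPow k n p) :
    extProj k n q w = 0 := by
  refine extPow_le (p := LinearMap.ker (extProj k n q)) (fun T hT => ?_) hw
  rw [LinearMap.mem_ker]
  refine Subtype.ext ?_
  change Finsupp.filter _ _ = 0
  exact Finsupp.filter_single_of_neg _ fun h' => h (hT.symm.trans h')

variable (k) in
/-- Contraction with the `i`-th dual basis vector, from degree `q + 1` to degree `q`. -/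
noncomputable def annLow (i : Fin n) (q : ℕ) : extPow k n (q + 1) →ₗ[k] extPow k n q :=
  (annihilation k i).restrict fun _ hw => annihilation_mem_extPow i hw

variable {g : Type*} [LieRing g] [LieAlgebra k g] (b : Module.Basis (Fin n) k g)

/-- The operator `bracketFock` from degree `q + 1` to degree `q`. -/
noncomputable def brLow (q : ℕ) : extPow k n (q + 1) →ₗ[k] extPow k n q :=
  (bracketFock b).restrict fun _ hw => bracketFock_mem_extPow b hw

theorem brLow_zero : brLow b 0 = 0 := by
  refine LinearMap.ext fun w => Subtype.ext ?_
  change bracketFock b w = 0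
  rw [bracketFock, LinearMap.sum_apply]
  refine Finset.sum_eq_zero fun i _ => ?_
  rw [LinearMap.sum_apply]
  refine Finset.sum_eq_zero fun j _ => ?_
  split_ifs
  · rw [Module.End.mul_apply, Module.End.mul_apply,
      annihilation_eq_zero i (annihilation_mem_extPow j w.2), map_zero]
  · rfl

variable {N : Type*} [AddCommGroup N] [Module k N] (ρ : g →ₗ[k] Module.End k N)

noncomputable instance (q : ℕ) : AddCommGroup (N ⊗[k] extPow k n q) := TensorProduct.addCommGroup

/-- The Chevalley–Eilenberg differential from degree `q + 1` to degree `q`. -/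
noncomputable def ceGr (q : ℕ) : N ⊗[k] extPow k n (q + 1) →ₗ[k] N ⊗[k] extPow k n q :=
  ∑ i, TensorProduct.map (ρ (b i)) (annLow k i q) - (brLow b q).lTensor N

theorem ceGr_tmul (q : ℕ) (m : N) (w : extPow k n (q + 1)) :
    ceGr b ρ q (m ⊗ₜ w) = ∑ i, ρ (b i) m ⊗ₜ annLow k i q w - m ⊗ₜ brLow b q w := by
  simp [ceGr, LinearMap.sum_apply]

theorem subtype_ceGr (q : ℕ) (x : N ⊗[k] extPow k n (q + 1)) :
    (extPow k n q).subtype.lTensor N (ceGr b ρ q x) =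
      ceDiff b ρ ((extPow k n (q + 1)).subtype.lTensor N x) := by
  refine LinearMap.congr_fun (f := (extPow k n q).subtype.lTensor N ∘ₗ ceGr b ρ q)
    (g := ceDiff b ρ ∘ₗ (extPow k n (q + 1)).subtype.lTensor N)
    (TensorProduct.ext' fun m w => ?_) x
  simp only [LinearMap.comp_apply, ceGr_tmul, map_sub, map_sum, LinearMap.lTensor_tmul, ceDiff,
    LinearMap.sub_apply, LinearMap.sum_apply, TensorProduct.map_tmul]
  rfl

theorem extProj_lTensor_subtype (q : ℕ) (x : N ⊗[k] extPow k n q) :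
    (extProj k n q).lTensor N ((extPow k n q).subtype.lTensor N x) = x := by
  have h : extProj k n q ∘ₗ (extPow k n q).subtype = LinearMap.id :=
    LinearMap.ext fun w => extProj_of_mem w.2
  rw [← LinearMap.comp_apply, ← LinearMap.lTensor_comp, h, LinearMap.lTensor_id_apply]

theorem extProj_annihilation (i : Fin n) (q : ℕ) (w : Fock k n) :
    extProj k n q (annihilation k i w) = annLow k i q (extProj k n (q + 1) w) := by
  refine LinearMap.congr_fun (f := extProj k n q ∘ₗ annihilation k i)
    (g := annLow k i q ∘ₗ extProj k n (q + 1)) (Finsupp.lhom_ext fun T c => ?_) w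
  rw [LinearMap.comp_apply, LinearMap.comp_apply]
  have hT := single_mem_extPow (k := k) (T := T) rfl c
  rcases hp : T.card with _ | p <;> rw [hp] at hT
  · rw [annihilation_eq_zero i hT, extProj_of_mem_ne (Nat.succ_ne_zero q).symm hT, map_zero,
      map_zero]
  · have h := annihilation_mem_extPow i hT
    rcases eq_or_ne p q with rfl | hpq
    · rw [extProj_of_mem h, extProj_of_mem hT]; rfl
    · rw [extProj_of_mem_ne hpq h, extProj_of_mem_ne (fun h => hpq (Nat.succ_injective h)) hT,
        map_zero]

theorem extProj_bracketFock (q : ℕ) (w : Fock k n) :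
    extProj k n q (bracketFock b w) = brLow b q (extProj k n (q + 1) w) := by
  refine LinearMap.congr_fun (f := extProj k n q ∘ₗ bracketFock b)
    (g := brLow b q ∘ₗ extProj k n (q + 1)) (Finsupp.lhom_ext fun T c => ?_) w
  rw [LinearMap.comp_apply, LinearMap.comp_apply]
  have hT := single_mem_extPow (k := k) (T := T) rfl c
  rcases hp : T.card with _ | p <;> rw [hp] at hT
  · rw [bracketFock_eq_zero b hT, extProj_of_mem_ne (Nat.succ_ne_zero q).symm hT, map_zero,
      map_zero]
  · have h := bracketFock_mem_extPow b hT
    rcases eq_or_ne p q with rfl | hpq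
    · rw [extProj_of_mem h, extProj_of_mem hT]; rfl
    · rw [extProj_of_mem_ne hpq h, extProj_of_mem_ne (fun h => hpq (Nat.succ_injective h)) hT,
        map_zero]

theorem extProj_ceDiff (q : ℕ) (x : N ⊗[k] Fock k n) :
    (extProj k n q).lTensor N (ceDiff b ρ x) =
      ceGr b ρ q ((extProj k n (q + 1)).lTensor N x) := by
  refine LinearMap.congr_fun (f := (extProj k n q).lTensor N ∘ₗ ceDiff b ρ)
    (g := ceGr b ρ q ∘ₗ (extProj k n (q + 1)).lTensor N) (TensorProduct.ext' fun m w => ?_) x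
  simp only [LinearMap.comp_apply, ceGr_tmul, map_sub, map_sum, LinearMap.lTensor_tmul, ceDiff,
    LinearMap.sub_apply, LinearMap.sum_apply, TensorProduct.map_tmul, extProj_annihilation,
    extProj_bracketFock]

/-- The complex with coefficients in polynomials is exact in each positive degree. -/
theorem exact_ceGr_pbwAct (q : ℕ) :
    Function.Exact (ceGr b (pbwAct b) (q + 1)) (ceGr b (pbwAct b) q) := by
  intro x
  constructor
  · intro hx
    obtain ⟨y, c, hy⟩ := exists_ceDiff_eq b ((extPow k n (q + 1)).subtype.lTensor _ x) (by
      rw [← subtype_ceGr, hx, map_zero])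
    refine ⟨(extProj k n (q + 2)).lTensor _ y, ?_⟩
    have h := congrArg ((extProj k n (q + 1)).lTensor _) hy
    rw [extProj_lTensor_subtype, map_add, extProj_ceDiff, map_smul, LinearMap.lTensor_tmul,
      extProj_of_mem_ne (Nat.succ_ne_zero q).symm (single_mem_extPow Finset.card_empty 1),
      TensorProduct.tmul_zero, smul_zero, add_zero] at h
    exact h.symm
  · rintro ⟨y, rfl⟩
    have h := congrArg ((extProj k n q).lTensor _)
      (LinearMap.congr_fun (ceDiff_mul_self b _ (pbwAct_lie b))
        ((extPow k n (q + 2)).subtype.lTensor _ y))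
    rwa [Module.End.mul_apply, extProj_ceDiff, extProj_ceDiff, extProj_lTensor_subtype,
      LinearMap.zero_apply, map_zero] at h

variable {N' : Type*} [AddCommGroup N'] [Module k N'] {ρ} {ρ' : g →ₗ[k] Module.End k N'}

theorem ceGr_rTensor (e : N ≃ₗ[k] N') (he : ∀ x m, ρ' x (e m) = e (ρ x m)) (q : ℕ) :
    ceGr b ρ' q ∘ₗ (e.rTensor (extPow k n (q + 1))).toLinearMap =
      (e.rTensor (extPow k n q)).toLinearMap ∘ₗ ceGr b ρ q :=
  TensorProduct.ext' fun m w => by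
    simp only [LinearMap.comp_apply, LinearEquiv.coe_coe, LinearEquiv.rTensor_tmul, ceGr_tmul,
      map_sub, map_sum, he]

theorem exact_ceGr_congr (e : N ≃ₗ[k] N') (he : ∀ x m, ρ' x (e m) = e (ρ x m)) {q : ℕ}
    (h : Function.Exact (ceGr b ρ (q + 1)) (ceGr b ρ q)) :
    Function.Exact (ceGr b ρ' (q + 1)) (ceGr b ρ' q) := by
  exact h.of_ladder_linearEquiv_of_exact (ceGr_rTensor b e he (q + 1)) (ceGr_rTensor b e he q)

theorem nonempty_homologyEquiv_ceGr (e : N ≃ₗ[k] N') (he : ∀ x m, ρ' x (e m) = e (ρ x m)) (q : ℕ) :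
    Nonempty (Homology (C := fun q => N ⊗[k] extPow k n q) (ceGr b ρ) q ≃ₗ[k]
      Homology (C := fun q => N' ⊗[k] extPow k n q) (ceGr b ρ') q) := by
  have hc := fun q x => (LinearMap.congr_fun (ceGr_rTensor b e he q) x).symm
  have hc' := fun q x => (LinearMap.congr_fun (ceGr_rTensor b e.symm (ρ := ρ') (ρ' := ρ)
    (fun x m => by rw [LinearEquiv.eq_symm_apply, ← he, LinearEquiv.apply_symm_apply]) q) x).symm
  refine nonempty_subquotientEquiv (e.rTensor (extPow k n q)).toLinearMap
    (e.symm.rTensor (extPow k n q)).toLinearMap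
    (map_mem_cycles (f := fun q => (e.rTensor (extPow k n q)).toLinearMap) hc q)
    ?_
    (map_mem_cycles (f := fun q => (e.symm.rTensor (extPow k n q)).toLinearMap) hc' q)
    ?_ (fun x _ => ?_) (fun x _ => ?_)
  · rintro _ ⟨y, rfl⟩
    exact ⟨_, (hc q y).symm⟩
  · rintro _ ⟨y, rfl⟩
    exact ⟨_, (hc' q y).symm⟩
  · change (e.rTensor (extPow k n q)).symm (e.rTensor (extPow k n q) x) - x ∈ _
    rw [LinearEquiv.symm_apply_apply, sub_self]
    exact zero_mem _
  · change e.rTensor (extPow k n q) ((e.rTensor (extPow k n q)).symm x) - x ∈ _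
    rw [LinearEquiv.apply_symm_apply, sub_self]
    exact zero_mem _

theorem exact_ceGr_lTensor (P : Type*) [AddCommGroup P] [Module k P]
    {ρ' : g →ₗ[k] Module.End k (P ⊗[k] N)} (hρ' : ∀ x, ρ' x = (ρ x).lTensor P) {q : ℕ}
    (h : Function.Exact (ceGr b ρ (q + 1)) (ceGr b ρ q)) :
    Function.Exact (ceGr b ρ' (q + 1)) (ceGr b ρ' q) := by
  have hc : ∀ q, ceGr b ρ' q ∘ₗ (TensorProduct.assoc k P N (extPow k n (q + 1))).symm.toLinearMap =
      (TensorProduct.assoc k P N (extPow k n q)).symm.toLinearMap ∘ₗ (ceGr b ρ q).lTensor P :=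
    fun q => TensorProduct.ext (LinearMap.ext fun p => TensorProduct.ext' fun m w => by
      change ceGr b ρ' q ((TensorProduct.assoc k P N (extPow k n (q + 1))).symm (p ⊗ₜ (m ⊗ₜ w))) =
        (TensorProduct.assoc k P N (extPow k n q)).symm ((ceGr b ρ q).lTensor P (p ⊗ₜ (m ⊗ₜ w)))
      simp only [TensorProduct.assoc_symm_tmul, ceGr_tmul, LinearMap.lTensor_tmul,
        hρ', TensorProduct.tmul_sub, TensorProduct.tmul_sum, map_sub, map_sum])
  exact (Module.Flat.lTensor_exact P h).of_ladder_linearEquiv_of_exact (hc (q + 1)) (hc q)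

end Graded

section Antipode

variable (k : Type*) [Field k] (g : Type*) [LieRing g] [LieAlgebra k g]

local notation "U" => UniversalEnvelopingAlgebra k g

variable {k g} in
/-- A subspace of the enveloping algebra that contains `1` and is stable under right multiplication
by `g` is everything. -/
theorem mem_of_mul_toU_mem (W : Submodule k U) (h1 : 1 ∈ W)
    (hW : ∀ u ∈ W, ∀ x, u * toU k x ∈ W) (u : U) : u ∈ W := by
  let S : Subalgebra k U :=
    { carrier := {v | ∀ u ∈ W, u * v ∈ W}
      mul_mem' := fun {v v'} hv hv' u hu => by rw [← mul_assoc]; exact hv' _ (hv u hu)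
      add_mem' := fun {v v'} hv hv' u hu => by rw [mul_add]; exact add_mem (hv u hu) (hv' u hu)
      algebraMap_mem' := fun c u hu => by
        rw [← Algebra.commutes, ← Algebra.smul_def]; exact W.smul_mem c hu }
  have h := mem_of_toU_mem S (fun x u hu => hW u hu x) u 1 h1
  rwa [one_mul] at h

theorem innerElt_toU_lie (x y : g) : innerElt k U (toU k ⁅x, y⁆) =
    innerElt k U (toU k y) * innerElt k U (toU k x) -
      innerElt k U (toU k x) * innerElt k U (toU k y) := by
  simp only [innerElt_apply, toU_lie, mul_sub, sub_mul, Algebra.TensorProduct.tmul_mul_tmul,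
    MulOpposite.op_sub, MulOpposite.op_mul, TensorProduct.tmul_sub, TensorProduct.sub_tmul, one_mul,
    mul_one]
  abel

/-- The anti-homomorphism `U(g) → U(g) ⊗ U(g)ᵐᵒᵖ` with `x ↦ 1 ⊗ x - x ⊗ 1` for `x ∈ g`. -/
noncomputable def antiInner : U →ₐ[k] (EnvAlg k U)ᵐᵒᵖ :=
  liftU ((MulOpposite.opLinearEquiv k : EnvAlg k U ≃ₗ[k] _).toLinearMap ∘ₗ
    innerElt k U ∘ₗ toU k) fun x y => congrArg MulOpposite.op (innerElt_toU_lie k g x y)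

theorem antiInner_toU (x : g) :
    antiInner k g (toU k x) = MulOpposite.op (innerElt k U (toU k x)) := liftU_toU _ _ x

theorem antiInner_mul_toU (u : U) (x : g) : (antiInner k g (u * toU k x)).unop =
    innerElt k U (toU k x) * (antiInner k g u).unop := by
  rw [map_mul, MulOpposite.unop_mul, antiInner_toU, MulOpposite.unop_op]

theorem antiInner_toU_mul (u : U) (x : g) : (antiInner k g (toU k x * u)).unop =
    (antiInner k g u).unop * innerElt k U (toU k x) := by
  rw [map_mul, MulOpposite.unop_mul, antiInner_toU, MulOpposite.unop_op]

/-- The comultiplication `U(g) → U(g) ⊗ U(g)`, `x ↦ x ⊗ 1 + 1 ⊗ x` for `x ∈ g`. -/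
noncomputable def comulU : U →ₐ[k] U ⊗[k] U :=
  liftU ((TensorProduct.mk k U U).flip 1 ∘ₗ toU k + TensorProduct.mk k U U 1 ∘ₗ toU k) fun x y => by
    simp only [LinearMap.comp_apply, LinearMap.add_apply, LinearMap.flip_apply,
      TensorProduct.mk_apply, toU_lie, TensorProduct.sub_tmul, TensorProduct.tmul_sub, mul_add,
      add_mul, Algebra.TensorProduct.tmul_mul_tmul, one_mul, mul_one]
    abel

theorem comulU_mul_toU (u : U) (x : g) : comulU k g (u * toU k x) =
    comulU k g u * (toU k x ⊗ₜ 1 + 1 ⊗ₜ toU k x) :=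
  (map_mul _ _ _).trans (congrArg (comulU k g u * ·) (liftU_toU _ _ x))

/-- The map `U(g) ⊗ U(g) → U(g) ⊗ U(g)ᵐᵒᵖ`, `a ⊗ u ↦ (a ⊗ 1) S(u)`, where `S` is the
anti-homomorphism `antiInner`. -/
noncomputable def untwist : U ⊗[k] U →ₗ[k] EnvAlg k U :=
  TensorProduct.lift <| (LinearMap.mul k (EnvAlg k U)).compl₁₂
    (Algebra.TensorProduct.includeLeft : U →ₐ[k] EnvAlg k U).toLinearMap
    ((MulOpposite.opLinearEquiv k : EnvAlg k U ≃ₗ[k] _).symm.toLinearMap ∘ₗ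
      (antiInner k g).toLinearMap)

theorem untwist_tmul (a u : U) :
    untwist k g (a ⊗ₜ u) = (a ⊗ₜ 1) * (antiInner k g u).unop := rfl

/-- The map `U(g) ⊗ U(g)ᵐᵒᵖ → U(g) ⊗ U(g)`, `a ⊗ b ↦ (a ⊗ 1) Δ(b)`. -/
noncomputable def twistComul : EnvAlg k U →ₗ[k] U ⊗[k] U :=
  TensorProduct.lift <| (LinearMap.mul k (U ⊗[k] U)).compl₁₂
    (Algebra.TensorProduct.includeLeft : U →ₐ[k] U ⊗[k] U).toLinearMap
    ((comulU k g).toLinearMap ∘ₗ (MulOpposite.opLinearEquiv k : U ≃ₗ[k] _).symm.toLinearMap)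

theorem twistComul_tmul (a b : U) :
    twistComul k g (a ⊗ₜ MulOpposite.op b) = (a ⊗ₜ 1) * comulU k g b := rfl

theorem untwist_mul (t : U ⊗[k] U) (x : g) :
    untwist k g (t * (toU k x ⊗ₜ 1 + 1 ⊗ₜ toU k x)) =
      (1 ⊗ₜ MulOpposite.op (toU k x)) * untwist k g t := by
  refine LinearMap.congr_fun (f := untwist k g ∘ₗ
    LinearMap.mulRight k (toU k x ⊗ₜ 1 + 1 ⊗ₜ toU k x : U ⊗[k] U))
    (g := LinearMap.mulLeft k (1 ⊗ₜ MulOpposite.op (toU k x) : EnvAlg k U) ∘ₗ untwist k g)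
    (TensorProduct.ext' fun a u => ?_) t
  rw [LinearMap.comp_apply, LinearMap.comp_apply, LinearMap.mulRight_apply,
    LinearMap.mulLeft_apply, mul_add, Algebra.TensorProduct.tmul_mul_tmul,
    Algebra.TensorProduct.tmul_mul_tmul, mul_one, mul_one, map_add, untwist_tmul, untwist_tmul,
    untwist_tmul, antiInner_mul_toU, ← mul_assoc, ← mul_assoc, ← add_mul, innerElt_apply]
  simp only [mul_sub, Algebra.TensorProduct.tmul_mul_tmul, mul_one, one_mul]
  rw [add_sub_cancel]

theorem twistComul_mul (r : EnvAlg k U) (x : g) :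
    twistComul k g ((1 ⊗ₜ MulOpposite.op (toU k x)) * r) =
      twistComul k g r * (toU k x ⊗ₜ 1 + 1 ⊗ₜ toU k x) := by
  refine LinearMap.congr_fun (f := twistComul k g ∘ₗ
    LinearMap.mulLeft k (1 ⊗ₜ MulOpposite.op (toU k x) : EnvAlg k U))
    (g := LinearMap.mulRight k (toU k x ⊗ₜ 1 + 1 ⊗ₜ toU k x : U ⊗[k] U) ∘ₗ twistComul k g)
    (TensorProduct.ext' fun a u => ?_) r
  obtain ⟨u, rfl⟩ := MulOpposite.op_surjective u
  rw [LinearMap.comp_apply, LinearMap.comp_apply, LinearMap.mulRight_apply,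
    LinearMap.mulLeft_apply, Algebra.TensorProduct.tmul_mul_tmul, one_mul, ← MulOpposite.op_mul,
    twistComul_tmul, twistComul_tmul, comulU_mul_toU, mul_assoc]

theorem twistComul_untwist (t : U ⊗[k] U) : twistComul k g (untwist k g t) = t := by
  refine LinearMap.congr_fun (f := twistComul k g ∘ₗ untwist k g) (g := LinearMap.id)
    (TensorProduct.ext' fun a u => ?_) t
  let W : Submodule k U :=
    { carrier := {u | ∀ a, twistComul k g (untwist k g (a ⊗ₜ u)) = a ⊗ₜ u}
      zero_mem' := fun a => by rw [TensorProduct.tmul_zero, map_zero, map_zero]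
      add_mem' := fun {u v} hu hv a => by rw [TensorProduct.tmul_add, map_add, map_add, hu, hv]
      smul_mem' := fun c u hu a => by rw [TensorProduct.tmul_smul, map_smul, map_smul, hu] }
  refine mem_of_mul_toU_mem W (fun a => ?_) (fun u hu x a => ?_) u a
  · rw [untwist_tmul, map_one, MulOpposite.unop_one, mul_one, ← MulOpposite.op_one,
      twistComul_tmul, map_one, mul_one]
  · have h : a ⊗ₜ[k] (u * toU k x) = (a ⊗ₜ[k] u) * (toU k x ⊗ₜ 1 + 1 ⊗ₜ toU k x) -
        (a * toU k x) ⊗ₜ[k] u := by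
      simp [mul_add]
    rw [h, map_sub, map_sub, untwist_mul, twistComul_mul, hu, hu]

theorem untwist_twistComul (r : EnvAlg k U) : untwist k g (twistComul k g r) = r := by
  refine LinearMap.congr_fun (f := untwist k g ∘ₗ twistComul k g) (g := LinearMap.id)
    (TensorProduct.ext' fun a u => ?_) r
  obtain ⟨u, rfl⟩ := MulOpposite.op_surjective u
  let W : Submodule k U :=
    { carrier := {u | ∀ a, untwist k g (twistComul k g (a ⊗ₜ MulOpposite.op u)) =
        a ⊗ₜ MulOpposite.op u}
      zero_mem' := fun a => by
        rw [MulOpposite.op_zero, TensorProduct.tmul_zero, map_zero, map_zero]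
      add_mem' := fun {u v} hu hv a => by
        rw [MulOpposite.op_add, TensorProduct.tmul_add, map_add, map_add, hu, hv]
      smul_mem' := fun c u hu a => by
        rw [MulOpposite.op_smul, TensorProduct.tmul_smul, map_smul, map_smul, hu] }
  refine mem_of_mul_toU_mem W (fun a => ?_) (fun u hu x a => ?_) u a
  · rw [twistComul_tmul, map_one, mul_one, untwist_tmul, map_one, MulOpposite.unop_one, mul_one]
    rfl
  · have h : a ⊗ₜ[k] MulOpposite.op (u * toU k x) =
        (1 ⊗ₜ MulOpposite.op (toU k x)) * (a ⊗ₜ[k] MulOpposite.op u : EnvAlg k U) := by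
      simp
    rw [h, twistComul_mul, untwist_mul, hu]

/-- The isomorphism `U(g) ⊗ U(g) ≃ U(g) ⊗ U(g)ᵐᵒᵖ` under which left multiplication by `x ∈ g` on the
second factor becomes right multiplication by `1 ⊗ x - x ⊗ 1`. -/
noncomputable def untwistEquiv : U ⊗[k] U ≃ₗ[k] EnvAlg k U where
  __ := untwist k g
  invFun := twistComul k g
  left_inv := twistComul_untwist k g
  right_inv := untwist_twistComul k g

theorem untwistEquiv_lTensor (x : g) (t : U ⊗[k] U) :
    untwistEquiv k g ((LinearMap.mulLeft k (toU k x)).lTensor U t) =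
      untwistEquiv k g t * innerElt k U (toU k x) := by
  refine LinearMap.congr_fun (f := untwist k g ∘ₗ (LinearMap.mulLeft k (toU k x)).lTensor U)
    (g := LinearMap.mulRight k (innerElt k U (toU k x)) ∘ₗ untwist k g)
    (TensorProduct.ext' fun a u => ?_) t
  rw [LinearMap.comp_apply, LinearMap.comp_apply, LinearMap.mulRight_apply, LinearMap.lTensor_tmul,
    LinearMap.mulLeft_apply, untwist_tmul, untwist_tmul, antiInner_toU_mul, mul_assoc]

end Antipode

section KoszulResolution

variable {k : Type*} [Field k] {g : Type*} [LieRing g] [LieAlgebra k g] {n : ℕ}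
  (b : Module.Basis (Fin n) k g)

local notation "U" => UniversalEnvelopingAlgebra k g

noncomputable instance (V : Type*) [AddCommGroup V] [Module k V] :
    AddCommGroup (EnvAlg k U ⊗[k] V) := TensorProduct.addCommGroup

/-- The differential of the Koszul resolution of the bimodule `U(g)`. -/
noncomputable def kosDiff (q : ℕ) :
    EnvAlg k U ⊗[k] extPow k n (q + 1) →ₗ[EnvAlg k U] EnvAlg k U ⊗[k] extPow k n q :=
  freeLift (R := EnvAlg k U) (X := EnvAlg k U ⊗[k] extPow k n q) <|
    ∑ i, TensorProduct.mk k (EnvAlg k U) _ (innerElt k U (toU k (b i))) ∘ₗ annLow k i q -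
      TensorProduct.mk k (EnvAlg k U) _ 1 ∘ₗ brLow b q

theorem kosDiff_tmul (q : ℕ) (r : EnvAlg k U) (w : extPow k n (q + 1)) :
    kosDiff b q (r ⊗ₜ w) = ∑ i, (r * innerElt k U (toU k (b i))) ⊗ₜ annLow k i q w -
      r ⊗ₜ brLow b q w := by
  simp [kosDiff, freeLift_tmul, LinearMap.sum_apply, smul_sub, Finset.smul_sum,
    TensorProduct.smul_tmul']

variable (k g) in
/-- Left multiplication of `g` on `U(g)`. -/
noncomputable def mulLeftAct : g →ₗ[k] Module.End k U := LinearMap.mul k U ∘ₗ toU k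

variable (k g) in
/-- Right multiplication by `1 ⊗ x - x ⊗ 1` on the enveloping algebra of `U(g)`, for `x ∈ g`. -/
noncomputable def mulInnerAct : g →ₗ[k] Module.End k (EnvAlg k U) :=
  (LinearMap.mul k (EnvAlg k U)).flip ∘ₗ innerElt k U ∘ₗ toU k

theorem kosDiff_eq_ceGr (q : ℕ) : (kosDiff b q).restrictScalars k = ceGr b (mulInnerAct k g) q :=
  TensorProduct.ext' fun r w => by
    rw [LinearMap.restrictScalars_apply, kosDiff_tmul, ceGr_tmul]
    rfl

variable (k g) in
/-- Left multiplication of `g` on the second factor of `U(g) ⊗ U(g)`. -/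
noncomputable def mulRightFactorAct : g →ₗ[k] Module.End k (U ⊗[k] U) :=
  (LinearMap.lTensorHom U : (U →ₗ[k] U) →ₗ[k] (U ⊗[k] U →ₗ[k] U ⊗[k] U)) ∘ₗ mulLeftAct k g

/-- Exactness is transported from polynomials to `U(g)` by the Poincaré–Birkhoff–Witt theorem, then
to `U(g) ⊗ U(g)` because `U(g)` is free over the field, then to `U(g) ⊗ U(g)ᵐᵒᵖ` by
`untwistEquiv`. -/
theorem exact_kosDiff (q : ℕ) : Function.Exact (kosDiff b (q + 1)) (kosDiff b q) := by
  have h1 : Function.Exact (ceGr b (mulLeftAct k g) (q + 1)) (ceGr b (mulLeftAct k g) q) :=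
    exact_ceGr_congr b (pbwEquiv b) (fun x v => (orderedProd_pbwAct b x v).symm)
      (exact_ceGr_pbwAct b q)
  have h2 : Function.Exact (ceGr b (mulRightFactorAct k g) (q + 1))
      (ceGr b (mulRightFactorAct k g) q) :=
    exact_ceGr_lTensor b U (fun x => rfl) h1
  have h3 : Function.Exact (ceGr b (mulInnerAct k g) (q + 1)) (ceGr b (mulInnerAct k g) q) :=
    exact_ceGr_congr b (untwistEquiv k g) (fun x t => (untwistEquiv_lTensor k g x t).symm) h2
  rw [← kosDiff_eq_ceGr, ← kosDiff_eq_ceGr] at h3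
  exact h3

variable (k n) in
/-- The component of degree `0` of the exterior algebra is one-dimensional. -/
noncomputable def extPowZeroEquiv : extPow k n 0 ≃ₗ[k] k :=
  LinearEquiv.ofLinearMap (Finsupp.lapply ∅ ∘ₗ (extPow k n 0).subtype)
    (LinearMap.toSpanSingleton k (extPow k n 0)
      ⟨Finsupp.single ∅ 1, single_mem_extPow Finset.card_empty 1⟩)
    (LinearMap.ext_ring (by simp)) (LinearMap.ext fun w => Subtype.ext (by
      refine extPow_le (p := LinearMap.eqLocus (LinearMap.toSpanSingleton k (Fock k n)
        (Finsupp.single ∅ 1) ∘ₗ Finsupp.lapply ∅) LinearMap.id) (fun T hT => ?_) w.2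
      rw [Finset.card_eq_zero.1 hT, LinearMap.mem_eqLocus]
      simp))

/-- The last differential of the Koszul resolution has the same image in `U(g)ᵉ` as that of the bar
resolution. -/
theorem range_kosDiff_zero : LinearMap.range
    ((freeRankOne (EnvAlg k U) (extPowZeroEquiv k n)).toLinearMap ∘ₗ kosDiff b 0) =
      diagIdeal k U := by
  set e := extPowZeroEquiv k n
  have key : ∀ (r : EnvAlg k U) (w : extPow k n 1), freeRankOne (EnvAlg k U) e
      (kosDiff b 0 (r ⊗ₜ w)) = ∑ i, e (annLow k i 0 w) • (r * innerElt k U (toU k (b i))) := by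
    intro r w
    rw [kosDiff_tmul, brLow_zero, LinearMap.zero_apply, TensorProduct.tmul_zero, sub_zero, map_sum]
    rfl
  apply le_antisymm
  · rintro _ ⟨y, rfl⟩
    rw [LinearMap.comp_apply]
    induction y with
    | zero => rw [map_zero, map_zero]; exact zero_mem _
    | add y z hy hz => rw [map_add, map_add]; exact add_mem hy hz
    | tmul r w =>
      refine (congrArg (· ∈ diagIdeal k U) (key r w)).mpr (sum_mem fun i _ => ?_)
      rw [← smul_mul_assoc]
      exact Submodule.smul_mem _ (_ • r) (Submodule.subset_span ⟨_, rfl⟩)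
  · set J := LinearMap.range ((freeRankOne (EnvAlg k U) e).toLinearMap ∘ₗ kosDiff b 0)
    have hsmul : ∀ (c : k), ∀ r ∈ J, c • r ∈ J := fun c r hr => by
      have : c • r = (c • (1 : EnvAlg k U)) • r := by rw [smul_eq_mul, smul_mul_assoc, one_mul]
      rw [this]
      exact Submodule.smul_mem _ _ hr
    have hb : ∀ i, innerElt k U (toU k (b i)) ∈ J := by
      intro i
      refine ⟨(1 : EnvAlg k U) ⊗ₜ ⟨Finsupp.single {i} 1,
        single_mem_extPow (Finset.card_singleton i) 1⟩, ?_⟩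
      refine (key _ _).trans ?_
      rw [Finset.sum_eq_single i]
      · have : e (annLow k i 0 ⟨Finsupp.single {i} 1,
            single_mem_extPow (Finset.card_singleton i) 1⟩) = 1 := by
          change annihilation k i (Finsupp.single {i} 1) ∅ = 1
          rw [annihilation_single, if_pos (Finset.mem_singleton_self i),
            koszulSign_of_forall_lt k (fun j hj => (Finset.mem_singleton.1 hj).ge)]
          simp
        rw [this, one_smul, one_mul]
      · intro j _ hj
        have : e (annLow k j 0 ⟨Finsupp.single {i} 1,
            single_mem_extPow (Finset.card_singleton i) 1⟩) = 0 := by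
          change annihilation k j (Finsupp.single {i} 1) ∅ = 0
          rw [annihilation_single, if_neg (fun h => hj (Finset.mem_singleton.1 h))]
          rfl
        rw [this, zero_smul]
      · exact fun h => absurd (Finset.mem_univ i) h
    have hx : ∀ x, innerElt k U (toU k x) ∈ J := fun x => by
      rw [← b.sum_repr x, map_sum, map_sum]
      exact sum_mem fun i _ => by rw [map_smul, map_smul]; exact hsmul _ _ (hb i)
    let S : Subalgebra k U :=
      { carrier := {u | innerElt k U u ∈ J}
        mul_mem' := fun {u v} hu hv => by
          change innerElt k U (u * v) ∈ J
          rw [innerElt_mul]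
          exact add_mem (Submodule.smul_mem J _ hu) (Submodule.smul_mem J _ hv)
        add_mem' := fun {u v} hu hv => by
          change innerElt k U (u + v) ∈ J
          rw [map_add]
          exact add_mem hu hv
        algebraMap_mem' := fun c => by
          change innerElt k U (algebraMap k U c) ∈ J
          rw [Algebra.algebraMap_eq_smul_one, map_smul, innerElt_apply]
          exact hsmul c _ (by rw [MulOpposite.op_one, sub_self]; exact zero_mem _) }
    refine Submodule.span_le.2 ?_
    rintro _ ⟨u, rfl⟩
    exact mem_of_toU_mem S hx u

/-- The Koszul resolution of the bimodule `U(g)`. -/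
noncomputable def koszulResolution : Resolution (EnvAlg k U) (EnvAlg k U ⧸ diagIdeal k U)
    (fun q => EnvAlg k U ⊗[k] extPow k n q) where
  d := kosDiff b
  aug := (diagIdeal k U).mkQ ∘ₗ
    (freeRankOne (EnvAlg k U) (extPowZeroEquiv k n)).toLinearMap
  exact_d := exact_kosDiff b
  exact_aug := exact_freeRankOne _ _ _ (range_kosDiff_zero b)
  aug_surjective := (Submodule.mkQ_surjective _).comp (LinearEquiv.surjective _)

end KoszulResolution

/-! ### The Hodge star -/

section Duality

variable {k : Type*} [Field k] {n : ℕ} {M : Type*} [AddCommGroup M] [Module k M]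

variable (k) in
/-- The sign of the shuffle that moves the elements of `T` to the front, up to a sign that only
depends on the cardinality of `T`. -/
noncomputable def shuffleSign (T : Finset (Fin n)) : k := ∏ i ∈ T, (-1) ^ (i : ℕ)

theorem shuffleSign_mul_self (T : Finset (Fin n)) : shuffleSign k T * shuffleSign k T = 1 := by
  rw [shuffleSign, ← Finset.prod_mul_distrib]
  exact Finset.prod_eq_one fun i _ => by rw [← mul_pow]; simp

/-- The elements below `i` lie either in `T` or in its complement, and there are `i` of them. -/
theorem koszulSign_mul_compl (i : Fin n) (T : Finset (Fin n)) :
    koszulSign k i T * koszulSign k i Tᶜ = (-1) ^ (i : ℕ) := by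
  rw [koszulSign, koszulSign, ← pow_add, ← Finset.card_union_of_disjoint
    (Finset.disjoint_filter_filter disjoint_compl_right), ← Finset.filter_union,
    Finset.union_compl]
  congr 1
  rw [Finset.filter_gt_eq_Iio, Fin.card_Iio]

theorem shuffleSign_insert {i : Fin n} {T : Finset (Fin n)} (h : i ∉ T) :
    shuffleSign k (insert i T) = koszulSign k i T * koszulSign k i Tᶜ * shuffleSign k T := by
  rw [shuffleSign, Finset.prod_insert h, koszulSign_mul_compl]
  rfl

/-- The Hodge star `Hom(⋀ g, M) → M ⊗ ⋀ g`, `f ↦ ∑ T, ± f(e_T) ⊗ e_{Tᶜ}`. -/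
noncomputable def hodgeStar : (Fock k n →ₗ[k] M) →ₗ[k] M ⊗[k] Fock k n :=
  ∑ T : Finset (Fin n), shuffleSign k T •
    ((TensorProduct.mk k M (Fock k n)).flip (Finsupp.single Tᶜ 1) ∘ₗ
      LinearMap.applyₗ (Finsupp.single T 1))

theorem hodgeStar_apply (f : Fock k n →ₗ[k] M) : hodgeStar f =
    ∑ T : Finset (Fin n), shuffleSign k T • (f (Finsupp.single T 1) ⊗ₜ Finsupp.single Tᶜ 1) := by
  simp [hodgeStar, LinearMap.sum_apply]

/-- A sum over all subsets, with each `T` that avoids `i` paired with `T ∪ {i}`. -/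
theorem sum_finset_eq (i : Fin n) {X : Type*} [AddCommMonoid X] (F : Finset (Fin n) → X) :
    ∑ T, F T = ∑ T with i ∉ T, (F T + F (insert i T)) := by
  rw [← Finset.sum_filter_add_sum_filter_not _ (fun T => i ∉ T), Finset.sum_add_distrib]
  congr 1
  refine Finset.sum_nbij' (fun T => T.erase i) (fun T => insert i T) ?_ ?_ ?_ ?_ ?_ <;>
    simp +contextual [Finset.insert_erase]

theorem annihilation_single_one (i : Fin n) (T : Finset (Fin n)) :
    annihilation k i (Finsupp.single T 1) =
      if i ∈ T then koszulSign k i T • Finsupp.single (T.erase i) 1 else 0 := by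
  rw [annihilation_single, Finsupp.smul_single, smul_eq_mul, one_mul, mul_one]

theorem creation_single_one (i : Fin n) (T : Finset (Fin n)) :
    creation k i (Finsupp.single T 1) =
      if i ∈ T then 0 else koszulSign k i T • Finsupp.single (insert i T) 1 := by
  rw [creation_single, Finsupp.smul_single, smul_eq_mul, one_mul, mul_one]

/-- The Hodge star turns precomposition with an annihilation operator into the same operator
on `⋀ g`. -/
theorem hodgeStar_annihilation (f : Fock k n →ₗ[k] M) (i : Fin n) :
    hodgeStar (f ∘ₗ annihilation k i) = (annihilation k i).lTensor M (hodgeStar f) := by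
  rw [hodgeStar_apply, hodgeStar_apply, map_sum, sum_finset_eq i, sum_finset_eq i]
  refine Finset.sum_congr rfl fun T hT => ?_
  have hT : i ∉ T := (Finset.mem_filter.1 hT).2
  have hc : (insert i T)ᶜ = Tᶜ.erase i := by ext j; simp
  have h1 := koszulSign_mul_self k i T
  have h2 : (insert i T).erase i = T := Finset.erase_insert hT
  simp only [LinearMap.comp_apply, annihilation_single_one, hc, map_zero,
    TensorProduct.zero_tmul, smul_zero, map_smul, LinearMap.lTensor_tmul,
    Finset.mem_insert_self, if_true, Finset.notMem_erase, if_false, TensorProduct.tmul_zero,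
    Finset.mem_compl, hT, not_false_eq_true, zero_add, add_zero, koszulSign_insert_self,
    shuffleSign_insert hT, h2, TensorProduct.tmul_smul, ← TensorProduct.smul_tmul', smul_smul]
  congr 1
  linear_combination (koszulSign k i Tᶜ * shuffleSign k T) * h1

/-- The Hodge star turns precomposition with a creation operator into the same operator on `⋀ g`. -/
theorem hodgeStar_creation (f : Fock k n →ₗ[k] M) (i : Fin n) :
    hodgeStar (f ∘ₗ creation k i) = (creation k i).lTensor M (hodgeStar f) := by
  rw [hodgeStar_apply, hodgeStar_apply, map_sum, sum_finset_eq i, sum_finset_eq i]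
  refine Finset.sum_congr rfl fun T hT => ?_
  have hT : i ∉ T := (Finset.mem_filter.1 hT).2
  have hc : insert i (insert i T)ᶜ = Tᶜ := by
    ext j; by_cases h : j = i <;> simp [h, hT]
  have hk : koszulSign k i (insert i T)ᶜ = koszulSign k i Tᶜ := by
    rw [← hc, koszulSign_insert_self]
  have h1 := koszulSign_mul_self k i Tᶜ
  simp only [LinearMap.comp_apply, creation_single_one, map_zero,
    TensorProduct.zero_tmul, smul_zero, map_smul, LinearMap.lTensor_tmul,
    Finset.mem_insert_self, if_true, if_false, TensorProduct.tmul_zero, not_true_eq_false,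
    Finset.mem_compl, hT, not_false_eq_true, zero_add, add_zero, hk, hc,
    shuffleSign_insert hT, TensorProduct.tmul_smul, ← TensorProduct.smul_tmul', smul_smul]
  congr 1
  linear_combination -(koszulSign k i T * shuffleSign k T) * h1

theorem hodgeStar_comp (L : Module.End k M) (f : Fock k n →ₗ[k] M) :
    hodgeStar (L ∘ₗ f) = L.rTensor _ (hodgeStar f) := by
  simp only [hodgeStar_apply, map_sum, map_smul, LinearMap.rTensor_tmul, LinearMap.comp_apply]

/-- The inverse of the Hodge star. -/
noncomputable def hodgeStarInv : M ⊗[k] Fock k n →ₗ[k] Fock k n →ₗ[k] M :=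
  TensorProduct.lift <| LinearMap.mk₂ k (fun m w => Finsupp.linearCombination k fun T =>
      (shuffleSign k T * w Tᶜ) • m)
    (fun m m' w => by ext; simp)
    (fun c m w => by ext; simp [smul_comm c])
    (fun m w w' => by ext; simp [mul_add, add_smul])
    (fun c m w => by ext; simp [smul_smul]; congr 1; ring)

theorem hodgeStarInv_tmul_single (m : M) (w : Fock k n) (T : Finset (Fin n)) :
    hodgeStarInv (m ⊗ₜ w) (Finsupp.single T 1) = (shuffleSign k T * w Tᶜ) • m := by
  simp [hodgeStarInv]

theorem hodgeStarInv_hodgeStar (f : Fock k n →ₗ[k] M) : hodgeStarInv (hodgeStar f) = f := by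
  refine Finsupp.lhom_ext' fun T => LinearMap.ext_ring ?_
  rw [LinearMap.comp_apply, LinearMap.comp_apply, Finsupp.lsingle_apply, hodgeStar_apply, map_sum,
    LinearMap.sum_apply, Finset.sum_eq_single T]
  · rw [map_smul, LinearMap.smul_apply, hodgeStarInv_tmul_single, Finsupp.single_eq_same, mul_one,
      smul_smul, shuffleSign_mul_self, one_smul]
  · intro S _ hS
    rw [map_smul, LinearMap.smul_apply, hodgeStarInv_tmul_single,
      Finsupp.single_eq_of_ne (fun h => hS (compl_injective h).symm), mul_zero, zero_smul,
      smul_zero]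
  · exact fun h => absurd (Finset.mem_univ T) h

theorem hodgeStar_hodgeStarInv (t : M ⊗[k] Fock k n) : hodgeStar (hodgeStarInv t) = t := by
  refine LinearMap.congr_fun (f := hodgeStar ∘ₗ hodgeStarInv) (g := LinearMap.id)
    (TensorProduct.ext (LinearMap.ext fun m => Finsupp.lhom_ext' fun S => LinearMap.ext_ring ?_)) t
  change hodgeStar (hodgeStarInv (m ⊗ₜ Finsupp.single S 1)) = m ⊗ₜ Finsupp.single S 1
  rw [hodgeStar_apply, Finset.sum_eq_single Sᶜ]
  · rw [hodgeStarInv_tmul_single, compl_compl, Finsupp.single_eq_same, mul_one,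
      ← TensorProduct.smul_tmul', smul_smul, shuffleSign_mul_self, one_smul]
  · intro T _ hT
    rw [hodgeStarInv_tmul_single, Finsupp.single_eq_of_ne (fun h => hT (compl_eq_comm.1 h).symm),
      mul_zero, zero_smul, TensorProduct.zero_tmul, smul_zero]
  · exact fun h => absurd (Finset.mem_univ _) h

variable {g : Type*} [LieRing g] [LieAlgebra k g] (b : Module.Basis (Fin n) k g)

/-- The trace of `ad x`, in the basis `b`. -/
noncomputable def adTrace : g →ₗ[k] k :=
  ∑ i, b.coord i ∘ₗ (LieModule.toEnd k g g : g →ₗ[k] Module.End k g).flip (b i)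

theorem adTrace_apply (x : g) : adTrace b x = ∑ i, b.repr ⁅x, b i⁆ i := by
  simp [adTrace]

theorem hodgeStar_wedge (f : Fock k n →ₗ[k] M) (x : g) :
    hodgeStar (f ∘ₗ wedge b x) = (wedge b x).lTensor M (hodgeStar f) := by
  have h : f ∘ₗ wedge b x = ∑ i, b.repr x i • (f ∘ₗ creation k i) := by
    rw [wedge_eq_sum]; ext; simp
  rw [h, map_sum, wedge_eq_sum]
  simp only [map_smul, hodgeStar_creation]
  rw [← LinearMap.coe_lTensorHom, map_sum, LinearMap.sum_apply]
  simp

/-- Normal ordering: reversing the factors of `bracketFock` changes its sign, up to a trace term. -/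
theorem sum_annihilation_annihilation_wedge :
    (∑ i, ∑ j, if i < j then annihilation k j * annihilation k i * wedge b ⁅b i, b j⁆ else 0) =
      -bracketFock b - ∑ j, adTrace b (b j) • annihilation k j := by
  have h : ∀ i j, annihilation k j * annihilation k i * wedge b ⁅b i, b j⁆ =
      -(wedge b ⁅b i, b j⁆ * annihilation k i * annihilation k j) +
      (b.repr ⁅b i, b j⁆ i • annihilation k j + b.repr ⁅b j, b i⁆ j • annihilation k i) := by
    intro i j
    have h1 := eq_sub_of_add_eq (annihilation_wedge b i ⁅b i, b j⁆)
    have h2 := eq_sub_of_add_eq (annihilation_wedge b j ⁅b i, b j⁆)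
    have h3 := eq_neg_of_add_eq_zero_left (annihilation_anticomm k j i)
    rw [mul_assoc, h1, mul_sub, ← mul_assoc (annihilation k j), h2, ← lie_skew (b i) (b j)]
    simp only [sub_mul, mul_smul_comm, mul_one, smul_mul_assoc, one_mul, mul_assoc, h3, map_neg,
      Finsupp.neg_apply, neg_mul, mul_neg, neg_smul]
    abel
  have e : ∀ i j : Fin n, (if i < j then b.repr ⁅b i, b j⁆ i • annihilation k j else 0) +
      (if j < i then b.repr ⁅b i, b j⁆ i • annihilation k j else 0) =
      b.repr ⁅b i, b j⁆ i • annihilation k j := by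
    intro i j
    rcases lt_trichotomy i j with h | rfl | h
    · rw [if_pos h, if_neg h.not_gt, add_zero]
    · rw [lie_self, map_zero, Finsupp.zero_apply, zero_smul, if_neg (lt_irrefl _), add_zero]
    · rw [if_neg h.not_gt, if_pos h, zero_add]
  have h' : ∑ j, adTrace b (b j) • annihilation k j =
      -∑ i, ∑ j, b.repr ⁅b i, b j⁆ i • annihilation k j := by
    rw [Finset.sum_comm, ← Finset.sum_neg_distrib]
    refine Finset.sum_congr rfl fun j _ => ?_
    rw [adTrace_apply, Finset.sum_smul, ← Finset.sum_neg_distrib]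
    refine Finset.sum_congr rfl fun i _ => ?_
    rw [← lie_skew, map_neg, Finsupp.neg_apply, neg_smul]
  rw [h', sub_neg_eq_add, Finset.sum_congr rfl fun i _ =>
    Finset.sum_congr rfl fun j _ => (e i j).symm]
  simp only [Finset.sum_add_distrib]
  rw [Finset.sum_comm (f := fun i j => if j < i then _ else _)]
  simp only [bracketFock, ← Finset.sum_add_distrib, ← Finset.sum_neg_distrib]
  refine Finset.sum_congr rfl fun i _ => Finset.sum_congr rfl fun j _ => ?_
  split_ifs
  · exact h i j
  · simp

theorem hodgeStar_bracketFock (f : Fock k n →ₗ[k] M) :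
    hodgeStar (f ∘ₗ bracketFock b) =
      (-bracketFock b - ∑ j, adTrace b (b j) • annihilation k j).lTensor M (hodgeStar f) := by
  have h : f ∘ₗ bracketFock b = ∑ i, ∑ j, if i < j then
      ((f ∘ₗ wedge b ⁅b i, b j⁆) ∘ₗ annihilation k i) ∘ₗ annihilation k j else 0 := by
    refine LinearMap.ext fun w => ?_
    simp only [bracketFock, LinearMap.comp_apply, LinearMap.sum_apply, map_sum]
    refine Finset.sum_congr rfl fun i _ => Finset.sum_congr rfl fun j _ => ?_
    split_ifs
    · rfl
    · simp
  rw [h, ← sum_annihilation_annihilation_wedge, ← LinearMap.coe_lTensorHom]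
  simp only [map_sum, LinearMap.sum_apply]
  refine Finset.sum_congr rfl fun i _ => Finset.sum_congr rfl fun j _ => ?_
  split_ifs
  · rw [hodgeStar_annihilation, hodgeStar_annihilation, hodgeStar_wedge, LinearMap.coe_lTensorHom,
      LinearMap.lTensor_mul, LinearMap.lTensor_mul]
    rfl
  · rw [map_zero, map_zero, LinearMap.zero_apply]

variable (l : g →ₗ[k] Module.End k M)

/-- The Chevalley–Eilenberg differential on `Hom(⋀ g, M)`. -/
noncomputable def ceCodiff : (Fock k n →ₗ[k] M) →ₗ[k] (Fock k n →ₗ[k] M) :=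
  ∑ i, (LinearMap.lcomp k M (annihilation k i)) ∘ₗ LinearMap.llcomp k (Fock k n) M M (l (b i)) -
    LinearMap.lcomp k M (bracketFock b)

theorem ceCodiff_apply (f : Fock k n →ₗ[k] M) : ceCodiff b l f =
    ∑ i, (l (b i) ∘ₗ f) ∘ₗ annihilation k i - f ∘ₗ bracketFock b := by
  simp [ceCodiff, LinearMap.sum_apply]
  rfl

/-- The action `x ↦ -l x - tr (ad x)` whose homology is dual to the cohomology of `l`. -/
noncomputable def dualAct : g →ₗ[k] Module.End k M :=
  -l - (LinearMap.toSpanSingleton k (Module.End k M) 1) ∘ₗ adTrace b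

theorem dualAct_apply (x : g) (m : M) : dualAct b l x m = -l x m - adTrace b x • m := rfl

/-- Poincaré duality for the Chevalley–Eilenberg complexes. -/
theorem hodgeStar_ceCodiff (f : Fock k n →ₗ[k] M) :
    hodgeStar (ceCodiff b l f) = -ceDiff b (dualAct b l) (hodgeStar f) := by
  have h : ∀ i, TensorProduct.map (dualAct b l (b i)) (annihilation k i) =
      -((l (b i)).rTensor _ ∘ₗ (annihilation k i).lTensor M) -
        adTrace b (b i) • (annihilation k i).lTensor M := fun i =>
    TensorProduct.ext' fun m w => by
      simp [dualAct_apply, TensorProduct.sub_tmul, TensorProduct.neg_tmul,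
        TensorProduct.smul_tmul']
  have h2 : (∑ j, adTrace b (b j) • annihilation k j).lTensor M =
      ∑ j, adTrace b (b j) • (annihilation k j).lTensor M := by
    rw [← LinearMap.coe_lTensorHom, map_sum]
    simp
  rw [ceCodiff_apply, map_sub, map_sum, hodgeStar_bracketFock, ceDiff]
  simp only [hodgeStar_annihilation, hodgeStar_comp, h, LinearMap.lTensor_sub,
    LinearMap.lTensor_neg,
    h2, LinearMap.sub_apply, LinearMap.sum_apply, LinearMap.neg_apply, LinearMap.smul_apply,
    LinearMap.comp_apply, Finset.sum_sub_distrib, Finset.sum_neg_distrib]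
  have hc : ∀ (L : Module.End k M) (F : Module.End k (Fock k n)) (t : M ⊗[k] Fock k n),
      F.lTensor M (L.rTensor _ t) = L.rTensor _ (F.lTensor M t) := fun L F t => by
    rw [← LinearMap.comp_apply, ← LinearMap.comp_apply, LinearMap.lTensor_comp_rTensor,
      LinearMap.rTensor_comp_lTensor]
  simp only [hc]
  abel

end Duality

/-! ### Duality in each degree and the top exterior power -/

section GradedDuality

variable {k : Type*} [Field k] {n : ℕ} {M : Type*} [AddCommGroup M] [Module k M]

variable (k n M) in
/-- The Hodge star from `Hom(⋀^q g, M)` to `M ⊗ ⋀^p g`; it is an isomorphism if `p + q = n`. -/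
noncomputable def hodgeGr (p q : ℕ) : (extPow k n q →ₗ[k] M) →ₗ[k] M ⊗[k] extPow k n p :=
  (extProj k n p).lTensor M ∘ₗ hodgeStar ∘ₗ LinearMap.lcomp k M (extProj k n q)

theorem hodgeGr_apply (p q : ℕ) (f : extPow k n q →ₗ[k] M) :
    hodgeGr k n M p q f = (extProj k n p).lTensor M (hodgeStar (f ∘ₗ extProj k n q)) := rfl

variable (k n M) in
/-- The inverse of the Hodge star from `Hom(⋀^q g, M)` to `M ⊗ ⋀^p g` if `p + q = n`. -/
noncomputable def hodgeGrInv (p q : ℕ) : M ⊗[k] extPow k n p →ₗ[k] (extPow k n q →ₗ[k] M) :=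
  LinearMap.lcomp k M (extPow k n q).subtype ∘ₗ hodgeStarInv ∘ₗ (extPow k n p).subtype.lTensor M

theorem hodgeGrInv_apply (p q : ℕ) (t : M ⊗[k] extPow k n p) : hodgeGrInv k n M p q t =
    hodgeStarInv ((extPow k n p).subtype.lTensor M t) ∘ₗ (extPow k n q).subtype := rfl

theorem extProj_comp_subtype (q : ℕ) : extProj k n q ∘ₗ (extPow k n q).subtype = LinearMap.id :=
  LinearMap.ext fun w => extProj_of_mem w.2

theorem card_compl_eq_iff {p q : ℕ} (h : p + q = n) (T : Finset (Fin n)) :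
    Tᶜ.card = p ↔ T.card = q := by
  have := T.card_add_card_compl
  rw [Fintype.card_fin] at this
  omega

theorem hodgeGrInv_hodgeGr {p q : ℕ} (h : p + q = n) (f : extPow k n q →ₗ[k] M) :
    hodgeGrInv k n M p q (hodgeGr k n M p q f) = f := by
  have h1 : (extPow k n p).subtype.lTensor M (hodgeGr k n M p q f) =
      hodgeStar (f ∘ₗ extProj k n q) := by
    rw [hodgeGr_apply, hodgeStar_apply, map_sum, map_sum]
    refine Finset.sum_congr rfl fun T _ => ?_
    rw [map_smul, map_smul, LinearMap.lTensor_tmul, LinearMap.lTensor_tmul]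
    by_cases hT : T.card = q
    · rw [extProj_of_mem (single_mem_extPow ((card_compl_eq_iff h T).2 hT) 1)]
      rfl
    · rw [LinearMap.comp_apply, extProj_of_mem_ne hT (single_mem_extPow rfl 1), map_zero,
        TensorProduct.zero_tmul, TensorProduct.zero_tmul]
  rw [hodgeGrInv_apply, h1, hodgeStarInv_hodgeStar, LinearMap.comp_assoc, extProj_comp_subtype,
    LinearMap.comp_id]

theorem hodgeGr_hodgeGrInv {p q : ℕ} (h : p + q = n) (t : M ⊗[k] extPow k n p) :
    hodgeGr k n M p q (hodgeGrInv k n M p q t) = t := by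
  have h1 : hodgeGrInv k n M p q t ∘ₗ extProj k n q =
      hodgeStarInv ((extPow k n p).subtype.lTensor M t) := by
    refine LinearMap.congr_fun (f := LinearMap.lcomp k M (extProj k n q) ∘ₗ hodgeGrInv k n M p q)
      (g := hodgeStarInv ∘ₗ (extPow k n p).subtype.lTensor M)
      (TensorProduct.ext' fun m w => Finsupp.lhom_ext' fun T => LinearMap.ext_ring ?_) t
    change hodgeStarInv (m ⊗ₜ (w : Fock k n)) (extProj k n q (Finsupp.single T 1)) =
      hodgeStarInv (m ⊗ₜ (w : Fock k n)) (Finsupp.single T 1)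
    by_cases hT : T.card = q
    · rw [extProj_of_mem (single_mem_extPow hT 1)]
    · have hw : (w : Fock k n) Tᶜ = 0 :=
        (Finsupp.mem_supported' k _).1 w.2 _ fun h' => hT ((card_compl_eq_iff h T).1 h')
      rw [extProj_of_mem_ne hT (single_mem_extPow rfl 1), hodgeStarInv_tmul_single, hw, mul_zero,
        zero_smul]
      exact map_zero _
  rw [hodgeGr_apply, h1, hodgeStar_hodgeStarInv, extProj_lTensor_subtype]

variable {g : Type*} [LieRing g] [LieAlgebra k g] (b : Module.Basis (Fin n) k g)
  (l : g →ₗ[k] Module.End k M)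

/-- The Chevalley–Eilenberg differential from `Hom(⋀^q g, M)` to `Hom(⋀^(q+1) g, M)`. -/
noncomputable def coGr (q : ℕ) : (extPow k n q →ₗ[k] M) →ₗ[k] (extPow k n (q + 1) →ₗ[k] M) :=
  ∑ i, LinearMap.lcomp k M (annLow k i q) ∘ₗ LinearMap.llcomp k (extPow k n q) M M (l (b i)) -
    LinearMap.lcomp k M (brLow b q)

theorem coGr_apply (q : ℕ) (f : extPow k n q →ₗ[k] M) (w : extPow k n (q + 1)) :
    coGr b l q f w = ∑ i, l (b i) (f (annLow k i q w)) - f (brLow b q w) := by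
  simp [coGr, LinearMap.sum_apply]

theorem coGr_comp_extProj (q : ℕ) (f : extPow k n q →ₗ[k] M) :
    coGr b l q f ∘ₗ extProj k n (q + 1) = ceCodiff b l (f ∘ₗ extProj k n q) := by
  refine LinearMap.ext fun w => ?_
  rw [LinearMap.comp_apply, coGr_apply, ceCodiff_apply]
  simp only [LinearMap.sub_apply, LinearMap.sum_apply, LinearMap.comp_apply, extProj_annihilation,
    extProj_bracketFock]

/-- The Hodge star anticommutes with the differentials, for the cochain action `l` and the chain
action `dualAct b l` that differs from it by the trace of `ad`. -/
theorem hodgeGr_coGr (p q : ℕ) (f : extPow k n q →ₗ[k] M) :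
    hodgeGr k n M p (q + 1) (coGr b l q f) =
      -ceGr b (dualAct b l) p (hodgeGr k n M (p + 1) q f) := by
  rw [hodgeGr_apply, coGr_comp_extProj, hodgeStar_ceCodiff, map_neg, extProj_ceDiff, hodgeGr_apply]

theorem subsingleton_extPow {q : ℕ} (h : n < q) : Subsingleton (extPow k n q) := by
  refine ⟨fun v w => Subtype.ext ?_⟩
  have : ∀ v ∈ extPow k n q, v = 0 := fun v hv => by
    refine extPow_le (p := ⊥) (fun T hT => ?_) hv
    have := T.card_le_univ
    rw [Fintype.card_fin] at this
    omega
  rw [this v v.2, this w w.2]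

/-- Poincaré duality for Lie algebra cohomology. -/
theorem nonempty_cohomologyEquivHomology {p q : ℕ} (h : p + q = n) :
    Nonempty (Cohomology (C := fun q => extPow k n q →ₗ[k] M) (coGr b l) q ≃ₗ[k]
      Homology (C := fun q => M ⊗[k] extPow k n q) (ceGr b (dualAct b l)) p) := by
  have inj : ∀ {p q : ℕ}, p + q = n → Function.Injective (hodgeGr k n M p q) := fun h =>
    Function.LeftInverse.injective (hodgeGrInv_hodgeGr h)
  refine nonempty_subquotientEquiv (hodgeGr k n M p q) (hodgeGrInv k n M p q)
    (fun f hf => ?_) (fun f hf => ?_) (fun t ht => ?_) (fun t ht => ?_) (fun f _ => ?_)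
    (fun t _ => ?_)
  · cases p with
    | zero => exact Submodule.mem_top
    | succ p =>
      change ceGr b (dualAct b l) p _ = 0
      rw [← neg_eq_zero, ← hodgeGr_coGr, LinearMap.mem_ker.1 hf, map_zero]
  · cases q with
    | zero => rw [(Submodule.mem_bot k).1 hf, map_zero]; exact zero_mem _
    | succ q =>
      obtain ⟨f, rfl⟩ := hf
      rw [hodgeGr_coGr]
      exact neg_mem ⟨_, rfl⟩
  · cases p with
    | zero =>
      have := subsingleton_extPow (k := k) (n := n) (q := q + 1) (by omega)
      exact LinearMap.mem_ker.2 (Subsingleton.elim _ _)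
    | succ p =>
      have ht : ceGr b (dualAct b l) p t = 0 := ht
      refine inj (p := p) (q := q + 1) (by omega) ?_
      rw [hodgeGr_coGr, hodgeGr_hodgeGrInv h, ht, neg_zero, map_zero]
  · obtain ⟨t, rfl⟩ := ht
    cases q with
    | zero =>
      have := subsingleton_extPow (k := k) (n := n) (q := p + 1) (by omega)
      rw [Subsingleton.elim t 0, map_zero, map_zero]
      exact zero_mem _
    | succ q =>
      refine ⟨-hodgeGrInv k n M (p + 1) q t, inj h ?_⟩
      rw [map_neg, map_neg, hodgeGr_coGr, hodgeGr_hodgeGrInv (by omega), neg_neg,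
        hodgeGr_hodgeGrInv h]
  · rw [hodgeGrInv_hodgeGr h, sub_self]; exact zero_mem _
  · rw [hodgeGr_hodgeGrInv h, sub_self]; exact zero_mem _

end GradedDuality

section Twist

variable (k : Type*) [Field k] (g : Type*) [LieRing g] [LieAlgebra k g]

/-- The generator of `⋀^n g*` given by the dual of a basis. -/
noncomputable def topForm (b : Module.Basis (Fin (Module.finrank k g)) k g) : TopDual k g :=
  exteriorPower.ιMulti k _ b.dualBasis

variable {k g} (b : Module.Basis (Fin (Module.finrank k g)) k g)

/-- Its pairing with the wedge of the basis is the determinant of the identity matrix. -/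
theorem topForm_ne_zero : topForm k g b ≠ 0 := by
  intro h
  have h1 := congrArg (exteriorPower.pairingDual k (Module.Dual k g) (Module.finrank k g)
    (exteriorPower.ιMulti k _ fun i => Module.Dual.eval k g (b i))) h
  rw [topForm, exteriorPower.pairingDual_ιMulti_ιMulti, map_zero] at h1
  have h2 : (Matrix.of fun i j => Module.Dual.eval k g (b j) (b.dualBasis i)) = 1 := by
    ext i j
    simp [Matrix.one_apply, Finsupp.single_apply, eq_comm]
  rw [h2, Matrix.det_one] at h1
  exact one_ne_zero h1

theorem finrank_topDual [FiniteDimensional k g] : Module.finrank k (TopDual k g) = 1 := by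
  rw [exteriorPower.finrank_eq, Subspace.dual_finrank_eq, Nat.choose_self]

/-- Only the diagonal coefficients of `ad x` survive, since all other terms repeat a factor. -/
theorem coadTop_topForm (x : g) :
    coadTop k g x (topForm k g b) = -(adTrace b x • topForm k g b) := by
  rw [topForm, coadTop_ιMulti, adTrace_apply, Finset.sum_smul, ← Finset.sum_neg_distrib]
  refine Finset.sum_congr rfl fun i _ => ?_
  have h : -(b.dualBasis i ∘ₗ LieAlgebra.ad k g x) =
      ∑ j, (-b.repr ⁅x, b j⁆ i) • b.dualBasis j := by
    refine b.ext fun j => ?_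
    simp [LinearMap.sum_apply, Finsupp.single_apply]
  rw [h, AlternatingMap.map_update_sum, Finset.sum_eq_single i]
  · rw [AlternatingMap.map_update_smul, Function.update_eq_self, neg_smul]
  · intro j _ hj
    rw [AlternatingMap.map_update_smul, AlternatingMap.map_update_self _ _ hj.symm, smul_zero]
  · exact fun h => absurd (Finset.mem_univ i) h

theorem coadTop_eq [FiniteDimensional k g] (x : g) (w : TopDual k g) :
    coadTop k g x w = -(adTrace b x • w) := by
  obtain ⟨c, rfl⟩ := exists_smul_eq_of_finrank_eq_one finrank_topDual (topForm_ne_zero b) w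
  rw [map_smul, coadTop_topForm, smul_neg, smul_comm]

/-- The twist `M ⊗ ⋀^n g*` is isomorphic to `M` as a vector space. -/
noncomputable def twistEquiv (ε : k ≃ₗ[k] TopDual k g) (M : Type*) [AddCommGroup M] [Module k M] :
    M ≃ₗ[k] CoadjointTwist k g M :=
  (TensorProduct.rid k M).symm ≪≫ₗ ε.lTensor M ≪≫ₗ toTwist k g M

theorem twistEquiv_apply (ε : k ≃ₗ[k] TopDual k g) (M : Type*) [AddCommGroup M] [Module k M]
    (m : M) : twistEquiv ε M m = toTwist k g M (m ⊗ₜ ε 1) := rfl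

end Twist

/-! ### Lie algebra (co)homology and the twist -/

section Comparison

variable {k : Type*} [Field k] {g : Type*} [LieRing g] [LieAlgebra k g] {n : ℕ}
  (b : Module.Basis (Fin n) k g)

local notation "U" => UniversalEnvelopingAlgebra k g

section

variable (M : Type*) [AddCommGroup M] [Module k M] [Module (UniversalEnvelopingAlgebra k g) M]
  [Module (UniversalEnvelopingAlgebra k g)ᵐᵒᵖ M]
  [IsScalarTower k (UniversalEnvelopingAlgebra k g) M]
  [IsScalarTower k (UniversalEnvelopingAlgebra k g)ᵐᵒᵖ M]
  [SMulCommClass (UniversalEnvelopingAlgebra k g) (UniversalEnvelopingAlgebra k g)ᵐᵒᵖ M]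

variable (k g) in
/-- The action `m ↦ m x - x m` of `x ∈ g` on a bimodule. -/
noncomputable def commAct : g →ₗ[k] Module.End k M :=
  (leftAct k U M).toLinearMap ∘ₗ innerElt k U ∘ₗ toU k

theorem commAct_apply (x : g) (m : M) :
    commAct k g M x m = MulOpposite.op (toU k x) • m - toU k x • m := by
  change leftAct k U M (1 ⊗ₜ MulOpposite.op (toU k x) - toU k x ⊗ₜ 1) m = _
  rw [map_sub, LinearMap.sub_apply, leftAct_tmul, leftAct_tmul, one_smul, one_smul]

variable (k g) in
/-- The action `m ↦ x m - m x` of `x ∈ g` on a bimodule. -/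
noncomputable def commActOp : g →ₗ[k] Module.End k M :=
  (MulOpposite.opLinearEquiv k : Module.End k M ≃ₗ[k] _).symm.toLinearMap ∘ₗ
    (rightAct k U M).toLinearMap ∘ₗ innerElt k U ∘ₗ toU k

theorem commActOp_apply (x : g) (m : M) :
    commActOp k g M x m = toU k x • m - MulOpposite.op (toU k x) • m := by
  change (rightAct k U M (1 ⊗ₜ MulOpposite.op (toU k x) - toU k x ⊗ₜ 1)).unop m = _
  rw [map_sub, MulOpposite.unop_sub, LinearMap.sub_apply, rightAct_tmul, rightAct_tmul,
    MulOpposite.op_one, MulOpposite.unop_one, one_smul, one_smul, MulOpposite.unop_op]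

theorem homMap_kosDiff (q : ℕ) :
    homMap (leftAct k U M) (kosDiff b q) = coGr b (commAct k g M) q := by
  refine LinearMap.ext fun f => LinearMap.ext fun w => ?_
  rw [homMap_apply, kosDiff_tmul, coGr_apply, map_sub, map_sum, homExt_tmul, map_one]
  simp only [homExt_tmul, one_mul]
  rfl

theorem tensorMap_kosDiff (q : ℕ) :
    tensorMap (rightAct k U M) (kosDiff b q) = ceGr b (commActOp k g M) q := by
  refine TensorProduct.ext' fun m w => ?_
  rw [tensorMap_tmul, kosDiff_tmul, ceGr_tmul, map_sub, map_sum, LinearMap.sub_apply,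
    LinearMap.sum_apply, tensorExt_tmul, map_one]
  simp only [tensorExt_tmul, one_mul]
  rfl

/-- Hochschild cohomology of `U(g)` is Lie algebra cohomology. -/
theorem nonempty_hochschildCohomologyEquiv_coGr (q : ℕ) :
    Nonempty (HochschildCohomology k U M q ≃ₗ[k]
      Cohomology (C := fun q => extPow k n q →ₗ[k] M) (coGr b (commAct k g M)) q) := by
  obtain ⟨e₁⟩ := nonempty_hochschildCohomologyEquiv k U M q
  obtain ⟨e₂⟩ := Resolution.nonempty_cohomologyEquiv (barResolution k U) (koszulResolution b)
    (leftAct k U M) q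
  have h : (fun q => homMap (leftAct k U M) ((koszulResolution b).d q)) =
      coGr b (commAct k g M) := funext fun q => homMap_kosDiff b M q
  rw [h] at e₂
  exact ⟨e₁.trans e₂⟩

/-- Hochschild homology of `U(g)` is Lie algebra homology. -/
theorem nonempty_hochschildHomologyEquiv_ceGr (q : ℕ) :
    Nonempty (HochschildHomology k U M q ≃ₗ[k]
      Homology (C := fun q => M ⊗[k] extPow k n q) (ceGr b (commActOp k g M)) q) := by
  obtain ⟨e₁⟩ := nonempty_hochschildHomologyEquiv k U M q
  obtain ⟨e₂⟩ := Resolution.nonempty_homologyEquiv (barResolution k U) (koszulResolution b)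
    (rightAct k U M) q
  have h : (fun q => tensorMap (rightAct k U M) ((koszulResolution b).d q)) =
      ceGr b (commActOp k g M) := funext fun q => tensorMap_kosDiff b M q
  rw [h] at e₂
  exact ⟨e₁.trans e₂⟩

theorem subsingleton_hochschildCohomology [FiniteDimensional k g] {q : ℕ}
    (h : Module.finrank k g < q) :
    Subsingleton (HochschildCohomology k U M q) := by
  let b := Module.finBasis k g
  obtain ⟨e⟩ := nonempty_hochschildCohomologyEquiv_coGr b M q
  have := subsingleton_extPow (k := k) h
  have : Subsingleton (extPow k (Module.finrank k g) q →ₗ[k] M) :=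
    ⟨fun f f' => LinearMap.ext fun w => by
    rw [Subsingleton.elim w 0, map_zero, map_zero]⟩
  have := (Submodule.mkQ_surjective ((coboundaries (C := fun q => extPow k _ q →ₗ[k] M)
    (coGr b (commAct k g M)) q).submoduleOf
      (LinearMap.ker (coGr b (commAct k g M) q)))).subsingleton
  exact e.toEquiv.subsingleton

theorem subsingleton_hochschildHomology [FiniteDimensional k g] {q : ℕ}
    (h : Module.finrank k g < q) :
    Subsingleton (HochschildHomology k U M q) := by
  let b := Module.finBasis k g
  obtain ⟨e⟩ := nonempty_hochschildHomologyEquiv_ceGr b M q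
  have := subsingleton_extPow (k := k) h
  have : Subsingleton (M ⊗[k] extPow k (Module.finrank k g) q) := ⟨fun x y => by
    have h0 : ∀ z : M ⊗[k] extPow k (Module.finrank k g) q, z = 0 := fun z => by
      induction z with
      | zero => rfl
      | add x y hx hy => rw [hx, hy, add_zero]
      | tmul m w => rw [Subsingleton.elim w 0, TensorProduct.tmul_zero]
    rw [h0 x, h0 y]⟩
  have := (Submodule.mkQ_surjective ((LinearMap.range (ceGr b (commActOp k g M) q)).submoduleOf
    (cycles (C := fun q => M ⊗[k] extPow k _ q) (ceGr b (commActOp k g M)) q))).subsingleton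
  exact e.toEquiv.subsingleton

end

variable [FiniteDimensional k g] (b : Module.Basis (Fin (Module.finrank k g)) k g)
  (M : Type*) [AddCommGroup M] [Module k M] [Module (UniversalEnvelopingAlgebra k g) M]
  [Module (UniversalEnvelopingAlgebra k g)ᵐᵒᵖ M]
  [IsScalarTower k (UniversalEnvelopingAlgebra k g) M]
  [IsScalarTower k (UniversalEnvelopingAlgebra k g)ᵐᵒᵖ M]
  [SMulCommClass (UniversalEnvelopingAlgebra k g) (UniversalEnvelopingAlgebra k g)ᵐᵒᵖ M]

/-- On `M ⊗ ⋀^n g*`, the element `x ∈ g` acts by `m ↦ x m - m x - tr (ad x) m`. -/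
theorem commActOp_twistEquiv (ε : k ≃ₗ[k] TopDual k g) (x : g) (m : M) :
    commActOp k g (CoadjointTwist k g M) x (twistEquiv ε M m) =
      twistEquiv ε M (dualAct b (commAct k g M) x m) := by
  have h : ∀ y : g, UniversalEnvelopingAlgebra.ι k y = toU k y := fun _ => rfl
  rw [commActOp_apply, twistEquiv_apply, twistEquiv_apply, left_smul_tmul, ← h, right_smul_tmul,
    coadTop_eq b, neg_neg, dualAct_apply, commAct_apply, h, ← map_add, ← map_sub,
    TensorProduct.tmul_smul, TensorProduct.smul_tmul', ← TensorProduct.add_tmul,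
    ← TensorProduct.sub_tmul, neg_sub, sub_sub]

end Comparison

end HochschildDuality

theorem corollary2p4 (k : Type*) [Field k] (g : Type*) [LieRing g] [LieAlgebra k g]
    [FiniteDimensional k g] (M : Type*) [AddCommGroup M] [Module k M]
    [Module (UniversalEnvelopingAlgebra k g) M] [Module (UniversalEnvelopingAlgebra k g)ᵐᵒᵖ M]
    [IsScalarTower k (UniversalEnvelopingAlgebra k g) M]
    [IsScalarTower k (UniversalEnvelopingAlgebra k g)ᵐᵒᵖ M]
    [SMulCommClass (UniversalEnvelopingAlgebra k g) (UniversalEnvelopingAlgebra k g)ᵐᵒᵖ M] :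
    (∀ p q : ℕ, p + q = Module.finrank k g →
      Nonempty (HochschildDuality.HochschildCohomology k (UniversalEnvelopingAlgebra k g) M q ≃ₗ[k]
        HochschildDuality.HochschildHomology k (UniversalEnvelopingAlgebra k g)
          (HochschildDuality.CoadjointTwist k g M) p)) ∧
    (∀ q : ℕ, Module.finrank k g < q → Subsingleton
      (HochschildDuality.HochschildCohomology k (UniversalEnvelopingAlgebra k g) M q)) ∧
    (∀ p : ℕ, Module.finrank k g < p → Subsingleton
      (HochschildDuality.HochschildHomology k (UniversalEnvelopingAlgebra k g)
        (HochschildDuality.CoadjointTwist k g M) p)) := by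
  let b := Module.finBasis k g
  refine ⟨fun p q h => ?_, fun q h => HochschildDuality.subsingleton_hochschildCohomology M h,
    fun p h => HochschildDuality.subsingleton_hochschildHomology _ h⟩
  obtain ⟨ε⟩ := Module.nonempty_linearEquiv_of_finrank_eq_one
    (HochschildDuality.finrank_topDual (k := k) (g := g))
  obtain ⟨e₁⟩ := HochschildDuality.nonempty_hochschildCohomologyEquiv_coGr b M q
  obtain ⟨e₂⟩ := HochschildDuality.nonempty_cohomologyEquivHomology b
    (HochschildDuality.commAct k g M) h
  obtain ⟨e₃⟩ := HochschildDuality.nonempty_homologyEquiv_ceGr b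
    (HochschildDuality.twistEquiv ε M)
    (HochschildDuality.commActOp_twistEquiv b M ε) p
  obtain ⟨e₄⟩ := HochschildDuality.nonempty_hochschildHomologyEquiv_ceGr b
    (HochschildDuality.CoadjointTwist k g M) p
  exact ⟨e₁.trans (e₂.trans (e₃.trans e₄.symm))⟩
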